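/- Let $r \ge 2$ and $m, m', t \ge 1$ be integers. Let $L_r$ be the ring with generators $x_1,\dots,x_r,y_1,\dots,y_r$ and relations $x_i y_j = \delta_{ij}$ $(1 \le i,j \le r)$ and $\sum_{i=1}^r y_i x_i = 1$, with the involution $*$ (the anti-automorphism interchanging $x_i$ and $y_i$ for all $i$) and with positive cone the additive monoid generated by all monomials in the $x_i$ and $y_i$. Let $L_r^{\otimes t}$ be the tensor product over $\mathbb{Z}$ of $t$ copies of $L_r$. Make the matrix ring $M_m(L_r^{\otimes t})$ into a partially ordered ring with involution, where the involution is the conjugate transpose induced by $*$ on each tensor factor, and the positive cone is the additive monoid generated by the elements $e_{ij}\,(p_1\otimes\cdots\otimes p_t)$ with $e_{ij}$ a matrix unit and each $p_\ell$ in the positive cone of $L_r$. Let $PU_m(L_r^{\otimes t})$ be the group of all $u \in M_m(L_r^{\otimes t})$ with $u \ge 0$ and $uu^* = u^*u = 1$. Let $tV_{r,m}$ be the Brin-Higman-Thompson group, defined as follows. Consider the words $e_i b_1\cdots b_t$, where $1 \le i \le m$ and $b_\ell$ is an element of the free monoid on letters $y_{\ell,1},\dots,y_{\ell,r}$ (letters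 with different first index commute). An expansion of a finite set $A$ of words replaces some $a \in A$ by $a y_{\ell,1},\dots,a y_{\ell,r}$ for some $\ell$. Bases are the sets obtained from $\{e_1,\dots,e_m\}$ by finitely many expansions. An expansion of a bijection $\phi : A \to B$ between bases replaces some $a \mapsto \phi(a)$ by $a y_{\ell,k} \mapsto \phi(a) y_{\ell,k}$ $(1 \le k \le r)$. The elements of $tV_{r,m}$ are the classes of bijections between bases for the smallest equivalence relation identifying each bijection with its expansions, and the product is induced by the composition of composable representatives. If $\gcd(m', r-1) = \gcd(m, r-1)$, then: 1. $M_{m'}(L_r^{\otimes t})$ and $M_m(L_r^{\otimes t})$ are isomorphic as partially ordered rings with involution, that is, there is a ring isomorphism between them that commutes with the involutions and preserves and reflects the order; 2. the groups $PU_{m'}(L_r^{\otimes t})$ and $PU_m(L_r^{\otimes t})$ are isomorphic; 3. the groups $tV_{r,m'}$ and $tV_{r,m}$ are isomorphic. -/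

import Mathlib

noncomputable section

open scoped TensorProduct

/-! ## The Leavitt ring -/

/-- The defining relations of the Leavitt ring of type `(1, r)` on the generators
`x i` (encoded as `Sum.inl i`) and `y i` (encoded as `Sum.inr i`):
`x i * y j = δ i j` and `∑ i, y i * x i = 1`. -/
inductive LeavittRel (r : ℕ) :
    FreeAlgebra ℤ (Fin r ⊕ Fin r) → FreeAlgebra ℤ (Fin r ⊕ Fin r) → Prop
  | x_mul_y (i j : Fin r) : LeavittRel r
      (FreeAlgebra.ι ℤ (Sum.inl i) * FreeAlgebra.ι ℤ (Sum.inr j)) (if i = j then 1 else 0)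
  | sum_y_mul_x : LeavittRel r
      (∑ i : Fin r, FreeAlgebra.ι ℤ (Sum.inr i) * FreeAlgebra.ι ℤ (Sum.inl i)) 1

/-- The Leavitt ring `L_r`: the ring universal with an invertible `1 × r` matrix. -/
def LeavittRing (r : ℕ) : Type := RingQuot (LeavittRel r)

namespace LeavittRing

variable {r : ℕ}

instance : Ring (LeavittRing r) := inferInstanceAs (Ring (RingQuot (LeavittRel r)))

/-- The canonical map from the free ring. -/
def mk (r : ℕ) : FreeAlgebra ℤ (Fin r ⊕ Fin r) →+* LeavittRing r :=
  RingQuot.mkRingHom (LeavittRel r)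

/-- The generators `x i`. -/
def x (i : Fin r) : LeavittRing r := mk r (FreeAlgebra.ι ℤ (Sum.inl i))

/-- The generators `y i`. -/
def y (i : Fin r) : LeavittRing r := mk r (FreeAlgebra.ι ℤ (Sum.inr i))

theorem x_mul_y (i j : Fin r) : (x i * y j : LeavittRing r) = if i = j then 1 else 0 := by
  have h := RingQuot.mkRingHom_rel (LeavittRel.x_mul_y i j)
  rw [map_mul] at h
  refine Eq.trans h ?_
  split_ifs
  · exact map_one (mk r)
  · exact map_zero (mk r)

theorem sum_y_mul_x : (∑ i : Fin r, y i * x i : LeavittRing r) = 1 := by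
  have h := RingQuot.mkRingHom_rel (LeavittRel.sum_y_mul_x (r := r))
  rw [map_sum, map_one] at h
  refine Eq.trans ?_ h
  exact Finset.sum_congr rfl fun i _ => (map_mul (mk r) _ _).symm

/-- The universal property: a ring homomorphism out of `L_r`. -/
def lift {R : Type*} [Ring R] (a b : Fin r → R) (hab : ∀ i j, a i * b j = if i = j then 1 else 0)
    (hba : ∑ i, b i * a i = 1) : LeavittRing r →+* R :=
  RingQuot.lift ⟨(FreeAlgebra.lift ℤ (Sum.elim a b)).toRingHom, by
    rintro _ _ (⟨i, j⟩ | _)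
    · by_cases h : i = j <;> simp [h, hab]
    · simp [hba]⟩

section lift
variable {R : Type*} [Ring R] (a b : Fin r → R) (hab : ∀ i j, a i * b j = if i = j then 1 else 0)
    (hba : ∑ i, b i * a i = 1)

theorem lift_x (i : Fin r) : lift a b hab hba (x i) = a i :=
  (RingQuot.lift_mkRingHom_apply _ _ _).trans (by simp)

theorem lift_y (i : Fin r) : lift a b hab hba (y i) = b i :=
  (RingQuot.lift_mkRingHom_apply _ _ _).trans (by simp)

end lift

theorem hom_ext {R : Type*} [Ring R] {f g : LeavittRing r →+* R} (hx : ∀ i, f (x i) = g (x i))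
    (hy : ∀ i, f (y i) = g (y i)) : f = g := by
  apply RingQuot.ringQuot_ext (r := LeavittRel r)
  have h : ((f.comp (mk r)).toIntAlgHom : FreeAlgebra ℤ (Fin r ⊕ Fin r) →ₐ[ℤ] R)
      = (g.comp (mk r)).toIntAlgHom := by
    apply FreeAlgebra.hom_ext
    funext s
    cases s with
    | inl i => exact hx i
    | inr i => exact hy i
  ext s
  exact DFunLike.congr_fun h s

/-- The involution, as a ring homomorphism to the opposite ring: it interchanges `x i` and `y i`. -/
def starHom (r : ℕ) : LeavittRing r →+* (LeavittRing r)ᵐᵒᵖ :=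
  lift (fun i => MulOpposite.op (y i)) (fun i => MulOpposite.op (x i))
    (fun i j => by
      rw [← MulOpposite.op_mul, x_mul_y]
      by_cases h : i = j
      · simp [h]
      · simp [h, Ne.symm h])
    (by
      simp only [← MulOpposite.op_mul]
      rw [← MulOpposite.op_one, ← sum_y_mul_x]
      exact (map_sum MulOpposite.opAddEquiv _ _).symm)

theorem unop_starHom_unop_starHom (a : LeavittRing r) :
    (starHom r (starHom r a).unop).unop = a := by
  let F : LeavittRing r →+* LeavittRing r :=
    ((RingEquiv.opOp (LeavittRing r)).symm : (LeavittRing r)ᵐᵒᵖᵐᵒᵖ →+* LeavittRing r).comp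
      ((RingHom.op (starHom r)).comp (starHom r))
  have hF : F = RingHom.id _ := by
    apply hom_ext <;> intro i <;> simp [F, starHom, lift_x, lift_y]
  exact DFunLike.congr_fun hF a

instance : StarRing (LeavittRing r) where
  star a := (starHom r a).unop
  star_involutive := unop_starHom_unop_starHom
  star_mul a b := by simp
  star_add a b := by simp

@[simp] theorem star_x (i : Fin r) : star (x i : LeavittRing r) = y i :=
  congrArg MulOpposite.unop (lift_x _ _ _ _ i)

@[simp] theorem star_y (i : Fin r) : star (y i : LeavittRing r) = x i :=
  congrArg MulOpposite.unop (lift_y _ _ _ _ i)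

/-- The multiplicative monoid of monomials in the `x i` and `y i`. -/
def monomials (r : ℕ) : Submonoid (LeavittRing r) :=
  Submonoid.closure (Set.range x ∪ Set.range y)

/-- The positive cone of `L_r`: the additive monoid generated by the monomials. -/
def posCone (r : ℕ) : AddSubmonoid (LeavittRing r) :=
  AddSubmonoid.closure (monomials r : Set (LeavittRing r))

end LeavittRing

/-! ## Tensor powers -/

/-- The ring `L_r ⊗ ⋯ ⊗ L_r` (tensor product over `ℤ` of `t` copies). -/
def LeavittTensor (r t : ℕ) : Type := ⨂[ℤ] _ : Fin t, LeavittRing r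

namespace LeavittTensor

variable {r t : ℕ}

instance : Ring (LeavittTensor r t) := inferInstanceAs (Ring (⨂[ℤ] _ : Fin t, LeavittRing r))

/-- The pure tensor `p 0 ⊗ ⋯ ⊗ p (t - 1)`. -/
def tprod (p : Fin t → LeavittRing r) : LeavittTensor r t := PiTensorProduct.tprod ℤ p

theorem tprod_mul (p q : Fin t → LeavittRing r) : tprod p * tprod q = tprod (p * q) :=
  PiTensorProduct.tprod_mul_tprod p q

theorem tprod_one : tprod (1 : Fin t → LeavittRing r) = 1 := rfl

theorem induction {motive : LeavittTensor r t → Prop} (hp : ∀ p, motive (tprod p))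
    (hn : ∀ a, motive a → motive (-a))
    (ha : ∀ a b, motive a → motive b → motive (a + b)) (a : LeavittTensor r t) : motive a := by
  have h0 : motive 0 := by
    have := ha _ _ (hp 1) (hn _ (hp 1))
    rwa [add_neg_cancel] at this
  refine PiTensorProduct.induction_on (R := ℤ) (motive := motive) a ?_ ha
  intro n p
  have hnat : ∀ k : ℕ, motive (k • tprod p) := by
    intro k
    induction k with
    | zero => simpa using h0
    | succ k ih => rw [succ_nsmul]; exact ha _ _ ih (hp p)
  have key : ∀ n : ℤ, motive (n • tprod p) := by
    intro n
    obtain ⟨k, rfl | rfl⟩ := n.eq_nat_or_neg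
    · rw [natCast_zsmul]; exact hnat k
    · rw [neg_zsmul, natCast_zsmul]; exact hn _ (hnat k)
  exact (int_smul_eq_zsmul (PiTensorProduct.instModule) n (tprod p)) ▸ key n

/-- The involution of the tensor power as an additive map, acting on each of the factors. -/
def starHom (r t : ℕ) : LeavittTensor r t →+ LeavittTensor r t :=
  (PiTensorProduct.map (R := ℤ) (s := fun _ : Fin t => LeavittRing r)
    (fun _ => (starAddEquiv (R := LeavittRing r)).toAddMonoidHom.toIntLinearMap)).toAddMonoidHom

theorem starHom_tprod (p : Fin t → LeavittRing r) : starHom r t (tprod p) = tprod (star p) :=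
  PiTensorProduct.map_tprod _ _

instance : StarRing (LeavittTensor r t) where
  star a := starHom r t a
  star_involutive a := by
    change starHom r t (starHom r t a) = a
    induction a using induction with
    | hp p => rw [starHom_tprod, starHom_tprod, star_star]
    | hn a ha => rw [map_neg, map_neg, ha]
    | ha a b ha hb => rw [map_add, map_add, ha, hb]
  star_add a b := map_add _ a b
  star_mul a b := by
    induction a using induction with
    | hp p =>
      induction b using induction with
      | hp q => rw [tprod_mul, starHom_tprod, starHom_tprod, starHom_tprod, tprod_mul, star_mul]
      | hn b hb => rw [mul_neg, map_neg, map_neg, hb, neg_mul]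
      | ha b c hb hc => rw [mul_add, map_add, map_add, hb, hc, add_mul]
    | hn a ha => rw [neg_mul, map_neg, map_neg, ha, mul_neg]
    | ha a c hb hc => rw [add_mul, map_add, map_add, hb, hc, mul_add]

theorem star_tprod (p : Fin t → LeavittRing r) : star (tprod p) = tprod (star p) := starHom_tprod p

/-- The positive cone of the tensor power: the additive monoid generated by the pure tensors of
positive elements of the factors. -/
def posCone (r t : ℕ) : AddSubmonoid (LeavittTensor r t) :=
  AddSubmonoid.closure {a | ∃ p : Fin t → LeavittRing r,
    (∀ l, p l ∈ LeavittRing.posCone r) ∧ a = tprod p}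


end LeavittTensor

/-! ## The order on matrices -/

/-- The ring `M_m(L_r ⊗ ⋯ ⊗ L_r)` of `m × m` matrices over the tensor product of `t` copies
of `L_r`. -/
def LeavittMatrix (m r t : ℕ) : Type := Matrix (Fin m) (Fin m) (LeavittTensor r t)

namespace LeavittRing

variable {r : ℕ}

theorem one_mem_posCone : (1 : LeavittRing r) ∈ posCone r :=
  AddSubmonoid.subset_closure (one_mem (monomials r))

theorem mul_mem_posCone {a b : LeavittRing r} (ha : a ∈ posCone r) (hb : b ∈ posCone r) :
    a * b ∈ posCone r := by
  induction ha, hb using AddSubmonoid.closure_induction₂ with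
  | mem a b ha hb => exact AddSubmonoid.subset_closure (mul_mem ha hb)
  | zero_left a _ => simp
  | zero_right a _ => simp
  | add_left a b c _ _ _ h1 h2 => rw [add_mul]; exact add_mem h1 h2
  | add_right a b c _ _ _ h1 h2 => rw [mul_add]; exact add_mem h1 h2

theorem star_mem_monomials {a : LeavittRing r} (ha : a ∈ monomials r) : star a ∈ monomials r := by
  induction ha using Submonoid.closure_induction with
  | mem a ha =>
    rcases ha with ⟨i, rfl⟩ | ⟨i, rfl⟩
    · rw [star_x]; exact Submonoid.subset_closure (Or.inr ⟨i, rfl⟩)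
    · rw [star_y]; exact Submonoid.subset_closure (Or.inl ⟨i, rfl⟩)
  | one => rw [star_one]; exact one_mem _
  | mul a b _ _ h1 h2 => rw [star_mul]; exact mul_mem h2 h1

theorem star_mem_posCone {a : LeavittRing r} (ha : a ∈ posCone r) : star a ∈ posCone r := by
  induction ha using AddSubmonoid.closure_induction with
  | mem a ha => exact AddSubmonoid.subset_closure (star_mem_monomials ha)
  | zero => simp
  | add a b _ _ h1 h2 => rw [star_add]; exact add_mem h1 h2

/-- The action of `x i` on functions on infinite words: `(x i f) c = f (i c)`. -/
def actX (i : Fin r) : Module.End ℤ ((ℕ → Fin r) → ℤ) where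
  toFun f c := f (fun n => Nat.casesOn n i c)
  map_add' _ _ := rfl
  map_smul' _ _ := rfl

/-- The action of `y i` on functions on infinite words: `(y i f) (j c) = δ i j f c`. -/
def actY (i : Fin r) : Module.End ℤ ((ℕ → Fin r) → ℤ) where
  toFun f c := if c 0 = i then f (fun n => c (n + 1)) else 0
  map_add' f g := by funext c; by_cases h : c 0 = i <;> simp [h]
  map_smul' k f := by funext c; by_cases h : c 0 = i <;> simp [h]

/-- The action of `L_r` on functions on infinite words. -/
def act (r : ℕ) : LeavittRing r →+* Module.End ℤ ((ℕ → Fin r) → ℤ) :=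
  lift actX actY
    (fun i j => by
      apply LinearMap.ext
      intro f
      funext c
      by_cases h : i = j <;> simp [actX, actY, h])
    (by
      apply LinearMap.ext
      intro f
      funext c
      have hc : (fun n => Nat.casesOn n (c 0) fun n => c (n + 1) : ℕ → Fin r) = c := by
        funext n
        cases n <;> rfl
      simpa [actX, actY, LinearMap.sum_apply, Finset.sum_apply] using congrArg f hc)

theorem act_nonneg {a : LeavittRing r} (ha : a ∈ posCone r) (f : (ℕ → Fin r) → ℤ) (hf : 0 ≤ f) :
    0 ≤ act r a f := by
  induction ha using AddSubmonoid.closure_induction with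
  | mem a ha =>
    have ha' : a ∈ Submonoid.closure (Set.range x ∪ Set.range y) := ha
    clear ha
    induction ha' using Submonoid.closure_induction generalizing f with
    | mem a ha =>
      rcases ha with ⟨i, rfl⟩ | ⟨i, rfl⟩
      · rw [act, lift_x]; intro c; exact hf _
      · rw [act, lift_y]; intro c
        change 0 ≤ if c 0 = i then f (fun n => c (n + 1)) else 0
        split_ifs
        · exact hf _
        · exact le_rfl
    | one => simpa using hf
    | mul a b _ _ h1 h2 => rw [map_mul]; exact h1 _ (h2 _ hf)
  | zero => simp
  | add a b _ _ h1 h2 => rw [map_add]; exact add_nonneg h1 h2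

/-- An additive functional that is nonnegative on the positive cone and takes the value `1`
at `1`; it exists because there are infinite words. -/
def state (c : ℕ → Fin r) : LeavittRing r →+ ℤ where
  toFun a := act r a 1 c
  map_zero' := by simp
  map_add' a b := by simp

theorem state_one (c : ℕ → Fin r) : state c 1 = 1 := by simp [state]

theorem state_nonneg (c : ℕ → Fin r) {a : LeavittRing r} (ha : a ∈ posCone r) : 0 ≤ state c a :=
  act_nonneg ha 1 (fun _ => zero_le_one) c

/-- Every monomial is zero or of the form `y_u x_v` for words `u`, `v`. -/
theorem monomial_normal_form {a : LeavittRing r} (ha : a ∈ monomials r) :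
    a = 0 ∨ ∃ u v : List (Fin r), a = (u.map y).prod * (v.map x).prod := by
  induction ha using Submonoid.closure_induction_left with
  | one => exact Or.inr ⟨[], [], by simp⟩
  | mul_left g hg a _ ih =>
    rcases ih with rfl | ⟨u, v, rfl⟩
    · simp
    rcases hg with ⟨i, rfl⟩ | ⟨i, rfl⟩
    · cases u with
      | nil => exact Or.inr ⟨[], i :: v, by simp⟩
      | cons j u =>
        by_cases h : i = j
        · exact Or.inr ⟨u, v, by simp [← mul_assoc, x_mul_y, h]⟩
        · exact Or.inl (by simp [← mul_assoc, x_mul_y, h])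
    · exact Or.inr ⟨i :: u, v, by simp [mul_assoc]⟩

theorem prod_x_mul_prod_y (u : List (Fin r)) :
    (u.reverse.map x).prod * (u.map y).prod = (1 : LeavittRing r) := by
  induction u with
  | nil => simp
  | cons i u ih =>
    simp only [List.reverse_cons, List.map_append, List.map_cons, List.map_nil, List.prod_append,
      List.prod_cons, List.prod_nil, mul_one]
    rw [mul_assoc, ← mul_assoc (x i), x_mul_y, if_pos rfl, one_mul, ih]

theorem prod_x_mem (u : List (Fin r)) : (u.map x).prod ∈ posCone r := by
  apply AddSubmonoid.subset_closure
  refine list_prod_mem fun a ha => ?_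
  obtain ⟨i, _, rfl⟩ := List.mem_map.1 ha
  exact Submonoid.subset_closure (Or.inl ⟨i, rfl⟩)

theorem prod_y_mem (u : List (Fin r)) : (u.map y).prod ∈ posCone r := by
  apply AddSubmonoid.subset_closure
  refine list_prod_mem fun a ha => ?_
  obtain ⟨i, _, rfl⟩ := List.mem_map.1 ha
  exact Submonoid.subset_closure (Or.inr ⟨i, rfl⟩)

theorem state_pos (c : ℕ → Fin r) {a : LeavittRing r} (ha : a ∈ posCone r) :
    a = 0 ∨ ∃ b ∈ posCone r, ∃ d ∈ posCone r, 0 < state c (b * a * d) := by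
  induction ha using AddSubmonoid.closure_induction with
  | mem a ha =>
    rcases monomial_normal_form ha with rfl | ⟨u, v, rfl⟩
    · exact Or.inl rfl
    · refine Or.inr ⟨_, prod_x_mem u.reverse, _, prod_y_mem v.reverse, ?_⟩
      have h := prod_x_mul_prod_y v.reverse
      rw [List.reverse_reverse] at h
      rw [← mul_assoc, prod_x_mul_prod_y, one_mul, h, state_one]
      exact zero_lt_one
  | zero => exact Or.inl rfl
  | add a a' ha ha' h1 h2 =>
    rcases h1 with rfl | ⟨b, hb, d, hd, h⟩
    · simpa using h2
    · refine Or.inr ⟨b, hb, d, hd, ?_⟩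
      rw [mul_add, add_mul, map_add]
      exact add_pos_of_pos_of_nonneg h
        (state_nonneg c (mul_mem_posCone (mul_mem_posCone hb ha') hd))

end LeavittRing

namespace LeavittTensor

variable {r t : ℕ}

theorem one_mem_posCone : (1 : LeavittTensor r t) ∈ posCone r t :=
  AddSubmonoid.subset_closure ⟨1, fun _ => LeavittRing.one_mem_posCone, rfl⟩

theorem mul_mem_posCone {a b : LeavittTensor r t} (ha : a ∈ posCone r t) (hb : b ∈ posCone r t) :
    a * b ∈ posCone r t := by
  induction ha, hb using AddSubmonoid.closure_induction₂ with
  | mem a b ha hb =>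
    obtain ⟨p, hp, rfl⟩ := ha
    obtain ⟨q, hq, rfl⟩ := hb
    exact AddSubmonoid.subset_closure
      ⟨p * q, fun l => LeavittRing.mul_mem_posCone (hp l) (hq l), tprod_mul p q⟩
  | zero_left a _ => simp
  | zero_right a _ => simp
  | add_left a b c _ _ _ h1 h2 => rw [add_mul]; exact add_mem h1 h2
  | add_right a b c _ _ _ h1 h2 => rw [mul_add]; exact add_mem h1 h2

theorem star_mem_posCone {a : LeavittTensor r t} (ha : a ∈ posCone r t) :
    star a ∈ posCone r t := by
  induction ha using AddSubmonoid.closure_induction with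
  | mem a ha =>
    obtain ⟨p, hp, rfl⟩ := ha
    exact AddSubmonoid.subset_closure
      ⟨star p, fun l => LeavittRing.star_mem_posCone (hp l), star_tprod p⟩
  | zero => simp
  | add a b _ _ h1 h2 => rw [star_add]; exact add_mem h1 h2

/-- The product functional `p 0 ⊗ ⋯ ⊗ p (t - 1) ↦ ∏ l, state (c l) (p l)`. -/
def state (c : Fin t → ℕ → Fin r) : LeavittTensor r t →+ ℤ :=
  (PiTensorProduct.lift (R := ℤ) (s := fun _ : Fin t => LeavittRing r)
    ((MultilinearMap.mkPiAlgebra ℤ (Fin t) ℤ).compLinearMap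
      fun l => (LeavittRing.state (c l)).toIntLinearMap)).toAddMonoidHom

theorem state_tprod (c : Fin t → ℕ → Fin r) (p : Fin t → LeavittRing r) :
    state c (tprod p) = ∏ l, LeavittRing.state (c l) (p l) :=
  (PiTensorProduct.lift.tprod p).trans (by simp)

theorem state_nonneg (c : Fin t → ℕ → Fin r) {a : LeavittTensor r t} (ha : a ∈ posCone r t) :
    0 ≤ state c a := by
  induction ha using AddSubmonoid.closure_induction with
  | mem a ha =>
    obtain ⟨p, hp, rfl⟩ := ha
    rw [state_tprod]
    exact Finset.prod_nonneg fun l _ => LeavittRing.state_nonneg _ (hp l)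
  | zero => simp
  | add a b _ _ h1 h2 => rw [map_add]; exact add_nonneg h1 h2

theorem state_pos (c : Fin t → ℕ → Fin r) {a : LeavittTensor r t} (ha : a ∈ posCone r t) :
    a = 0 ∨ ∃ b ∈ posCone r t, ∃ d ∈ posCone r t, 0 < state c (b * a * d) := by
  induction ha using AddSubmonoid.closure_induction with
  | mem a ha =>
    obtain ⟨p, hp, rfl⟩ := ha
    by_cases h : ∃ l, p l = 0
    · obtain ⟨l, hl⟩ := h
      exact Or.inl ((PiTensorProduct.tprod ℤ).map_coord_zero l hl)
    · have h' : ∀ l, ∃ b ∈ LeavittRing.posCone r, ∃ d ∈ LeavittRing.posCone r,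
          0 < LeavittRing.state (c l) (b * p l * d) := fun l =>
        (LeavittRing.state_pos (c l) (hp l)).resolve_left fun hl => h ⟨l, hl⟩
      choose b hb d hd hbd using h'
      refine Or.inr ⟨tprod b, AddSubmonoid.subset_closure ⟨b, hb, rfl⟩, tprod d,
        AddSubmonoid.subset_closure ⟨d, hd, rfl⟩, ?_⟩
      rw [tprod_mul, tprod_mul, state_tprod]
      exact Finset.prod_pos fun l _ => hbd l
  | zero => exact Or.inl rfl
  | add a a' ha ha' h1 h2 =>
    rcases h1 with rfl | ⟨b, hb, d, hd, h⟩
    · simpa using h2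
    · refine Or.inr ⟨b, hb, d, hd, ?_⟩
      rw [mul_add, add_mul, map_add]
      exact add_pos_of_pos_of_nonneg h
        (state_nonneg c (mul_mem_posCone (mul_mem_posCone hb ha') hd))

/-- A nonempty sum of nonzero monomials is not zero. -/
theorem posCone_antisymm {a : LeavittTensor r t} (ha : a ∈ posCone r t) (ha' : -a ∈ posCone r t) :
    a = 0 := by
  by_cases hc : Nonempty (Fin t → ℕ → Fin r)
  · obtain ⟨c⟩ := hc
    rcases state_pos c ha with h | ⟨b, hb, d, hd, h⟩
    · exact h
    · have := state_nonneg c (mul_mem_posCone (mul_mem_posCone hb ha') hd)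
      rw [mul_neg, neg_mul, map_neg] at this
      omega
  · rw [not_nonempty_iff, isEmpty_pi] at hc
    obtain ⟨l, hl⟩ := hc
    rw [isEmpty_pi] at hl
    obtain ⟨_, hl⟩ := hl
    have h1 : (1 : LeavittTensor r t) = 0 := by
      refine (PiTensorProduct.tprod ℤ).map_coord_zero l ?_
      change (1 : LeavittRing r) = 0
      rw [← LeavittRing.sum_y_mul_x]
      exact Finset.sum_of_isEmpty _
    rw [← one_mul a, h1, zero_mul]

end LeavittTensor

namespace LeavittMatrix

variable {m r t : ℕ}

instance : Ring (LeavittMatrix m r t) :=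
  inferInstanceAs (Ring (Matrix (Fin m) (Fin m) (LeavittTensor r t)))

/-- The involution is the conjugate transpose. -/
instance : StarRing (LeavittMatrix m r t) :=
  inferInstanceAs (StarRing (Matrix (Fin m) (Fin m) (LeavittTensor r t)))

/-- The positive cone of `M_m(L_r ⊗ ⋯ ⊗ L_r)`: the additive monoid generated by the products
`e i j ⊗ p` of matrix units and positive elements of `L_r ⊗ ⋯ ⊗ L_r`. -/
def posCone (m r t : ℕ) : AddSubmonoid (LeavittMatrix m r t) :=
  AddSubmonoid.closure {a | ∃ (i j : Fin m), ∃ p ∈ LeavittTensor.posCone r t,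
    a = Matrix.single i j p}

theorem mem_posCone_iff {a : LeavittMatrix m r t} :
    a ∈ posCone m r t ↔ ∀ i j, a i j ∈ LeavittTensor.posCone r t := by
  constructor
  · intro h
    induction h using AddSubmonoid.closure_induction with
    | mem a ha =>
      obtain ⟨i, j, p, hp, rfl⟩ := ha
      intro k l
      rw [Matrix.single_apply]
      split_ifs
      · exact hp
      · exact zero_mem _
    | zero => intro i j; exact zero_mem _
    | add a b _ _ h1 h2 => intro i j; exact add_mem (h1 i j) (h2 i j)
  · intro h
    have ha := Matrix.matrix_eq_sum_single (show Matrix (Fin m) (Fin m) (LeavittTensor r t) from a)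
    rw [show a = _ from ha]
    exact AddSubmonoid.sum_mem _ fun i _ => AddSubmonoid.sum_mem _ fun j _ =>
      AddSubmonoid.subset_closure ⟨i, j, _, h i j, rfl⟩

/-- The partial order whose positive cone is `posCone m r t`. -/
instance : PartialOrder (LeavittMatrix m r t) where
  le a b := b - a ∈ posCone m r t
  le_refl a := by simp
  le_trans a b c h1 h2 := by
    have := add_mem h1 h2
    rwa [show b - a + (c - b) = c - a by abel] at this
  le_antisymm a b h1 h2 := by
    rw [mem_posCone_iff] at h1 h2
    refine Matrix.ext fun i j => ?_
    have h3 : b i j - a i j ∈ LeavittTensor.posCone r t := h1 i j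
    have h4 : a i j - b i j ∈ LeavittTensor.posCone r t := h2 i j
    rw [← neg_sub] at h4
    exact (sub_eq_zero.1 (LeavittTensor.posCone_antisymm h3 h4)).symm

theorem le_def {a b : LeavittMatrix m r t} : a ≤ b ↔ b - a ∈ posCone m r t := Iff.rfl

theorem nonneg_iff {a : LeavittMatrix m r t} : 0 ≤ a ↔ a ∈ posCone m r t := by
  rw [le_def, sub_zero]

theorem one_mem_posCone : (1 : LeavittMatrix m r t) ∈ posCone m r t := by
  rw [mem_posCone_iff]
  intro i j
  change (1 : Matrix (Fin m) (Fin m) (LeavittTensor r t)) i j ∈ _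
  rw [Matrix.one_apply]
  split_ifs
  · exact LeavittTensor.one_mem_posCone
  · exact zero_mem _

theorem mul_mem_posCone {a b : LeavittMatrix m r t} (ha : a ∈ posCone m r t)
    (hb : b ∈ posCone m r t) : a * b ∈ posCone m r t := by
  rw [mem_posCone_iff] at *
  intro i j
  have h : ∑ k, a i k * b k j ∈ LeavittTensor.posCone r t :=
    AddSubmonoid.sum_mem _ fun k _ => LeavittTensor.mul_mem_posCone (ha i k) (hb k j)
  exact h

theorem star_mem_posCone {a : LeavittMatrix m r t} (ha : a ∈ posCone m r t) :
    star a ∈ posCone m r t := by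
  rw [mem_posCone_iff] at *
  intro i j
  exact LeavittTensor.star_mem_posCone (ha j i)

instance : IsOrderedRing (LeavittMatrix m r t) where
  add_le_add_left a b h c := by
    rw [le_def] at *
    rwa [add_sub_add_right_eq_sub]
  zero_le_one := nonneg_iff.2 one_mem_posCone
  mul_le_mul_of_nonneg_left a ha b c h := by
    rw [le_def, ← mul_sub]
    exact mul_mem_posCone (nonneg_iff.1 ha) h
  mul_le_mul_of_nonneg_right a ha b c h := by
    rw [le_def, ← sub_mul]
    exact mul_mem_posCone h (nonneg_iff.1 ha)

theorem star_nonneg {a : LeavittMatrix m r t} (ha : 0 ≤ a) : 0 ≤ star a :=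
  nonneg_iff.2 (star_mem_posCone (nonneg_iff.1 ha))

/-- The group of positive unitary `m × m` matrices over `L_r ⊗ ⋯ ⊗ L_r`. -/
def PU (m r t : ℕ) : Subgroup (unitary (LeavittMatrix m r t)) where
  carrier := {u | 0 ≤ (u : LeavittMatrix m r t)}
  one_mem' := zero_le_one (α := LeavittMatrix m r t)
  mul_mem' {u v} ha hb := mul_nonneg (a := (u : LeavittMatrix m r t)) (b := v) ha hb
  inv_mem' ha := star_nonneg ha

end LeavittMatrix

/-! ## The Brin-Higman-Thompson groups -/

namespace BrinHigmanThompson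

variable {m r t : ℕ}

/-- The elements `b_1 ⋯ b_t` of the monoid generated by the `y_{ℓ,k}`: this monoid is the product
of `t` free monoids of rank `r`. -/
abbrev MultiWord (r t : ℕ) : Type := Fin t → List (Fin r)

/-- The elements `e_i b_1 ⋯ b_t`, with `b_ℓ` a word in the letters `y_{ℓ,k}`. -/
abbrev Word (m r t : ℕ) : Type := Fin m × MultiWord r t

/-- The letter `y_{ℓ,k}`. -/
def letter (l : Fin t) (k : Fin r) : MultiWord r t := Function.update (fun _ => []) l [k]

/-- Right multiplication `a ↦ a u`. -/
def app (a : Word m r t) (u : MultiWord r t) : Word m r t := (a.1, fun l => a.2 l ++ u l)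

/-- The simultaneous right multiplication `(a, b) ↦ (a u, b u)`. -/
def app₂ (p : Word m r t × Word m r t) (u : MultiWord r t) : Word m r t × Word m r t :=
  (app p.1 u, app p.2 u)

/-- The expansion `∂_{ℓ,a} A = (A \ {a}) ∪ {a y_{ℓ,1}, …, a y_{ℓ,r}}` of a set of words. -/
def expand (l : Fin t) (a : Word m r t) (A : Finset (Word m r t)) : Finset (Word m r t) :=
  A.erase a ∪ Finset.univ.image fun k => app a (letter l k)

/-- The expansion of (the graph of) a bijection `φ`: the pair `(a, b)`, `b = φ a`, is replaced by
the pairs `(a y_{ℓ,k}, b y_{ℓ,k})`. -/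
def expand₂ (l : Fin t) (p : Word m r t × Word m r t) (G : Finset (Word m r t × Word m r t)) :
    Finset (Word m r t × Word m r t) :=
  G.erase p ∪ Finset.univ.image fun k => app₂ p (letter l k)

/-- The set `{e_1, …, e_m}`. -/
def initial (m r t : ℕ) : Finset (Word m r t) := Finset.univ.image fun i => (i, fun _ => [])

/-- Bases: the smallest collection of finite sets of words that contains `{e_1, …, e_m}` and is
closed under expansions of all kinds. -/
inductive IsBasis : Finset (Word m r t) → Prop
  | initial : IsBasis (initial m r t)
  | expand (l : Fin t) {A : Finset (Word m r t)} {a : Word m r t} (ha : a ∈ A) (hA : IsBasis A) :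
      IsBasis (expand l a A)

/-- A bijection between two bases, given by its graph. -/
@[ext]
structure BasisBij (m r t : ℕ) where
  /-- The graph of the bijection. -/
  graph : Finset (Word m r t × Word m r t)
  injOn_fst : Set.InjOn Prod.fst (graph : Set (Word m r t × Word m r t))
  injOn_snd : Set.InjOn Prod.snd (graph : Set (Word m r t × Word m r t))
  isBasis_dom : IsBasis (graph.image Prod.fst)
  isBasis_cod : IsBasis (graph.image Prod.snd)

/-- `ψ` is an expansion of `φ`. -/
def BasisBij.Expansion (φ ψ : BasisBij m r t) : Prop :=
  ∃ (l : Fin t), ∃ p ∈ φ.graph, ψ.graph = expand₂ l p φ.graph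

end BrinHigmanThompson

/-- The Brin-Higman-Thompson group `tV_{r,m}`: the equivalence classes of bijections between bases,
for the smallest equivalence relation that identifies each bijection with all of its expansions. -/
def BrinHigmanThompsonGroup (t r m : ℕ) : Type :=
  Quot (BrinHigmanThompson.BasisBij.Expansion (m := m) (r := r) (t := t))

namespace BrinHigmanThompson

variable {m r t : ℕ}

/-! ### Words -/

theorem app_nil (a : Word m r t) : app a (fun _ => []) = a := by
  simp [app]

theorem app_app (a : Word m r t) (u v : MultiWord r t) :
    app (app a u) v = app a (fun l => u l ++ v l) := by
  simp [app]

theorem app_cancel {a : Word m r t} {u v : MultiWord r t} (h : app a u = app a v) : u = v := by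
  funext l
  have := congrFun (congrArg Prod.snd h) l
  exact List.append_cancel_left this

theorem letter_inj {l : Fin t} {k k' : Fin r} {u v : MultiWord r t}
    (h : (fun i => letter l k i ++ u i) = fun i => letter l k' i ++ v i) : k = k' := by
  have := congrFun h l
  simp [letter] at this
  exact this.1

theorem app_letter_inj {a : Word m r t} {l : Fin t} {k k' : Fin r}
    (h : app a (letter l k) = app a (letter l k')) : k = k' := by
  have h' := app_cancel h
  exact letter_inj (l := l) (u := fun _ => []) (v := fun _ => []) (by rw [h'])

theorem app_letter_comm (a : Word m r t) {l l' : Fin t} (hl : l ≠ l') (k k' : Fin r) :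
    app (app a (letter l k)) (letter l' k') = app (app a (letter l' k')) (letter l k) := by
  rw [app_app, app_app]
  congr 1
  funext i
  by_cases h : i = l
  · subst h; simp [letter, hl]
  · simp [letter, h]

/-! ### Independence of bases -/

/-- No two distinct elements of `A` have a common right multiple. -/
def Indep (A : Finset (Word m r t)) : Prop :=
  ∀ a ∈ A, ∀ b ∈ A, ∀ u v, app a u = app b v → a = b

theorem mem_expand {l : Fin t} {a b : Word m r t} {A : Finset (Word m r t)} :
    b ∈ expand l a A ↔ (b ≠ a ∧ b ∈ A) ∨ ∃ k, b = app a (letter l k) := by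
  simp [expand, eq_comm]

theorem mem_expand₂ {l : Fin t} {p q : Word m r t × Word m r t}
    {G : Finset (Word m r t × Word m r t)} :
    q ∈ expand₂ l p G ↔ (q ≠ p ∧ q ∈ G) ∨ ∃ k, q = app₂ p (letter l k) := by
  simp [expand₂, eq_comm]

theorem Indep.expand {A : Finset (Word m r t)} (hA : Indep A) {a : Word m r t} (ha : a ∈ A)
    (l : Fin t) : Indep (expand l a A) := by
  intro b hb c hc u v h
  rw [mem_expand] at hb hc
  rcases hb with ⟨hb, hbA⟩ | ⟨k, rfl⟩ <;> rcases hc with ⟨hc, hcA⟩ | ⟨k', rfl⟩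
  · exact hA b hbA c hcA u v h
  · rw [app_app] at h
    exact absurd (hA b hbA a ha _ _ h) hb
  · rw [app_app] at h
    exact absurd (hA a ha c hcA _ _ h).symm hc
  · rw [app_app, app_app] at h
    rw [letter_inj (app_cancel h)]

theorem IsBasis.indep {A : Finset (Word m r t)} (hA : IsBasis A) : Indep A := by
  induction hA with
  | initial =>
    intro a ha b hb u v h
    simp only [BrinHigmanThompson.initial, Finset.mem_image, Finset.mem_univ, true_and] at ha hb
    obtain ⟨i, rfl⟩ := ha
    obtain ⟨j, rfl⟩ := hb
    have : i = j := congrArg Prod.fst h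
    rw [this]
  | expand l ha _ ih => exact ih.expand ha l

/-! ### Common expansions of bases -/

/-- One-step expansion of sets of words. -/
def Step (A C : Finset (Word m r t)) : Prop := ∃ l, ∃ a ∈ A, C = expand l a A

/-- Iterated expansion of sets of words. -/
abbrev Reach : Finset (Word m r t) → Finset (Word m r t) → Prop := Relation.ReflTransGen Step

theorem Indep.reach {A C : Finset (Word m r t)} (hA : Indep A) (h : Reach A C) : Indep C := by
  induction h with
  | refl => exact hA
  | tail _ h ih => obtain ⟨l, a, ha, rfl⟩ := h; exact ih.expand ha l

theorem IsBasis.reach {A C : Finset (Word m r t)} (hA : IsBasis A) (h : Reach A C) :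
    IsBasis C := by
  induction h with
  | refl => exact hA
  | tail _ h ih => obtain ⟨l, a, ha, rfl⟩ := h; exact ih.expand l ha

theorem IsBasis.reach_initial {A : Finset (Word m r t)} (hA : IsBasis A) :
    Reach (BrinHigmanThompson.initial m r t) A := by
  induction hA with
  | initial => exact .refl
  | expand l ha _ ih => exact ih.tail ⟨l, _, ha, rfl⟩

/-- The set obtained by expanding all the elements of `A` in direction `l`. -/
def full (l : Fin t) (A : Finset (Word m r t)) : Finset (Word m r t) :=
  A.biUnion fun a => Finset.univ.image fun k => app a (letter l k)

theorem mem_full {l : Fin t} {b : Word m r t} {A : Finset (Word m r t)} :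
    b ∈ full l A ↔ ∃ a ∈ A, ∃ k, b = app a (letter l k) := by
  simp [full, eq_comm]

theorem Indep.eq_of_app {A : Finset (Word m r t)} (hA : Indep A) {a b : Word m r t} (ha : a ∈ A)
    (hb : b ∈ A) {u : MultiWord r t} (h : a = app b u) : a = b :=
  hA a ha b hb (fun _ => []) u (by rw [app_nil, h])

theorem Indep.reach_sdiff {A : Finset (Word m r t)} (hA : Indep A) (l : Fin t)
    (S : Finset (Word m r t)) (hS : S ⊆ A) : Reach A ((A \ S) ∪ full l S) := by
  induction S using Finset.induction_on with
  | empty => simpa [full] using Relation.ReflTransGen.refl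
  | insert s S hs ih =>
    rw [Finset.insert_subset_iff] at hS
    refine (ih hS.2).tail ⟨l, s, ?_, ?_⟩
    · simp [hS.1, hs]
    · ext b
      simp only [mem_expand, Finset.mem_union, Finset.mem_sdiff, Finset.mem_insert, mem_full]
      constructor
      · rintro (⟨hb, hbs⟩ | ⟨a, rfl | ha, k, rfl⟩)
        · exact Or.inl ⟨fun h => hbs (Or.inl h), Or.inl ⟨hb, fun h => hbs (Or.inr h)⟩⟩
        · exact Or.inr ⟨k, rfl⟩
        · refine Or.inl ⟨fun h => ?_, Or.inr ⟨a, ha, k, rfl⟩⟩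
          have := hA.eq_of_app hS.1 (hS.2 ha) h.symm
          exact hs (this ▸ ha)
      · rintro (⟨hb, ⟨hbA, hbS⟩ | ⟨a, ha, k, rfl⟩⟩ | ⟨k, rfl⟩)
        · exact Or.inl ⟨hbA, fun h => h.elim hb hbS⟩
        · exact Or.inr ⟨a, Or.inr ha, k, rfl⟩
        · exact Or.inr ⟨s, Or.inl rfl, k, rfl⟩

theorem Indep.reach_full {A : Finset (Word m r t)} (hA : Indep A) (l : Fin t) :
    Reach A (full l A) := by
  simpa using hA.reach_sdiff l A subset_rfl

theorem Indep.expand_reach_full {A : Finset (Word m r t)} (hA : Indep A) {a : Word m r t}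
    (ha : a ∈ A) (l : Fin t) : Reach (BrinHigmanThompson.expand l a A) (full l A) := by
  have h := (hA.expand ha l).reach_sdiff l (A.erase a) Finset.subset_union_left
  convert h using 1
  ext b
  simp only [mem_expand, Finset.mem_union, Finset.mem_sdiff, Finset.mem_erase, mem_full]
  constructor
  · rintro ⟨c, hc, k, rfl⟩
    by_cases hca : c = a
    · subst hca
      refine Or.inl ⟨Or.inr ⟨k, rfl⟩, fun h => h.1 (hA.eq_of_app h.2 ha rfl)⟩
    · exact Or.inr ⟨c, ⟨hca, hc⟩, k, rfl⟩
  · rintro (⟨h | ⟨k, rfl⟩, h'⟩ | ⟨c, ⟨_, hc⟩, k, rfl⟩)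
    · exact absurd h h'
    · exact ⟨a, ha, k, rfl⟩
    · exact ⟨c, hc, k, rfl⟩

theorem Indep.full_reach_full {A : Finset (Word m r t)} (hA : Indep A) {a : Word m r t}
    (ha : a ∈ A) (l l' : Fin t) :
    Reach (full l A) (full l (BrinHigmanThompson.expand l' a A)) := by
  have hf := hA.reach (hA.reach_full l)
  have h := hf.reach_sdiff l' (full l {a}) (by
    intro b
    simp only [mem_full, Finset.mem_singleton]
    rintro ⟨_, rfl, k, rfl⟩
    exact ⟨_, ha, k, rfl⟩)
  convert h using 1
  ext b
  simp only [mem_expand, Finset.mem_union, Finset.mem_sdiff, mem_full, Finset.mem_singleton]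
  constructor
  · rintro ⟨c, ⟨hca, hc⟩ | ⟨k', rfl⟩, k, rfl⟩
    · refine Or.inl ⟨⟨c, hc, k, rfl⟩, ?_⟩
      rintro ⟨_, rfl, k', h⟩
      exact hca (hA c hc _ ha _ _ h)
    · refine Or.inr ?_
      by_cases hl : l = l'
      · subst hl
        exact ⟨_, ⟨a, rfl, k', rfl⟩, k, rfl⟩
      · exact ⟨_, ⟨a, rfl, k, rfl⟩, k', (app_letter_comm a hl k k').symm⟩
  · rintro (⟨⟨c, hc, k, rfl⟩, h⟩ | ⟨_, ⟨_, rfl, k, rfl⟩, k', rfl⟩)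
    · refine ⟨c, Or.inl ⟨?_, hc⟩, k, rfl⟩
      rintro rfl
      exact h ⟨_, rfl, k, rfl⟩
    · by_cases hl : l = l'
      · subst hl
        exact ⟨_, Or.inr ⟨k, rfl⟩, k', rfl⟩
      · exact ⟨_, Or.inr ⟨k', rfl⟩, k, app_letter_comm _ hl k k'⟩

theorem Indep.full_mono {A C : Finset (Word m r t)} (hA : Indep A) (h : Reach A C) (l : Fin t) :
    Reach (full l A) (full l C) := by
  induction h with
  | refl => exact .refl
  | tail h1 h ih =>
    obtain ⟨l', a, ha, rfl⟩ := h
    exact ih.trans ((hA.reach h1).full_reach_full ha l l')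

theorem Indep.confluent {A B C : Finset (Word m r t)} (hA : Indep A) (hB : Reach A B)
    (hC : Reach A C) : ∃ D, Reach B D ∧ Reach C D := by
  induction hB with
  | refl => exact ⟨C, hC, .refl⟩
  | tail h1 h ih =>
    obtain ⟨D, hBD, hCD⟩ := ih
    obtain ⟨l, a, ha, rfl⟩ := h
    have hI := hA.reach h1
    exact ⟨full l D, (hI.expand_reach_full ha l).trans (hI.full_mono hBD l),
      hCD.trans ((hA.reach (hC.trans hCD)).reach_full l)⟩

theorem IsBasis.exists_common {A B : Finset (Word m r t)} (hA : IsBasis A) (hB : IsBasis B) :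
    ∃ D, Reach A D ∧ Reach B D :=
  IsBasis.initial.indep.confluent hA.reach_initial hB.reach_initial

/-! ### Expansions of bijections -/

theorem image_expand₂ (f : Word m r t × Word m r t → Word m r t)
    (hf : ∀ p u, f (app₂ p u) = app (f p) u) {G : Finset (Word m r t × Word m r t)}
    (hG : Set.InjOn f (G : Set (Word m r t × Word m r t))) {p : Word m r t × Word m r t}
    (hp : p ∈ G) (l : Fin t) : (expand₂ l p G).image f = expand l (f p) (G.image f) := by
  ext b
  simp only [Finset.mem_image, mem_expand, mem_expand₂]
  constructor
  · rintro ⟨q, ⟨hq, hqG⟩ | ⟨k, rfl⟩, rfl⟩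
    · exact Or.inl ⟨fun h => hq (hG hqG hp h), q, hqG, rfl⟩
    · exact Or.inr ⟨k, hf _ _⟩
  · rintro (⟨hb, q, hqG, rfl⟩ | ⟨k, rfl⟩)
    · exact ⟨q, Or.inl ⟨fun h => hb (congrArg f h), hqG⟩, rfl⟩
    · exact ⟨_, Or.inr ⟨k, rfl⟩, hf _ _⟩

theorem injOn_expand₂ (f : Word m r t × Word m r t → Word m r t)
    (hf : ∀ p u, f (app₂ p u) = app (f p) u) {G : Finset (Word m r t × Word m r t)}
    (hG : Set.InjOn f (G : Set (Word m r t × Word m r t))) (hI : Indep (G.image f))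
    {p : Word m r t × Word m r t} (hp : p ∈ G) (l : Fin t) :
    Set.InjOn f (expand₂ l p G : Set (Word m r t × Word m r t)) := by
  have key : ∀ q ∈ G, ∀ u, f q = app (f p) u → q = p := fun q hq u h =>
    hG hq hp (hI.eq_of_app (Finset.mem_image_of_mem f hq) (Finset.mem_image_of_mem f hp) h)
  intro q hq q' hq' h
  rw [Finset.mem_coe, mem_expand₂] at hq hq'
  rcases hq with ⟨hq, hqG⟩ | ⟨k, rfl⟩ <;> rcases hq' with ⟨hq', hqG'⟩ | ⟨k', rfl⟩
  · exact hG hqG hqG' h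
  · rw [hf] at h; exact absurd (key _ hqG _ h) hq
  · rw [hf] at h; exact absurd (key _ hqG' _ h.symm) hq'
  · rw [hf, hf] at h; rw [app_letter_inj h]

namespace BasisBij

/-- The domain of a bijection between bases. -/
def dom (φ : BasisBij m r t) : Finset (Word m r t) := φ.graph.image Prod.fst

/-- The codomain of a bijection between bases. -/
def cod (φ : BasisBij m r t) : Finset (Word m r t) := φ.graph.image Prod.snd

theorem basis_dom (φ : BasisBij m r t) : IsBasis φ.dom := φ.isBasis_dom

theorem basis_cod (φ : BasisBij m r t) : IsBasis φ.cod := φ.isBasis_cod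

/-- The expansion of a bijection at an element `p = (a, φ a)` of its graph. -/
def expandAt (φ : BasisBij m r t) (l : Fin t) (p : Word m r t × Word m r t) (hp : p ∈ φ.graph) :
    BasisBij m r t where
  graph := expand₂ l p φ.graph
  injOn_fst := injOn_expand₂ Prod.fst (fun _ _ => rfl) φ.injOn_fst φ.isBasis_dom.indep hp l
  injOn_snd := injOn_expand₂ Prod.snd (fun _ _ => rfl) φ.injOn_snd φ.isBasis_cod.indep hp l
  isBasis_dom := by
    rw [image_expand₂ Prod.fst (fun _ _ => rfl) φ.injOn_fst hp]
    exact φ.isBasis_dom.expand l (Finset.mem_image_of_mem _ hp)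
  isBasis_cod := by
    rw [image_expand₂ Prod.snd (fun _ _ => rfl) φ.injOn_snd hp]
    exact φ.isBasis_cod.expand l (Finset.mem_image_of_mem _ hp)

/-- The inverse of a bijection between bases. -/
def inv (φ : BasisBij m r t) : BasisBij m r t where
  graph := φ.graph.image Prod.swap
  injOn_fst := by
    intro p hp q hq h
    simp only [Finset.coe_image, Set.mem_image] at hp hq
    obtain ⟨p, hp, rfl⟩ := hp
    obtain ⟨q, hq, rfl⟩ := hq
    exact congrArg Prod.swap (φ.injOn_snd hp hq h)
  injOn_snd := by
    intro p hp q hq h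
    simp only [Finset.coe_image, Set.mem_image] at hp hq
    obtain ⟨p, hp, rfl⟩ := hp
    obtain ⟨q, hq, rfl⟩ := hq
    exact congrArg Prod.swap (φ.injOn_fst hp hq h)
  isBasis_dom := by
    rw [Finset.image_image]
    exact φ.isBasis_cod
  isBasis_cod := by
    rw [Finset.image_image]
    exact φ.isBasis_dom

theorem dom_inv (φ : BasisBij m r t) : φ.inv.dom = φ.cod := Finset.image_image

theorem cod_inv (φ : BasisBij m r t) : φ.inv.cod = φ.dom := Finset.image_image

theorem inv_inv (φ : BasisBij m r t) : φ.inv.inv = φ := by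
  apply BasisBij.ext
  simp [inv, Finset.image_image]

theorem mem_inv {φ : BasisBij m r t} {a b : Word m r t} :
    (a, b) ∈ φ.inv.graph ↔ (b, a) ∈ φ.graph := by
  simp only [inv, Finset.mem_image]
  constructor
  · rintro ⟨p, hp, h⟩
    obtain rfl : p = (b, a) := congrArg Prod.swap h
    exact hp
  · exact fun h => ⟨_, h, rfl⟩

/-- Iterated expansion of bijections. -/
abbrev Reach : BasisBij m r t → BasisBij m r t → Prop := Relation.ReflTransGen Expansion

theorem Expansion.inv {φ ψ : BasisBij m r t} (h : Expansion φ ψ) :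
    Expansion φ.inv ψ.inv := by
  obtain ⟨l, p, hp, h⟩ := h
  refine ⟨l, p.swap, Finset.mem_image_of_mem _ hp, ?_⟩
  ext ⟨a, b⟩
  rw [mem_inv, h, mem_expand₂, mem_expand₂, mem_inv]
  obtain ⟨c, d⟩ := p
  simp only [app₂, Prod.swap, Prod.mk.injEq, ne_eq]
  tauto

theorem Reach.inv {φ ψ : BasisBij m r t} (h : Reach φ ψ) : Reach φ.inv ψ.inv := by
  induction h with
  | refl => exact .refl
  | tail _ h ih => exact ih.tail h.inv

theorem exists_reach_of_dom (φ : BasisBij m r t) {C : Finset (Word m r t)}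
    (h : BrinHigmanThompson.Reach φ.dom C) : ∃ ψ, Reach φ ψ ∧ ψ.dom = C := by
  induction h with
  | refl => exact ⟨φ, .refl, rfl⟩
  | tail _ h ih =>
    obtain ⟨l, a, ha, rfl⟩ := h
    obtain ⟨ψ, hψ, rfl⟩ := ih
    obtain ⟨p, hp, rfl⟩ := Finset.mem_image.1 ha
    exact ⟨ψ.expandAt l p hp, hψ.tail ⟨l, p, hp, rfl⟩,
      image_expand₂ Prod.fst (fun _ _ => rfl) ψ.injOn_fst hp l⟩

theorem exists_reach_of_cod (φ : BasisBij m r t) {C : Finset (Word m r t)}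
    (h : BrinHigmanThompson.Reach φ.cod C) : ∃ ψ, Reach φ ψ ∧ ψ.cod = C := by
  rw [← dom_inv] at h
  obtain ⟨ψ, hψ, rfl⟩ := φ.inv.exists_reach_of_dom h
  refine ⟨ψ.inv, ?_, cod_inv ψ⟩
  have := hψ.inv
  rwa [inv_inv] at this

theorem Reach.dom {φ ψ : BasisBij m r t} (h : Reach φ ψ) :
    BrinHigmanThompson.Reach φ.dom ψ.dom := by
  induction h with
  | refl => exact .refl
  | @tail ψ χ _ h ih =>
    obtain ⟨l, p, hp, h⟩ := h
    refine ih.tail ⟨l, p.1, Finset.mem_image_of_mem _ hp, ?_⟩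
    rw [BasisBij.dom, h]
    exact image_expand₂ Prod.fst (fun _ _ => rfl) ψ.injOn_fst hp l

/-- `ψ` is a restriction of the map `a u ↦ φ a u` defined by `φ`. -/
def Refines (φ ψ : BasisBij m r t) : Prop :=
  ∀ q ∈ ψ.graph, ∃ p ∈ φ.graph, ∃ u, q = app₂ p u

theorem Reach.refines {φ ψ : BasisBij m r t} (h : Reach φ ψ) : Refines φ ψ := by
  induction h with
  | refl => exact fun q hq => ⟨q, hq, fun _ => [], by simp [app₂, app_nil]⟩
  | tail _ h ih =>
    obtain ⟨l, p, hp, h⟩ := h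
    intro q hq
    rw [h, mem_expand₂] at hq
    rcases hq with ⟨_, hq⟩ | ⟨k, rfl⟩
    · exact ih q hq
    · obtain ⟨p', hp', u, rfl⟩ := ih p hp
      exact ⟨p', hp', fun i => u i ++ letter l k i, by simp [app₂, app_app]⟩

theorem Refines.subset {φ ψ χ : BasisBij m r t} (h1 : Refines φ ψ) (h2 : Refines φ χ)
    (h : ψ.dom = χ.dom) : ψ.graph ⊆ χ.graph := by
  intro q hq
  have : q.1 ∈ χ.dom := h ▸ Finset.mem_image_of_mem _ hq
  obtain ⟨q', hq', hqq⟩ := Finset.mem_image.1 this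
  obtain ⟨p, hp, u, rfl⟩ := h1 q hq
  obtain ⟨p', hp', u', rfl⟩ := h2 q' hq'
  have hpp : p' = p := φ.injOn_fst hp' hp (φ.isBasis_dom.indep _ (Finset.mem_image_of_mem _ hp') _
    (Finset.mem_image_of_mem _ hp) u' u hqq)
  subst hpp
  rwa [app_cancel hqq] at hq'

theorem Refines.unique {φ ψ χ : BasisBij m r t} (h1 : Refines φ ψ) (h2 : Refines φ χ)
    (h : ψ.dom = χ.dom) : ψ = χ :=
  BasisBij.ext ((h1.subset h2 h).antisymm (h2.subset h1 h.symm))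

/-! ### Equivalence of bijections -/

theorem exists_common {φ ψ : BasisBij m r t} (h : Relation.EqvGen Expansion φ ψ) :
    ∃ χ, Reach φ χ ∧ Reach ψ χ := by
  induction h with
  | rel φ ψ h => exact ⟨ψ, .single h, .refl⟩
  | refl φ => exact ⟨φ, .refl, .refl⟩
  | symm φ ψ _ ih => obtain ⟨χ, h1, h2⟩ := ih; exact ⟨χ, h2, h1⟩
  | trans φ ψ ω _ _ ih1 ih2 =>
    obtain ⟨χ₁, h1, h2⟩ := ih1
    obtain ⟨χ₂, h3, h4⟩ := ih2
    obtain ⟨D, hD1, hD2⟩ := χ₁.isBasis_dom.exists_common χ₂.isBasis_dom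
    obtain ⟨η₁, h5, h5'⟩ := χ₁.exists_reach_of_dom hD1
    obtain ⟨η₂, h6, h6'⟩ := χ₂.exists_reach_of_dom hD2
    have : η₁ = η₂ :=
      (Reach.refines (h2.trans h5)).unique (Reach.refines (h3.trans h6)) (h5'.trans h6'.symm)
    subst this
    exact ⟨η₁, h1.trans h5, h4.trans h6⟩

/-- The element of the Brin-Higman-Thompson group represented by a bijection. -/
def toGroup (φ : BasisBij m r t) : BrinHigmanThompsonGroup t r m := Quot.mk _ φ

theorem toGroup_eq_iff {φ ψ : BasisBij m r t} :
    φ.toGroup = ψ.toGroup ↔ ∃ χ, Reach φ χ ∧ Reach ψ χ := by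
  constructor
  · intro h
    exact exists_common (Quot.eqvGen_exact h)
  · have key : ∀ {φ χ : BasisBij m r t}, Reach φ χ → φ.toGroup = χ.toGroup := by
      intro φ χ h
      induction h with
      | refl => rfl
      | tail _ h ih => exact ih.trans (Quot.sound h)
    rintro ⟨χ, h1, h2⟩
    exact (key h1).trans (key h2).symm

theorem Reach.toGroup_eq {φ ψ : BasisBij m r t} (h : Reach φ ψ) : φ.toGroup = ψ.toGroup :=
  toGroup_eq_iff.2 ⟨ψ, h, .refl⟩

/-! ### Composition -/

/-- The composite of `φ : A → B` and `ψ : B → C`, first `φ` and then `ψ`. -/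
def comp (φ ψ : BasisBij m r t) (h : φ.cod = ψ.dom) : BasisBij m r t :=
  have hfst : (((φ.graph ×ˢ ψ.graph).filter fun p => p.1.2 = p.2.1).image
      fun p => (p.1.1, p.2.2)).image Prod.fst = φ.graph.image Prod.fst := by
    ext a
    simp only [Finset.mem_image, Finset.mem_filter, Finset.mem_product, exists_exists_and_eq_and]
    constructor
    · rintro ⟨⟨p, q⟩, ⟨⟨hp, _⟩, _⟩, rfl⟩
      exact ⟨p, hp, rfl⟩
    · rintro ⟨p, hp, rfl⟩
      have : p.2 ∈ ψ.dom := h ▸ Finset.mem_image_of_mem _ hp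
      obtain ⟨q, hq, hqp⟩ := Finset.mem_image.1 this
      exact ⟨(p, q), ⟨⟨hp, hq⟩, hqp.symm⟩, rfl⟩
  have hsnd : (((φ.graph ×ˢ ψ.graph).filter fun p => p.1.2 = p.2.1).image
      fun p => (p.1.1, p.2.2)).image Prod.snd = ψ.graph.image Prod.snd := by
    ext a
    simp only [Finset.mem_image, Finset.mem_filter, Finset.mem_product, exists_exists_and_eq_and]
    constructor
    · rintro ⟨⟨p, q⟩, ⟨⟨_, hq⟩, _⟩, rfl⟩
      exact ⟨q, hq, rfl⟩
    · rintro ⟨q, hq, rfl⟩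
      have : q.1 ∈ φ.cod := h ▸ Finset.mem_image_of_mem _ hq
      obtain ⟨p, hp, hqp⟩ := Finset.mem_image.1 this
      exact ⟨(p, q), ⟨⟨hp, hq⟩, hqp⟩, rfl⟩
  { graph := ((φ.graph ×ˢ ψ.graph).filter fun p => p.1.2 = p.2.1).image fun p => (p.1.1, p.2.2)
    injOn_fst := by
      intro x hx y hy hxy
      simp only [Finset.mem_coe, Finset.mem_image, Finset.mem_filter, Finset.mem_product] at hx hy
      obtain ⟨⟨p, q⟩, ⟨⟨hp, hq⟩, e⟩, rfl⟩ := hx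
      obtain ⟨⟨p', q'⟩, ⟨⟨hp', hq'⟩, e'⟩, rfl⟩ := hy
      obtain rfl : p = p' := φ.injOn_fst hp hp' hxy
      obtain rfl : q = q' := ψ.injOn_fst hq hq' (e.symm.trans e')
      rfl
    injOn_snd := by
      intro x hx y hy hxy
      simp only [Finset.mem_coe, Finset.mem_image, Finset.mem_filter, Finset.mem_product] at hx hy
      obtain ⟨⟨p, q⟩, ⟨⟨hp, hq⟩, e⟩, rfl⟩ := hx
      obtain ⟨⟨p', q'⟩, ⟨⟨hp', hq'⟩, e'⟩, rfl⟩ := hy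
      obtain rfl : q = q' := ψ.injOn_snd hq hq' hxy
      obtain rfl : p = p' := φ.injOn_snd hp hp' (e.trans e'.symm)
      rfl
    isBasis_dom := hfst ▸ φ.isBasis_dom
    isBasis_cod := hsnd ▸ ψ.isBasis_cod }

theorem mem_comp {φ ψ : BasisBij m r t} {h : φ.cod = ψ.dom} {a c : Word m r t} :
    (a, c) ∈ (comp φ ψ h).graph ↔ ∃ b, (a, b) ∈ φ.graph ∧ (b, c) ∈ ψ.graph := by
  simp only [comp, Finset.mem_image, Finset.mem_filter, Finset.mem_product]
  constructor
  · rintro ⟨⟨⟨a', b⟩, ⟨b', c'⟩⟩, ⟨⟨hp, hq⟩, e⟩, e'⟩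
    obtain ⟨rfl, rfl⟩ := Prod.mk.inj e'
    obtain rfl : b = b' := e
    exact ⟨b, hp, hq⟩
  · rintro ⟨b, hp, hq⟩
    exact ⟨((a, b), (b, c)), ⟨⟨hp, hq⟩, rfl⟩, rfl⟩

theorem mem_dom {φ : BasisBij m r t} {a : Word m r t} : a ∈ φ.dom ↔ ∃ b, (a, b) ∈ φ.graph := by
  constructor
  · intro h
    obtain ⟨⟨a, b⟩, hq, rfl⟩ := Finset.mem_image.1 h
    exact ⟨b, hq⟩
  · rintro ⟨b, h⟩
    exact Finset.mem_image_of_mem Prod.fst h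

theorem mem_cod {φ : BasisBij m r t} {b : Word m r t} : b ∈ φ.cod ↔ ∃ a, (a, b) ∈ φ.graph := by
  constructor
  · intro h
    obtain ⟨⟨a, b⟩, hq, rfl⟩ := Finset.mem_image.1 h
    exact ⟨a, hq⟩
  · rintro ⟨a, h⟩
    exact Finset.mem_image_of_mem Prod.snd h

theorem dom_comp (φ ψ : BasisBij m r t) (h : φ.cod = ψ.dom) : (comp φ ψ h).dom = φ.dom := by
  ext a
  simp only [mem_dom, mem_comp]
  constructor
  · rintro ⟨c, b, hp, _⟩
    exact ⟨b, hp⟩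
  · rintro ⟨b, hp⟩
    obtain ⟨c, hc⟩ := mem_dom.1 (h ▸ mem_cod.2 ⟨a, hp⟩ : b ∈ ψ.dom)
    exact ⟨c, b, hp, hc⟩

theorem cod_comp (φ ψ : BasisBij m r t) (h : φ.cod = ψ.dom) : (comp φ ψ h).cod = ψ.cod := by
  ext c
  simp only [mem_cod, mem_comp]
  constructor
  · rintro ⟨a, b, _, hq⟩
    exact ⟨b, hq⟩
  · rintro ⟨b, hq⟩
    obtain ⟨a, ha⟩ := mem_cod.1 (h ▸ mem_dom.2 ⟨c, hq⟩ : b ∈ φ.cod)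
    exact ⟨a, b, ha, hq⟩

theorem Reach.comp {φ φ' ψ ψ' : BasisBij m r t} (h : φ.cod = ψ.dom) (h' : φ'.cod = ψ'.dom)
    (hφ : Reach φ φ') (hψ : Reach ψ ψ') : Reach (comp φ ψ h) (comp φ' ψ' h') := by
  obtain ⟨χ, hχ, hd⟩ := (BasisBij.comp φ ψ h).exists_reach_of_dom (C := φ'.dom)
    (by rw [dom_comp]; exact hφ.dom)
  have : χ = BasisBij.comp φ' ψ' h' := by
    refine hχ.refines.unique ?_ (hd.trans (dom_comp _ _ _).symm)
    rintro ⟨a, c⟩ hac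
    obtain ⟨b, hab, hbc⟩ := mem_comp.1 hac
    obtain ⟨⟨a₁, b₁⟩, hp, u, hu⟩ := hφ.refines _ hab
    obtain ⟨⟨b₂, c₂⟩, hq, v, hv⟩ := hψ.refines _ hbc
    obtain ⟨rfl, rfl⟩ := Prod.mk.inj hu
    obtain ⟨hb, rfl⟩ := Prod.mk.inj hv
    have hb₁ : b₁ ∈ ψ.dom := h ▸ Finset.mem_image_of_mem Prod.snd hp
    obtain rfl : b₁ = b₂ :=
      ψ.isBasis_dom.indep _ hb₁ _ (Finset.mem_image_of_mem Prod.fst hq) _ _ hb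
    obtain rfl := app_cancel hb
    exact ⟨(a₁, c₂), mem_comp.2 ⟨_, hp, hq⟩, _, rfl⟩
  rwa [this] at hχ

/-- Any two bijections have composable expansions. -/
theorem exists_composable (φ ψ : BasisBij m r t) :
    ∃ φ' ψ', Reach φ φ' ∧ Reach ψ ψ' ∧ φ'.cod = ψ'.dom := by
  obtain ⟨D, h1, h2⟩ := φ.isBasis_cod.exists_common ψ.isBasis_dom
  obtain ⟨φ', h3, h3'⟩ := φ.exists_reach_of_cod h1
  obtain ⟨ψ', h4, h4'⟩ := ψ.exists_reach_of_dom h2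
  exact ⟨φ', ψ', h3, h4, h3'.trans h4'.symm⟩

theorem toGroup_comp_congr {φ φ' ψ ψ' : BasisBij m r t} (h : φ.cod = ψ.dom)
    (h' : φ'.cod = ψ'.dom) (hφ : φ.toGroup = φ'.toGroup) (hψ : ψ.toGroup = ψ'.toGroup) :
    (comp φ ψ h).toGroup = (comp φ' ψ' h').toGroup := by
  obtain ⟨φ₁, h1, h2⟩ := toGroup_eq_iff.1 hφ
  obtain ⟨ψ₁, h3, h4⟩ := toGroup_eq_iff.1 hψ
  obtain ⟨φ₂, ψ₂, h5, h6, h7⟩ := exists_composable φ₁ ψ₁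
  exact toGroup_eq_iff.2 ⟨comp φ₂ ψ₂ h7, Reach.comp h h7 (h1.trans h5) (h3.trans h6),
    Reach.comp h' h7 (h2.trans h5) (h4.trans h6)⟩

/-- The identity map of a basis. -/
def refl (A : Finset (Word m r t)) (hA : IsBasis A) : BasisBij m r t where
  graph := A.image fun a => (a, a)
  injOn_fst := by
    intro p hp q hq h
    simp only [Finset.mem_coe, Finset.mem_image] at hp hq
    obtain ⟨a, _, rfl⟩ := hp
    obtain ⟨b, _, rfl⟩ := hq
    obtain rfl : a = b := h
    rfl
  injOn_snd := by
    intro p hp q hq h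
    simp only [Finset.mem_coe, Finset.mem_image] at hp hq
    obtain ⟨a, _, rfl⟩ := hp
    obtain ⟨b, _, rfl⟩ := hq
    obtain rfl : a = b := h
    rfl
  isBasis_dom := by
    rw [Finset.image_image]
    exact (Finset.image_id (s := A)).symm ▸ hA
  isBasis_cod := by
    rw [Finset.image_image]
    exact (Finset.image_id (s := A)).symm ▸ hA

theorem mem_refl {A : Finset (Word m r t)} {hA : IsBasis A} {a b : Word m r t} :
    (a, b) ∈ (refl A hA).graph ↔ a ∈ A ∧ a = b := by
  simp only [refl, Finset.mem_image, Prod.mk.injEq]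
  constructor
  · rintro ⟨c, hc, rfl, rfl⟩
    exact ⟨hc, rfl⟩
  · rintro ⟨ha, rfl⟩
    exact ⟨a, ha, rfl, rfl⟩

theorem dom_refl (A : Finset (Word m r t)) (hA : IsBasis A) : (refl A hA).dom = A :=
  Finset.image_image.trans Finset.image_id

theorem cod_refl (A : Finset (Word m r t)) (hA : IsBasis A) : (refl A hA).cod = A :=
  Finset.image_image.trans Finset.image_id

theorem toGroup_refl (A : Finset (Word m r t)) (hA : IsBasis A) :
    (refl A hA).toGroup = (refl (initial m r t) IsBasis.initial).toGroup := by
  obtain ⟨χ, hχ, hd⟩ := (refl (initial m r t) IsBasis.initial).exists_reach_of_dom (C := A)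
    (by rw [dom_refl]; exact hA.reach_initial)
  have : χ = refl A hA := by
    apply BasisBij.ext
    have key : ∀ q ∈ χ.graph, q.1 = q.2 := by
      intro q hq
      obtain ⟨⟨a, b⟩, hp, u, rfl⟩ := hχ.refines q hq
      obtain rfl := (mem_refl.1 hp).2
      rfl
    ext ⟨a, b⟩
    rw [mem_refl, ← hd]
    constructor
    · intro h
      exact ⟨Finset.mem_image_of_mem Prod.fst h, key _ h⟩
    · rintro ⟨h, rfl⟩
      obtain ⟨⟨a, b⟩, hq, rfl⟩ := Finset.mem_image.1 h
      obtain rfl : a = b := key _ hq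
      exact hq
  rw [← this]
  exact hχ.toGroup_eq.symm

end BasisBij

end BrinHigmanThompson

namespace BrinHigmanThompsonGroup

open BrinHigmanThompson BrinHigmanThompson.BasisBij

variable {m r t : ℕ}

theorem exists_rep (g h : BrinHigmanThompsonGroup t r m) :
    ∃ (φ ψ : BasisBij m r t), φ.cod = ψ.dom ∧ φ.toGroup = g ∧ ψ.toGroup = h := by
  obtain ⟨φ, rfl⟩ := Quot.exists_rep g
  obtain ⟨ψ, rfl⟩ := Quot.exists_rep h
  obtain ⟨φ', ψ', h1, h2, h3⟩ := exists_composable φ ψ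
  exact ⟨φ', ψ', h3, h1.toGroup_eq.symm, h2.toGroup_eq.symm⟩

/-- The product `g * h` is the class of the composite (first `φ`, then `ψ`) of any representatives
`φ : A → B` of `g` and `ψ : B → C` of `h`. -/
instance : Mul (BrinHigmanThompsonGroup t r m) where
  mul g h := (BasisBij.comp (exists_rep g h).choose (exists_rep g h).choose_spec.choose
    (exists_rep g h).choose_spec.choose_spec.1).toGroup

theorem toGroup_mul_toGroup (φ ψ : BasisBij m r t) (h : φ.cod = ψ.dom) :
    φ.toGroup * ψ.toGroup = (BasisBij.comp φ ψ h).toGroup :=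
  toGroup_comp_congr _ _ (exists_rep φ.toGroup ψ.toGroup).choose_spec.choose_spec.2.1
    (exists_rep φ.toGroup ψ.toGroup).choose_spec.choose_spec.2.2

instance : One (BrinHigmanThompsonGroup t r m) where
  one := (BasisBij.refl (BrinHigmanThompson.initial m r t) IsBasis.initial).toGroup

instance : Inv (BrinHigmanThompsonGroup t r m) where
  inv := Quot.map BasisBij.inv fun _ _ h => h.inv

theorem one_eq (A : Finset (Word m r t)) (hA : IsBasis A) :
    (1 : BrinHigmanThompsonGroup t r m) = (BasisBij.refl A hA).toGroup :=
  (toGroup_refl A hA).symm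

instance : Group (BrinHigmanThompsonGroup t r m) where
  mul_assoc a b c := by
    obtain ⟨φ, ψ, h, rfl, rfl⟩ := exists_rep a b
    obtain ⟨χ, rfl⟩ : ∃ χ : BasisBij m r t, χ.toGroup = c := Quot.exists_rep c
    obtain ⟨ψ₁, χ₁, h1, h2, h3⟩ := exists_composable ψ χ
    obtain ⟨φ₁, h4, h5⟩ := φ.exists_reach_of_cod (C := ψ₁.dom) (h ▸ h1.dom)
    rw [h1.toGroup_eq, h2.toGroup_eq, h4.toGroup_eq, toGroup_mul_toGroup φ₁ ψ₁ h5,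
      toGroup_mul_toGroup ψ₁ χ₁ h3,
      toGroup_mul_toGroup _ χ₁ ((cod_comp _ _ _).trans h3),
      toGroup_mul_toGroup φ₁ _ (h5.trans (dom_comp _ _ _).symm)]
    congr 1
    apply BasisBij.ext
    ext ⟨x, y⟩
    simp only [mem_comp]
    constructor
    · rintro ⟨b, ⟨c, hc, hb⟩, hy⟩
      exact ⟨c, hc, b, hb, hy⟩
    · rintro ⟨c, hc, b, hb, hy⟩
      exact ⟨b, ⟨c, hc, hb⟩, hy⟩
  one_mul a := by
    obtain ⟨φ, rfl⟩ : ∃ φ : BasisBij m r t, φ.toGroup = a := Quot.exists_rep a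
    rw [one_eq φ.dom φ.basis_dom, toGroup_mul_toGroup _ _ (cod_refl _ _)]
    congr 1
    apply BasisBij.ext
    ext ⟨x, y⟩
    simp only [mem_comp, mem_refl]
    constructor
    · rintro ⟨b, ⟨_, rfl⟩, h⟩
      exact h
    · intro h
      exact ⟨x, ⟨Finset.mem_image_of_mem Prod.fst h, rfl⟩, h⟩
  mul_one a := by
    obtain ⟨φ, rfl⟩ : ∃ φ : BasisBij m r t, φ.toGroup = a := Quot.exists_rep a
    rw [one_eq φ.cod φ.basis_cod, toGroup_mul_toGroup _ _ (dom_refl _ _).symm]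
    congr 1
    apply BasisBij.ext
    ext ⟨x, y⟩
    simp only [mem_comp, mem_refl]
    constructor
    · rintro ⟨b, h, ⟨_, rfl⟩⟩
      exact h
    · intro h
      exact ⟨y, h, Finset.mem_image_of_mem Prod.snd h, rfl⟩
  inv_mul_cancel a := by
    obtain ⟨φ, rfl⟩ : ∃ φ : BasisBij m r t, φ.toGroup = a := Quot.exists_rep a
    change φ.inv.toGroup * φ.toGroup = 1
    rw [one_eq φ.cod φ.basis_cod, toGroup_mul_toGroup _ _ (cod_inv φ)]
    refine congrArg toGroup ?_
    apply BasisBij.ext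
    ext ⟨x, y⟩
    simp only [mem_comp, mem_refl, mem_inv]
    constructor
    · rintro ⟨b, h, h'⟩
      have := φ.injOn_fst h h' rfl
      exact ⟨Finset.mem_image_of_mem Prod.snd h, congrArg Prod.snd this⟩
    · rintro ⟨h, rfl⟩
      obtain ⟨⟨b, _⟩, hq, rfl⟩ := Finset.mem_image.1 h
      exact ⟨b, hq, hq⟩

end BrinHigmanThompsonGroup

end

/-!
The first two claims come from one isomorphism of partially ordered rings with involution,
`L_r ≅ M_d(L_r)` for `d` coprime to `r - 1`. In `M_d(L_r)`, with `n = r - 1`, let `P` be a rank one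
projection, `Q = 1`, and `R` the part of `P` complementary to the range of `y_1`, so that there are
decompositions `P = P ⊕ R`, `Q = d P`, `R = n P`, given by positive isometries that generate the
whole positive cone (`LeavittRing.presents_start`). Replacing in one of the three decompositions a
summand by its own decomposition, or the reverse, changes neither positivity nor the cone that is
generated (`presents_iff_of_move`). With `d e = 1 + k n`, a chain of such moves, which contains the
reduction of a matrix in `SL₂(ℤ)` with nonnegative entries, leads to `P = e Q`, `Q = (1 + n) Q`,
`R = n Q` (`presents_chain`). Now the decomposition of `Q = 1` consists of `r` isometries that
satisfy the relations of `L_r`, and those of `P` and `R` involve only `Q`, so they add nothing to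
the endomorphisms of `Q` that are generated: the resulting map from `L_r` is onto, and maps positive
cone onto positive cone (`Presents.exists_leavittRing_equiv`). It is injective, as is every ring
homomorphism from `L_r`, `r ≥ 2`, to a ring of characteristic zero: an element in the kernel becomes
a polynomial in the `y_i` by right multiplication with long words, and the coefficients of a
polynomial can be isolated by compressions (`LeavittRing.injective_of_charZero`).

Applied to one tensor factor and to all the entries of a matrix, this allows to multiply `m` by a
number coprime to `r - 1`; the unitary row `(y_1, …, y_r)` allows to add `r - 1` to `m`. Two numbers
with the same greatest common divisor with `r - 1` are linked by such steps
(`LeavittMatrix.orderIsomorphic_of_gcd_eq`).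

For the third claim, `tV_{r,m}` is identified with `PU_m` (`BrinHigmanThompsonGroup.mulEquivPU`): a
bijection `φ : A → B` between bases is sent to the matrix `∑ y_a x_{φ a}`, which does not change
under expansions. Conversely, a positive matrix `u` is a sum of matrix units `y_a x_b` in which the
words `b` form a subset of a basis; `u* u = 1` forces each `b` of the basis to occur exactly once
and the `a` to have no common right multiples, and `u u* = 1` then forces the `a` to become a basis
after expansions (`BrinHigmanThompson.exists_toMatrix_eq`).
-/

noncomputable section

open scoped TensorProduct

/-! ### Ring homomorphisms out of the Leavitt ring are injective -/

namespace LeavittRing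

variable {r : ℕ}

/-- The positive cone generates the Leavitt ring as an additive group. -/
theorem exists_eq_sub (a : LeavittRing r) : ∃ p ∈ posCone r, ∃ q ∈ posCone r, a = p - q := by
  obtain ⟨a, rfl⟩ := RingQuot.mkRingHom_surjective (LeavittRel r) a
  change ∃ p ∈ posCone r, ∃ q ∈ posCone r, mk r a = p - q
  have hgen : ∀ s, mk r (FreeAlgebra.ι ℤ s) ∈ posCone r := by
    rintro (i | i)
    · exact AddSubmonoid.subset_closure (Submonoid.subset_closure (Or.inl ⟨i, rfl⟩))
    · exact AddSubmonoid.subset_closure (Submonoid.subset_closure (Or.inr ⟨i, rfl⟩))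
  induction a using FreeAlgebra.induction with
  | grade0 n =>
    have hn : mk r (algebraMap ℤ _ n) = (n : LeavittRing r) := by
      rw [eq_intCast (algebraMap ℤ (FreeAlgebra ℤ (Fin r ⊕ Fin r))), map_intCast]
    rw [hn]
    obtain ⟨k, rfl | rfl⟩ := n.eq_nat_or_neg
    · exact ⟨k • 1, nsmul_mem one_mem_posCone k, 0, zero_mem _, by simp⟩
    · exact ⟨0, zero_mem _, k • 1, nsmul_mem one_mem_posCone k, by simp⟩
  | grade1 s => exact ⟨_, hgen s, 0, zero_mem _, by simp⟩
  | mul a b ha hb =>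
    obtain ⟨p, hp, q, hq, ha⟩ := ha
    obtain ⟨p', hp', q', hq', hb⟩ := hb
    refine ⟨p * p' + q * q', add_mem (mul_mem_posCone hp hp') (mul_mem_posCone hq hq'),
      p * q' + q * p', add_mem (mul_mem_posCone hp hq') (mul_mem_posCone hq hp'), ?_⟩
    rw [map_mul, ha, hb]
    noncomm_ring
  | add a b ha hb =>
    obtain ⟨p, hp, q, hq, ha⟩ := ha
    obtain ⟨p', hp', q', hq', hb⟩ := hb
    refine ⟨p + p', add_mem hp hp', q + q', add_mem hq hq', ?_⟩
    rw [map_add, ha, hb]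
    abel

/-- The noncommutative polynomials of degree at most `M` in the generators `y i`, in the form
`n + ∑ i, y i * c i` with `c i` of degree at most `M - 1`. -/
def IsYPolynomial : ℕ → LeavittRing r → Prop
  | 0, b => ∃ n : ℤ, b = n
  | M + 1, b => ∃ (n : ℤ) (c : Fin r → LeavittRing r),
      (∀ i, IsYPolynomial M (c i)) ∧ b = n + ∑ i, y i * c i

theorem IsYPolynomial.intCast (M : ℕ) (n : ℤ) : IsYPolynomial M (n : LeavittRing r) := by
  induction M generalizing n with
  | zero => exact ⟨n, rfl⟩
  | succ M ih =>
    refine ⟨n, fun _ => 0, fun _ => ?_, by simp⟩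
    simpa using ih 0

theorem IsYPolynomial.succ {M : ℕ} {b : LeavittRing r} (h : IsYPolynomial M b) :
    IsYPolynomial (M + 1) b := by
  induction M generalizing b with
  | zero => obtain ⟨n, rfl⟩ := h; exact .intCast 1 n
  | succ M ih =>
    obtain ⟨n, c, hc, rfl⟩ := h
    exact ⟨n, c, fun i => ih (hc i), rfl⟩

theorem IsYPolynomial.mono {M N : ℕ} (hMN : M ≤ N) {b : LeavittRing r} (h : IsYPolynomial M b) :
    IsYPolynomial N b := by
  induction hMN with
  | refl => exact h
  | step _ ih => exact ih.succ

theorem IsYPolynomial.sub {M : ℕ} {b b' : LeavittRing r} (h : IsYPolynomial M b)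
    (h' : IsYPolynomial M b') : IsYPolynomial M (b - b') := by
  induction M generalizing b b' with
  | zero =>
    obtain ⟨n, rfl⟩ := h
    obtain ⟨n', rfl⟩ := h'
    exact ⟨n - n', by simp⟩
  | succ M ih =>
    obtain ⟨n, c, hc, rfl⟩ := h
    obtain ⟨n', c', hc', rfl⟩ := h'
    refine ⟨n - n', fun i => c i - c' i, fun i => ih (hc i) (hc' i), ?_⟩
    simp only [mul_sub, Finset.sum_sub_distrib, Int.cast_sub]
    abel

theorem IsYPolynomial.add {M : ℕ} {b b' : LeavittRing r} (h : IsYPolynomial M b)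
    (h' : IsYPolynomial M b') : IsYPolynomial M (b + b') := by
  have h0 : IsYPolynomial M (0 : LeavittRing r) := by simpa using IsYPolynomial.intCast (r := r) M 0
  simpa using h.sub (h0.sub h')

theorem IsYPolynomial.prod_y (u : List (Fin r)) : IsYPolynomial u.length (u.map y).prod := by
  induction u with
  | nil => exact ⟨1, by simp⟩
  | cons i u ih =>
    have h0 : IsYPolynomial u.length (0 : LeavittRing r) := by
      simpa using IsYPolynomial.intCast (r := r) u.length 0
    refine ⟨0, fun j => if j = i then (u.map y).prod else 0, fun j => ?_, by simp⟩
    dsimp only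
    split_ifs
    · exact ih
    · exact h0

/-- Right multiplication by long words in the `y i` turns any element into a polynomial. -/
theorem exists_isYPolynomial_mul (a : LeavittRing r) :
    ∃ N, ∀ v : List (Fin r), N ≤ v.length → ∃ M, IsYPolynomial M (a * (v.map y).prod) := by
  have hmon : ∀ a ∈ monomials r, ∃ N, ∀ v : List (Fin r), N ≤ v.length →
      ∃ M, IsYPolynomial M (a * (v.map y).prod) := by
    intro a ha
    induction ha using Submonoid.closure_induction_right with
    | one => exact ⟨0, fun v _ => ⟨_, by simpa using IsYPolynomial.prod_y v⟩⟩
    | mul_right a _ g hg ih =>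
      obtain ⟨N, hN⟩ := ih
      rcases hg with ⟨i, rfl⟩ | ⟨i, rfl⟩
      · refine ⟨N + 1, fun v hv => ?_⟩
        cases v with
        | nil => simp at hv
        | cons j v =>
          by_cases hij : i = j
          · obtain ⟨M, hM⟩ := hN v (by simpa using hv)
            refine ⟨M, ?_⟩
            rwa [List.map_cons, List.prod_cons, mul_assoc, ← mul_assoc (x i), x_mul_y, if_pos hij,
              one_mul]
          · refine ⟨0, 0, ?_⟩
            rw [List.map_cons, List.prod_cons, mul_assoc, ← mul_assoc (x i), x_mul_y, if_neg hij]
            simp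
      · refine ⟨N, fun v hv => ?_⟩
        obtain ⟨M, hM⟩ := hN (i :: v) (by simp; omega)
        exact ⟨M, by simpa [mul_assoc] using hM⟩
  have hpos : ∀ a ∈ posCone r, ∃ N, ∀ v : List (Fin r), N ≤ v.length →
      ∃ M, IsYPolynomial M (a * (v.map y).prod) := by
    intro a ha
    induction ha using AddSubmonoid.closure_induction with
    | mem a ha => exact hmon a ha
    | zero => exact ⟨0, fun v _ => ⟨0, 0, by simp⟩⟩
    | add a b _ _ ha hb =>
      obtain ⟨N, hN⟩ := ha
      obtain ⟨N', hN'⟩ := hb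
      refine ⟨max N N', fun v hv => ?_⟩
      obtain ⟨M, hM⟩ := hN v (le_trans (le_max_left _ _) hv)
      obtain ⟨M', hM'⟩ := hN' v (le_trans (le_max_right _ _) hv)
      refine ⟨max M M', ?_⟩
      rw [add_mul]
      exact (hM.mono (le_max_left _ _)).add (hM'.mono (le_max_right _ _))
  obtain ⟨p, hp, q, hq, rfl⟩ := exists_eq_sub a
  obtain ⟨N, hN⟩ := hpos p hp
  obtain ⟨N', hN'⟩ := hpos q hq
  refine ⟨max N N', fun v hv => ?_⟩
  obtain ⟨M, hM⟩ := hN v (le_trans (le_max_left _ _) hv)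
  obtain ⟨M', hM'⟩ := hN' v (le_trans (le_max_right _ _) hv)
  refine ⟨max M M', ?_⟩
  rw [sub_mul]
  exact (hM.mono (le_max_left _ _)).sub (hM'.mono (le_max_right _ _))

theorem x_mul_sum (i : Fin r) (c : Fin r → LeavittRing r) : x i * ∑ j, y j * c j = c i := by
  simp [Finset.mul_sum, ← mul_assoc, x_mul_y]

/-- Compressing a polynomial `b` by a long power of `y i` and then multiplying by some `x j`,
`j ≠ i`, isolates an integer, namely the sum of the coefficients of the powers of `y i` in `b`. -/
theorem IsYPolynomial.exists_compress {i j : Fin r} (hij : j ≠ i) {M K : ℕ} (hK : M ≤ K)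
    {b : LeavittRing r} (hb : IsYPolynomial M b) :
    ∃ n : ℤ, x j * x i ^ K * b * y i ^ K = n * x j := by
  induction M generalizing K b with
  | zero =>
    obtain ⟨n, rfl⟩ := hb
    refine ⟨n, ?_⟩
    have hpow : x i ^ K * y i ^ K = (1 : LeavittRing r) := by
      have := prod_x_mul_prod_y (List.replicate K i)
      simpa using this
    rw [mul_assoc, mul_assoc, (Int.cast_commute n (y i ^ K)).eq, ← mul_assoc (x i ^ K), hpow,
      one_mul, (Int.cast_commute n (x j)).eq]
  | succ M ih =>
    obtain ⟨n, c, hc, rfl⟩ := hb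
    obtain ⟨K, rfl⟩ : ∃ K', K = K' + 1 := ⟨K - 1, by omega⟩
    obtain ⟨n', hn'⟩ := ih (K := K) (by omega) (hc i)
    refine ⟨n, ?_⟩
    have hpow : x i ^ (K + 1) * y i ^ (K + 1) = (1 : LeavittRing r) := by
      have := prod_x_mul_prod_y (List.replicate (K + 1) i)
      simpa using this
    have hzero : x j * y i = (0 : LeavittRing r) := by rw [x_mul_y, if_neg hij]
    rw [mul_add, add_mul]
    have h1 : x j * x i ^ (K + 1) * (n : LeavittRing r) * y i ^ (K + 1) = n * x j := by
      rw [mul_assoc, mul_assoc, (Int.cast_commute n (y i ^ (K + 1))).eq,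
        ← mul_assoc (x i ^ (K + 1)), hpow, one_mul, (Int.cast_commute n (x j)).eq]
    have h2 : x j * x i ^ (K + 1) * (∑ k, y k * c k) * y i ^ (K + 1) = 0 := by
      rw [pow_succ (x i), mul_assoc (x j), mul_assoc (x i ^ K), x_mul_sum, pow_succ (y i),
        ← mul_assoc (x j), ← mul_assoc, hn', mul_assoc, hzero, mul_zero]
    rw [h1, h2, add_zero]

theorem IsYPolynomial.eq_zero_of_map_eq_zero (hr : 2 ≤ r) {S : Type*} [Ring S]
    (hS : ∀ n : ℤ, (n : S) = 0 → n = 0) (f : LeavittRing r →+* S) {M : ℕ} {b : LeavittRing r}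
    (hb : IsYPolynomial M b) (hfb : f b = 0) : b = 0 := by
  induction M generalizing b with
  | zero =>
    obtain ⟨n, rfl⟩ := hb
    rw [hS n (by simpa using hfb), Int.cast_zero]
  | succ M ih =>
    obtain ⟨n, c, hc, rfl⟩ := hb
    let i : Fin r := ⟨0, by omega⟩
    let j : Fin r := ⟨1, by omega⟩
    have hij : j ≠ i := by simp [i, j]
    have hzero : x j * y i = (0 : LeavittRing r) := by rw [x_mul_y, if_neg hij]
    obtain ⟨n', hn'⟩ := (hc i).exists_compress hij le_rfl
    -- the constant coefficient of the polynomial is the value of a two-sided compression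
    have key : x j * x i ^ (M + 1) * (n + ∑ k, y k * c k) * y i ^ (M + 1) * y j = n := by
      have hpow : x i ^ (M + 1) * y i ^ (M + 1) = (1 : LeavittRing r) := by
        have := prod_x_mul_prod_y (List.replicate (M + 1) i)
        simpa using this
      have h1 : x j * x i ^ (M + 1) * (n : LeavittRing r) * y i ^ (M + 1) = n * x j := by
        rw [mul_assoc, mul_assoc, (Int.cast_commute n (y i ^ (M + 1))).eq,
          ← mul_assoc (x i ^ (M + 1)), hpow, one_mul, (Int.cast_commute n (x j)).eq]
      have h2 : x j * x i ^ (M + 1) * (∑ k, y k * c k) * y i ^ (M + 1) = 0 := by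
        rw [pow_succ (x i), mul_assoc (x j), mul_assoc (x i ^ M), x_mul_sum, pow_succ (y i),
          ← mul_assoc (x j), ← mul_assoc, hn', mul_assoc, hzero, mul_zero]
      rw [mul_add, add_mul, h1, h2, add_zero, mul_assoc, x_mul_y, if_pos rfl, mul_one]
    have hn : n = 0 := by
      apply hS
      have := congrArg f key
      rw [map_mul, map_mul, map_mul, hfb, mul_zero, zero_mul, zero_mul, map_intCast] at this
      exact this.symm
    subst hn
    rw [Int.cast_zero, zero_add] at hfb ⊢
    refine Finset.sum_eq_zero fun k _ => ?_
    rw [ih (hc k) (by rw [← x_mul_sum k c, map_mul, hfb, mul_zero]), mul_zero]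

/-- The projections `y_v x_v` over the words `v` of a given length add up to `1`: an element is
zero as soon as its products with all `y_v` are. -/
theorem eq_zero_of_mul_prod_y (N : ℕ) {a : LeavittRing r}
    (h : ∀ v : List (Fin r), v.length = N → a * (v.map y).prod = 0) : a = 0 := by
  induction N generalizing a with
  | zero => simpa using h [] rfl
  | succ N ih =>
    rw [← mul_one a, ← sum_y_mul_x, Finset.mul_sum]
    refine Finset.sum_eq_zero fun i _ => ?_
    rw [← mul_assoc, ih (a := a * y i), zero_mul]
    intro v hv
    rw [mul_assoc]
    exact h (i :: v) (by simp [hv])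

/-- Every ring homomorphism from the Leavitt ring to a ring of characteristic zero is injective. -/
theorem injective_of_charZero (hr : 2 ≤ r) {S : Type*} [Ring S]
    (hS : ∀ n : ℤ, (n : S) = 0 → n = 0) (f : LeavittRing r →+* S) : Function.Injective f := by
  rw [injective_iff_map_eq_zero]
  intro a ha
  obtain ⟨N, hN⟩ := exists_isYPolynomial_mul a
  refine eq_zero_of_mul_prod_y N fun v hv => ?_
  obtain ⟨M, hM⟩ := hN v hv.ge
  exact hM.eq_zero_of_map_eq_zero hr hS f (by rw [map_mul, ha, zero_mul])

theorem intCast_eq_zero (hr : 1 ≤ r) {n : ℤ} (h : (n : LeavittRing r) = 0) : n = 0 := by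
  have := congrArg (state fun _ => (⟨0, hr⟩ : Fin r)) h
  rwa [← zsmul_one, map_zsmul, state_one, map_zero, smul_eq_mul, mul_one] at this

end LeavittRing

/-! ### Decompositions of projections -/

section Decomposition

variable {ι : Type} {A : Type} [Ring A] [StarRing A]

/-- The elements `s j` are isometries from `ε (lab j)` into `ε v` with orthogonal ranges that add
up to `ε v`; they identify `ε v` with the direct sum of the `ε (lab j)`. -/
structure IsIsometryFamily (ε : ι → A) (v : ι) {J : Type} [Fintype J] (lab : J → ι)
    (s : J → A) : Prop where
  mul_proj : ∀ j, s j * ε (lab j) = s j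
  star_mul_self : ∀ j, star (s j) * s j = ε (lab j)
  star_mul_of_ne : ∀ {i j}, i ≠ j → star (s i) * s j = 0
  sum_mul_star : ∑ j, s j * star (s j) = ε v

namespace IsIsometryFamily

variable {ε : ι → A} {u v : ι} {J J' L : Type} [Fintype J] [Fintype J'] [Fintype L]
  {lab : J → ι} {s : J → A}

theorem proj_mul (h : IsIsometryFamily ε v lab s) (j : J) : ε v * s j = s j := by
  rw [← h.sum_mul_star, Finset.sum_mul, Finset.sum_eq_single j]
  · rw [mul_assoc, h.star_mul_self, h.mul_proj]
  · intro i _ hij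
    rw [mul_assoc, h.star_mul_of_ne hij, mul_zero]
  · simp

theorem star_proj (h : IsIsometryFamily ε v lab s) : star (ε v) = ε v := by
  rw [← h.sum_mul_star]
  simp

theorem star_mul_proj (h : IsIsometryFamily ε v lab s) (j : J) : star (s j) * ε v = star (s j) := by
  conv_lhs => rw [← h.star_proj]
  rw [← star_mul, h.proj_mul]

theorem reindex (h : IsIsometryFamily ε v lab s) (e : J' ≃ J) :
    IsIsometryFamily ε v (lab ∘ e) (s ∘ e) where
  mul_proj j := h.mul_proj (e j)
  star_mul_self j := h.star_mul_self (e j)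
  star_mul_of_ne hij := h.star_mul_of_ne fun hj => hij (e.injective hj)
  sum_mul_star := by
    rw [← h.sum_mul_star]
    exact Equiv.sum_comp e fun j => s j * star (s j)

variable {labL : L → ι} {a : A} {b : L → A} {t : J → A}

/-- In a decomposition of `ε v`, a summand `ε u` may be replaced by a decomposition of `ε u`. -/
theorem substitute
    (h : IsIsometryFamily ε v (Sum.elim (fun _ : Unit => u) labL) (Sum.elim (fun _ => a) b))
    (ht : IsIsometryFamily ε u lab t) :
    IsIsometryFamily ε v (Sum.elim lab labL) (Sum.elim (fun j => a * t j) b) := by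
  have haa : star a * a = ε u := h.star_mul_self (Sum.inl ())
  have hab : ∀ l, star a * b l = 0 := fun l =>
    h.star_mul_of_ne (i := Sum.inl ()) (j := Sum.inr l) (by simp)
  have hba : ∀ l, star (b l) * a = 0 := fun l =>
    h.star_mul_of_ne (i := Sum.inr l) (j := Sum.inl ()) (by simp)
  have hae : a * ε u = a := h.mul_proj (Sum.inl ())
  have hst : ∀ i j, star (a * t i) * (a * t j) = star (t i) * t j := fun i j => by
    rw [star_mul, mul_assoc, ← mul_assoc (star a), haa, ht.proj_mul]
  refine ⟨?_, ?_, ?_, ?_⟩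
  · rintro (j | l)
    · simp [mul_assoc, ht.mul_proj]
    · exact h.mul_proj (Sum.inr l)
  · rintro (j | l)
    · exact (hst j j).trans (ht.star_mul_self j)
    · exact h.star_mul_self (Sum.inr l)
  · rintro (i | l) (j | l') hij
    · exact (hst i j).trans (ht.star_mul_of_ne fun h => hij (congrArg _ h))
    · simp [mul_assoc, hab]
    · simp [← mul_assoc, hba]
    · exact h.star_mul_of_ne (i := Sum.inr l) (j := Sum.inr l') (by simpa using hij)
  · rw [← h.sum_mul_star]
    simp only [Fintype.sum_sum_type, Sum.elim_inl, Sum.elim_inr, Finset.univ_unique,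
      Finset.sum_const, Finset.card_singleton, one_smul, star_mul]
    congr 1
    calc ∑ j, a * t j * (star (t j) * star a) = a * (∑ j, t j * star (t j)) * star a := by
          simp only [Finset.mul_sum, Finset.sum_mul, mul_assoc]
      _ = a * star a := by rw [ht.sum_mul_star, hae]

/-- In a decomposition of `ε v`, summands with the labels of a decomposition of `ε u` may be
collected into a single summand `ε u`. -/
theorem collect {c : J → A}
    (h : IsIsometryFamily ε v (Sum.elim lab labL) (Sum.elim c b))
    (ht : IsIsometryFamily ε u lab t) :
    IsIsometryFamily ε v (Sum.elim (fun _ : Unit => u) labL)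
      (Sum.elim (fun _ => ∑ j, c j * star (t j)) b) := by
  have hcc : ∀ i j, i ≠ j → star (c i) * c j = 0 := fun i j hij =>
    h.star_mul_of_ne (i := Sum.inl i) (j := Sum.inl j) (by simpa using hij)
  have hcj : ∀ j, star (c j) * c j = ε (lab j) := fun j => h.star_mul_self (Sum.inl j)
  have hcb : ∀ j l, star (c j) * b l = 0 := fun j l =>
    h.star_mul_of_ne (i := Sum.inl j) (j := Sum.inr l) (by simp)
  have hbc : ∀ l j, star (b l) * c j = 0 := fun l j =>
    h.star_mul_of_ne (i := Sum.inr l) (j := Sum.inl j) (by simp)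
  have hce : ∀ j, c j * ε (lab j) = c j := fun j => h.mul_proj (Sum.inl j)
  refine ⟨?_, ?_, ?_, ?_⟩
  · rintro (_ | l)
    · simp [Finset.sum_mul, mul_assoc, ht.star_mul_proj]
    · exact h.mul_proj (Sum.inr l)
  · rintro (_ | l)
    · simp only [Sum.elim_inl, star_sum, star_mul, star_star]
      rw [← ht.sum_mul_star, Finset.sum_mul]
      refine Finset.sum_congr rfl fun j _ => ?_
      rw [Finset.mul_sum, Finset.sum_eq_single j]
      · rw [mul_assoc, ← mul_assoc (star (c j)), hcj, ← mul_assoc, ht.mul_proj]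
      · intro i _ hij
        rw [mul_assoc, ← mul_assoc (star (c j)), hcc j i hij.symm, zero_mul, mul_zero]
      · simp
    · exact h.star_mul_self (Sum.inr l)
  · rintro (_ | l) (_ | l') hij
    · exact absurd rfl hij
    · simp [Finset.sum_mul, mul_assoc, hcb]
    · simp [Finset.mul_sum, ← mul_assoc, hbc]
    · exact h.star_mul_of_ne (i := Sum.inr l) (j := Sum.inr l') (by simpa using hij)
  · rw [← h.sum_mul_star]
    simp only [Fintype.sum_sum_type, Sum.elim_inl, Sum.elim_inr, Finset.univ_unique,
      Finset.sum_const, Finset.card_singleton, one_smul, star_sum, star_mul, star_star]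
    congr 1
    rw [Finset.sum_mul]
    refine Finset.sum_congr rfl fun j _ => ?_
    rw [Finset.mul_sum, Finset.sum_eq_single j]
    · rw [mul_assoc, ← mul_assoc (star (t j)), ht.star_mul_self, ← mul_assoc, hce]
    · intro i _ hij
      rw [mul_assoc, ← mul_assoc (star (t j)), ht.star_mul_of_ne hij.symm, zero_mul, mul_zero]
    · simp

end IsIsometryFamily

/-- An assignment to all labels `u`, `v` of an additive monoid of elements, thought of as maps from
`ε v` to `ε u`, that is closed under composition and under the involution. -/
structure ClosedSystem (ι A : Type) [Ring A] [StarRing A] where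
  /-- The elements that are thought of as maps from `ε v` to `ε u`. -/
  hom : ι → ι → AddSubmonoid A
  mul_mem : ∀ {u v w a b}, a ∈ hom u v → b ∈ hom v w → a * b ∈ hom u w
  star_mem : ∀ {u v a}, a ∈ hom u v → star a ∈ hom v u

/-- A family of labelled elements that is a decomposition of `ε v`. -/
def IsDecomposition (ε : ι → A) (v : ι) (D : Multiset (ι × A)) : Prop :=
  ∃ (J : Type) (_ : Fintype J) (lab : J → ι) (s : J → A),
    IsIsometryFamily ε v lab s ∧ D = Finset.univ.val.map fun j => (lab j, s j)

/-- Two finite families with the same values differ by a bijection of the index sets. -/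
theorem exists_equiv_of_map_univ_eq {I J : Type} [Fintype I] [Fintype J] {f : I → ι} {g : J → ι}
    (h : Finset.univ.val.map f = Finset.univ.val.map g) : ∃ e : I ≃ J, g ∘ e = f := by
  classical
  have hc : ∀ c, Nonempty ({i // f i = c} ≃ {j // g j = c}) := by
    intro c
    rw [← Fintype.card_eq, Fintype.card_subtype, Fintype.card_subtype]
    have := congrArg (Multiset.count c) h
    rw [Multiset.count_map, Multiset.count_map] at this
    simp only [eq_comm (a := c)] at this
    exact this
  let e := fun c => (hc c).some
  exact ⟨Equiv.ofFiberEquiv e, funext fun i => Equiv.ofFiberEquiv_map e i⟩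

theorem map_univ_sumElim {I J : Type} [Fintype I] [Fintype J] {β : Type} (f : I → β) (g : J → β) :
    (Finset.univ : Finset (I ⊕ J)).val.map (Sum.elim f g) =
      Finset.univ.val.map f + Finset.univ.val.map g := by
  rw [← Finset.univ_disjSum_univ, Finset.val_disjSum, Multiset.disjSum, Multiset.map_add,
    Multiset.map_map, Multiset.map_map]
  rfl

theorem forall_mem_map_univ {I : Type} [Fintype I] {β : Type} (f : I → β) (p : β → Prop) :
    (∀ b ∈ Finset.univ.val.map f, p b) ↔ ∀ i, p (f i) := by
  simp

namespace IsDecomposition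

variable {ε : ι → A} {u v : ι} {D Du : Multiset (ι × A)} {w : Multiset ι}

theorem exists_family (h : IsDecomposition ε v D) {I : Type} [Fintype I] {lab : I → ι}
    (hlab : D.map Prod.fst = Finset.univ.val.map lab) :
    ∃ s : I → A, IsIsometryFamily ε v lab s ∧ D = Finset.univ.val.map fun i => (lab i, s i) := by
  obtain ⟨J, _, lab', s, hs, rfl⟩ := h
  rw [Multiset.map_map] at hlab
  obtain ⟨e, he⟩ := exists_equiv_of_map_univ_eq hlab.symm
  have he' : lab' ∘ e = lab := he
  subst he'
  refine ⟨s ∘ e, hs.reindex e, ?_⟩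
  rw [← Multiset.map_univ_val_equiv e, Multiset.map_map]
  rfl

theorem exists_substitute (h : IsDecomposition ε v D) (hu : IsDecomposition ε u Du)
    (hD : D.map Prod.fst = {u} + w) :
    ∃ D', D'.map Prod.fst = Du.map Prod.fst + w ∧ IsDecomposition ε v D' ∧
      ∀ B : ClosedSystem ι A, (∀ p ∈ Du, p.2 ∈ B.hom u p.1) →
        ((∀ p ∈ D, p.2 ∈ B.hom v p.1) ↔ ∀ p ∈ D', p.2 ∈ B.hom v p.1) := by
  classical
  obtain ⟨J, _, lab, t, ht, rfl⟩ := hu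
  obtain ⟨s, hs, rfl⟩ := h.exists_family
    (lab := Sum.elim (fun _ : Unit => u) (fun i : w.ToType => (i : ι))) (by
      rw [hD, map_univ_sumElim, Multiset.map_univ_coe]
      simp)
  obtain ⟨a, b, rfl⟩ : ∃ (a : A) (b : w.ToType → A), s = Sum.elim (fun _ => a) b :=
    ⟨s (Sum.inl ()), s ∘ Sum.inr, by ext (_ | _) <;> rfl⟩
  have hs' := hs.substitute ht
  refine ⟨_, ?_, ⟨_, _, _, _, hs', rfl⟩, ?_⟩
  · rw [Multiset.map_map, Multiset.map_map]
    change Multiset.map (Sum.elim lab fun i : w.ToType => (i : ι)) _ = Multiset.map lab _ + _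
    rw [map_univ_sumElim, Multiset.map_univ_coe]
  · intro B hB
    rw [forall_mem_map_univ] at hB
    rw [forall_mem_map_univ, forall_mem_map_univ, Sum.forall, Sum.forall]
    simp only [Sum.elim_inl, Sum.elim_inr, forall_const]
    refine and_congr_left fun _ => ⟨fun h j => B.mul_mem h (hB j), fun h => ?_⟩
    have ha : a = ∑ j, a * t j * star (t j) := by
      simp only [mul_assoc, ← Finset.mul_sum, ht.sum_mul_star]
      exact (hs.mul_proj (Sum.inl ())).symm
    rw [ha]
    exact AddSubmonoid.sum_mem _ fun j _ => B.mul_mem (h j) (B.star_mem (hB j))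

theorem exists_collect (h : IsDecomposition ε v D) (hu : IsDecomposition ε u Du)
    (hD : D.map Prod.fst = Du.map Prod.fst + w) :
    ∃ D', D'.map Prod.fst = {u} + w ∧ IsDecomposition ε v D' ∧
      ∀ B : ClosedSystem ι A, (∀ p ∈ Du, p.2 ∈ B.hom u p.1) →
        ((∀ p ∈ D, p.2 ∈ B.hom v p.1) ↔ ∀ p ∈ D', p.2 ∈ B.hom v p.1) := by
  classical
  obtain ⟨J, _, lab, t, ht, rfl⟩ := hu
  obtain ⟨s, hs, rfl⟩ := h.exists_family
    (lab := Sum.elim lab (fun i : w.ToType => (i : ι))) (by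
      rw [hD, map_univ_sumElim, Multiset.map_univ_coe, Multiset.map_map]
      rfl)
  obtain ⟨c, b, rfl⟩ : ∃ (c : J → A) (b : w.ToType → A), s = Sum.elim c b :=
    ⟨s ∘ Sum.inl, s ∘ Sum.inr, by ext (_ | _) <;> rfl⟩
  have hs' := hs.collect ht
  refine ⟨_, ?_, ⟨_, _, _, _, hs', rfl⟩, ?_⟩
  · rw [Multiset.map_map]
    change Multiset.map (Sum.elim (fun _ : Unit => u) fun i : w.ToType => (i : ι)) _ = _
    rw [map_univ_sumElim, Multiset.map_univ_coe]
    simp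
  · intro B hB
    rw [forall_mem_map_univ] at hB
    rw [forall_mem_map_univ, forall_mem_map_univ, Sum.forall, Sum.forall]
    simp only [Sum.elim_inl, Sum.elim_inr, forall_const]
    refine and_congr_left fun _ => ⟨fun h => ?_, fun h j => ?_⟩
    · exact AddSubmonoid.sum_mem _ fun j _ => B.mul_mem (h j) (B.star_mem (hB j))
    · have hc : c j = (∑ i, c i * star (t i)) * t j := by
        rw [Finset.sum_mul, Finset.sum_eq_single j]
        · rw [mul_assoc, ht.star_mul_self]
          exact (hs.mul_proj (Sum.inl j)).symm
        · intro i _ hij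
          rw [mul_assoc, ht.star_mul_of_ne hij, mul_zero]
        · simp
      rw [hc]
      exact B.mul_mem h (hB j)

end IsDecomposition

/-! ### Presentations and elementary moves -/

/-- Every projection `ε v` has a decomposition into copies of the `ε u`, with multiplicities
prescribed by `M v`, such that the elements of these decompositions are positive (lie in `K`) and
generate, under sums, composition and the involution, all positive elements as endomorphisms of
`ε q`. -/
def Presents [Fintype ι] (ε : ι → A) (K : AddSubmonoid A) (q : ι) (M : ι → ι → ℕ) : Prop :=
  ∃ F : ι → Multiset (ι × A),
    (∀ v, (F v).map Prod.fst = ∑ u, M v u • {u}) ∧ (∀ v, IsDecomposition ε v (F v)) ∧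
    (∀ v, ∀ p ∈ F v, p.2 ∈ K) ∧
    ∀ B : ClosedSystem ι A, (∀ v, ∀ p ∈ F v, p.2 ∈ B.hom v p.1) → ∀ a ∈ K, a ∈ B.hom q q

variable [Fintype ι] {ε : ι → A} {K : AddSubmonoid A} {q : ι}

/-- One of the decompositions of a presentation may be exchanged for another one that generates the
same elements in the presence of the decomposition with label `u`. -/
theorem Presents.of_replace
    (hmul : ∀ a ∈ K, ∀ b ∈ K, a * b ∈ K) (hstar : ∀ a ∈ K, star a ∈ K)
    {M M' : ι → ι → ℕ} {u v : ι} (huv : u ≠ v) (hM' : ∀ z, z ≠ v → M' z = M z)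
    (h : ∀ D Du : Multiset (ι × A), IsDecomposition ε v D → IsDecomposition ε u Du →
      D.map Prod.fst = ∑ z, M v z • {z} → Du.map Prod.fst = ∑ z, M u z • {z} →
      ∃ D', D'.map Prod.fst = ∑ z, M' v z • {z} ∧ IsDecomposition ε v D' ∧
        ∀ B : ClosedSystem ι A, (∀ p ∈ Du, p.2 ∈ B.hom u p.1) →
          ((∀ p ∈ D, p.2 ∈ B.hom v p.1) ↔ ∀ p ∈ D', p.2 ∈ B.hom v p.1))
    (hM : Presents ε K q M) : Presents ε K q M' := by
  classical
  obtain ⟨F, hF, hdec, hK, hgen⟩ := hM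
  obtain ⟨D', hD', hdec', hB⟩ := h (F v) (F u) (hdec v) (hdec u) (hF v) (hF u)
  refine ⟨Function.update F v D', fun z => ?_, fun z => ?_, fun z => ?_, fun B hBF => ?_⟩
  · by_cases hz : z = v
    · subst hz; simpa using hD'
    · rw [Function.update_of_ne hz, hF, hM' z hz]
  · by_cases hz : z = v
    · subst hz; simpa using hdec'
    · rw [Function.update_of_ne hz]; exact hdec z
  · by_cases hz : z = v
    · subst hz
      rw [Function.update_self]
      exact (hB ⟨fun _ _ => K, fun ha hb => hmul _ ha _ hb, fun ha => hstar _ ha⟩ (hK u)).1 (hK z)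
    · rw [Function.update_of_ne hz]; exact hK z
  · refine hgen B fun z => ?_
    by_cases hz : z = v
    · subst hz
      have hu := hBF u
      rw [Function.update_of_ne huv] at hu
      have hv := hBF z
      rw [Function.update_self] at hv
      exact (hB B hu).2 hv
    · have := hBF z
      rwa [Function.update_of_ne hz] at this

open Classical in
/-- The elementary move: the multiplicities `M v = δ_u + c` may be changed to `M u + c` and back. -/
theorem presents_iff_of_move
    (hmul : ∀ a ∈ K, ∀ b ∈ K, a * b ∈ K) (hstar : ∀ a ∈ K, star a ∈ K)
    {M M' : ι → ι → ℕ} {u v : ι} (huv : u ≠ v) (hM' : ∀ z, z ≠ v → M' z = M z) (c : ι → ℕ)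
    (h1 : ∀ z, M v z = c z + if z = u then 1 else 0) (h2 : ∀ z, M' v z = c z + M u z) :
    Presents ε K q M ↔ Presents ε K q M' := by
  have e1 : ∑ z, M v z • ({z} : Multiset ι) = {u} + ∑ z, c z • {z} := by
    simp only [h1, add_smul, Finset.sum_add_distrib, ite_smul, one_smul, zero_smul,
      Finset.sum_ite_eq', Finset.mem_univ, if_true]
    rw [add_comm]
  have e2 : ∑ z, M' v z • ({z} : Multiset ι) = ∑ z, M u z • {z} + ∑ z, c z • {z} := by
    simp only [h2, add_smul, Finset.sum_add_distrib]
    rw [add_comm]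
  constructor
  · refine Presents.of_replace hmul hstar huv hM' fun D Du hD hDu hd hdu => ?_
    rw [e2, ← hdu]
    exact hD.exists_substitute hDu (hd.trans e1)
  · refine Presents.of_replace hmul hstar huv (fun z hz => (hM' z hz).symm)
      fun D Du hD hDu hd hdu => ?_
    rw [e1]
    rw [hM' u huv] at hdu
    exact hD.exists_collect hDu (by rw [hd, e2, hdu])

end Decomposition

/-! ### A chain of moves from multiplicity `d` to its inverse modulo `n` -/

section Chain

variable {A : Type} [Ring A] [StarRing A] {ε : Fin 3 → A} {K : AddSubmonoid A} {q : Fin 3}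
    (hmul : ∀ a ∈ K, ∀ b ∈ K, a * b ∈ K) (hstar : ∀ a ∈ K, star a ∈ K)
include hmul hstar

theorem presents_move01 (a b c : ℕ) (w : Fin 3 → ℕ) (a' b' c' : ℕ) :
    Presents ε K q ![![a, b + 1, c], ![a', b', c'], w] ↔
      Presents ε K q ![![a + a', b + b', c + c'], ![a', b', c'], w] := by
  refine presents_iff_of_move hmul hstar (u := 1) (v := 0) (by simp) ?_ ![a, b, c] ?_ ?_ <;>
    intro z <;> fin_cases z <;> simp

theorem presents_move02 (a b c : ℕ) (w : Fin 3 → ℕ) (a' b' c' : ℕ) :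
    Presents ε K q ![![a, b, c + 1], w, ![a', b', c']] ↔
      Presents ε K q ![![a + a', b + b', c + c'], w, ![a', b', c']] := by
  refine presents_iff_of_move hmul hstar (u := 2) (v := 0) (by simp) ?_ ![a, b, c] ?_ ?_ <;>
    intro z <;> fin_cases z <;> simp

theorem presents_move10 (a b c : ℕ) (w : Fin 3 → ℕ) (a' b' c' : ℕ) :
    Presents ε K q ![![a', b', c'], ![a + 1, b, c], w] ↔
      Presents ε K q ![![a', b', c'], ![a + a', b + b', c + c'], w] := by
  refine presents_iff_of_move hmul hstar (u := 0) (v := 1) (by simp) ?_ ![a, b, c] ?_ ?_ <;>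
    intro z <;> fin_cases z <;> simp

theorem presents_move12 (a b c : ℕ) (w : Fin 3 → ℕ) (a' b' c' : ℕ) :
    Presents ε K q ![w, ![a, b, c + 1], ![a', b', c']] ↔
      Presents ε K q ![w, ![a + a', b + b', c + c'], ![a', b', c']] := by
  refine presents_iff_of_move hmul hstar (u := 2) (v := 1) (by simp) ?_ ![a, b, c] ?_ ?_ <;>
    intro z <;> fin_cases z <;> simp

theorem presents_move20 (a b c : ℕ) (w : Fin 3 → ℕ) (a' b' c' : ℕ) :
    Presents ε K q ![![a', b', c'], w, ![a + 1, b, c]] ↔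
      Presents ε K q ![![a', b', c'], w, ![a + a', b + b', c + c']] := by
  refine presents_iff_of_move hmul hstar (u := 0) (v := 2) (by simp) ?_ ![a, b, c] ?_ ?_ <;>
    intro z <;> fin_cases z <;> simp

theorem presents_move21 (a b c : ℕ) (w : Fin 3 → ℕ) (a' b' c' : ℕ) :
    Presents ε K q ![w, ![a', b', c'], ![a, b + 1, c]] ↔
      Presents ε K q ![w, ![a', b', c'], ![a + a', b + b', c + c']] := by
  refine presents_iff_of_move hmul hstar (u := 1) (v := 2) (by simp) ?_ ![a, b, c] ?_ ?_ <;>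
    intro z <;> fin_cases z <;> simp

/-- Row operations on the second and the third decomposition: these may be changed by any matrix
in `SL₂(ℤ)` with nonnegative entries, because such matrices are products of elementary ones. -/
theorem presents_iff_of_det_eq_one (w : Fin 3 → ℕ) {n : ℕ} (hn : 1 ≤ n) (x y z t : ℕ)
    (hdet : x * t = y * z + 1) :
    Presents ε K q ![w, ![0, 1 + y * n, x], ![0, t * n, z + 1]] ↔
      Presents ε K q ![w, ![0, 1, 1], ![0, n, 1]] := by
  induction hs : x + y + z + t using Nat.strong_induction_on generalizing x y z t with
  | _ N ih =>
  subst hs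
  have hx : 1 ≤ x := Nat.one_le_iff_ne_zero.2 fun h => by simp [h] at hdet
  have ht : 1 ≤ t := Nat.one_le_iff_ne_zero.2 fun h => by simp [h] at hdet
  rcases le_or_gt t y with hty | hty
  · -- the first row dominates the second one
    obtain ⟨y, rfl⟩ := Nat.exists_eq_add_of_le hty
    have hzx : z < x := by
      by_contra hcon
      nlinarith [Nat.mul_le_mul_left t (not_lt.1 hcon), Nat.zero_le (y * z)]
    obtain ⟨x, rfl⟩ := Nat.exists_eq_add_of_lt hzx
    rw [← ih (x + 1 + y + z + t) (by omega) (x + 1) y z t (by nlinarith) rfl]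
    have := presents_move12 (ε := ε) (q := q) hmul hstar 0 (1 + y * n) x w 0 (t * n) (z + 1)
    rw [this, iff_iff_eq]
    congr! 4
    all_goals ring_nf
  · rcases le_or_gt x z with hxz | hxz
    · -- the second row dominates the first one
      obtain ⟨z, rfl⟩ := Nat.exists_eq_add_of_le hxz
      obtain ⟨t, rfl⟩ := Nat.exists_eq_add_of_lt hty
      rw [← ih (x + y + z + (t + 1)) (by omega) x y z (t + 1) (by nlinarith) rfl]
      obtain ⟨n, rfl⟩ : ∃ k, n = k + 1 := ⟨n - 1, by omega⟩
      have := presents_move21 (ε := ε) (q := q) hmul hstar 0 ((t + 1) * n + t) (z + 1) w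
        0 (1 + y * (n + 1)) x
      have e : (t + 1) * n + t + 1 = (t + 1) * (n + 1) := by ring
      rw [e] at this
      rw [this, iff_iff_eq]
      congr! 4
      all_goals ring_nf
    · obtain ⟨rfl, rfl⟩ : y = 0 ∧ z = 0 := by
        have := Nat.mul_le_mul (Nat.succ_le_of_lt hxz) (Nat.succ_le_of_lt hty)
        rw [hdet, Nat.succ_mul_succ] at this
        constructor <;> nlinarith
      obtain ⟨rfl, rfl⟩ : x = 1 ∧ t = 1 := by
        rw [zero_mul, zero_add] at hdet
        exact mul_eq_one.1 hdet
      simp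

/-- From `P = P ⊕ R`, `Q = d P`, `R = n P` to `P = e Q`, `Q = (1 + n) Q`, `R = n Q`. -/
theorem presents_chain {n d e k : ℕ} (hn : 1 ≤ n) (hde : d * e = 1 + k * n)
    (h : Presents ε K q ![![1, 0, 1], ![d, 0, 0], ![n, 0, 0]]) :
    Presents ε K q ![![0, e, 0], ![0, 1 + n, 0], ![0, n, 0]] := by
  obtain ⟨n, rfl⟩ : ∃ k, n = k + 1 := ⟨n - 1, by omega⟩
  have he : 1 ≤ e := Nat.one_le_iff_ne_zero.2 fun h => by simp [h] at hde; omega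
  obtain ⟨e, rfl⟩ : ∃ k, e = k + 1 := ⟨e - 1, by omega⟩
  -- `R = n P ⊕ R`
  rw [presents_move20 hmul hstar] at h
  simp only [add_zero, zero_add] at h
  -- `P = (1 + k n) P ⊕ R`
  have h2 : ∀ j, Presents ε K q ![![1 + j * (n + 1), 0, 1], ![d, 0, 0], ![n + 1, 0, 1]] := by
    intro j
    induction j with
    | zero => simpa using h
    | succ j ih =>
      have := (presents_move02 (ε := ε) (q := q) hmul hstar (1 + j * (n + 1)) 0 0 ![d, 0, 0]
        (n + 1) 0 1).1 (by simpa using ih)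
      rwa [add_assoc, ← Nat.succ_mul] at this
  -- `P = e Q ⊕ R`
  have h3 : ∀ j, ∀ i, i + j = e + 1 →
      Presents ε K q ![![i * d, j, 1], ![d, 0, 0], ![n + 1, 0, 1]] := by
    intro j
    induction j with
    | zero =>
      intro i hi
      have := h2 k
      rw [← hde] at this
      rw [add_zero] at hi
      rwa [hi, mul_comm]
    | succ j ih =>
      intro i hi
      have := ih (i + 1) (by omega)
      rw [presents_move01 hmul hstar]
      rwa [Nat.succ_mul] at this
  have h3 := h3 (e + 1) 0 (by omega)
  rw [zero_mul] at h3
  -- `Q = d e Q ⊕ d R`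
  have h4 : ∀ j, ∀ i, i + j = d →
      Presents ε K q ![![0, e + 1, 1], ![i, j * (e + 1), j], ![n + 1, 0, 1]] := by
    intro j
    induction j with
    | zero => intro i hi; rw [add_zero] at hi; simpa [hi] using h3
    | succ j ih =>
      intro i hi
      have := (presents_move10 (ε := ε) (q := q) hmul hstar i (j * (e + 1)) j ![n + 1, 0, 1]
        0 (e + 1) 1).1 (ih (i + 1) (by omega))
      rwa [← Nat.succ_mul] at this
  have h4 := h4 d 0 (by omega)
  -- `R = n e Q ⊕ (n + 1) R`
  have h5 : ∀ j, ∀ i, i + j = n + 1 →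
      Presents ε K q ![![0, e + 1, 1], ![0, d * (e + 1), d], ![i, j * (e + 1), j + 1]] := by
    intro j
    induction j with
    | zero => intro i hi; rw [add_zero] at hi; simpa [hi] using h4
    | succ j ih =>
      intro i hi
      have := (presents_move20 (ε := ε) (q := q) hmul hstar i (j * (e + 1)) (j + 1)
        ![0, d * (e + 1), d] 0 (e + 1) 1).1 (ih (i + 1) (by omega))
      rwa [← Nat.succ_mul] at this
  have h5 := h5 (n + 1) 0 (by omega)
  rw [hde, mul_comm (n + 1) (e + 1),
    presents_iff_of_det_eq_one hmul hstar _ (by omega) d k (n + 1) (e + 1) (by omega)] at h5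
  -- `P = e Q`
  have h6 : Presents ε K q ![![0, e + 1, 0], ![0, 1, 1], ![0, n + 1, 1]] := by
    rwa [presents_move01 hmul hstar]
  -- `R = n Q`
  have h7 : Presents ε K q ![![0, e + 1, 0], ![0, 1, 1], ![0, n + 1, 0]] := by
    rwa [presents_move21 hmul hstar]
  rw [presents_move12 hmul hstar] at h7
  simpa using h7

end Chain

/-! ### The Leavitt ring as a matrix ring over itself -/

section EndOfChain

variable {A : Type} [Ring A] [StarRing A] {ε : Fin 3 → A} {K : AddSubmonoid A}

/-- If all projections are multiples of `ε 1 = 1`, and in particular `1 = r • 1`, then the ring is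
the Leavitt ring: the generators coming from the other decompositions contribute nothing new to the
endomorphisms of `ε 1`. -/
theorem Presents.exists_leavittRing_equiv {r : ℕ} (hr : 2 ≤ r)
    (hmul : ∀ a ∈ K, ∀ b ∈ K, a * b ∈ K) (hstar : ∀ a ∈ K, star a ∈ K)
    (hone : 1 ∈ K) (hsub : ∀ a, ∃ p ∈ K, ∃ q ∈ K, a = p - q)
    (hchar : ∀ n : ℤ, (n : A) = 0 → n = 0) (hε : ε 1 = 1) {N : Fin 3 → ℕ} (hN : N 1 = r)
    (h : Presents ε K 1 fun v => ![0, N v, 0]) :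
    ∃ f : LeavittRing r ≃+* A, (∀ a, f (star a) = star (f a)) ∧
      ∀ a, f a ∈ K ↔ a ∈ LeavittRing.posCone r := by
  obtain ⟨F, hF, hdec, hK, hgen⟩ := h
  have hex : ∀ v, ∃ s : Fin (N v) → A, IsIsometryFamily ε v (fun _ => 1) s ∧
      F v = Finset.univ.val.map fun j => (1, s j) := fun v =>
    (hdec v).exists_family (by rw [hF]; simp [Fin.sum_univ_three, Multiset.nsmul_singleton])
  choose s hs hFs using hex
  subst hN
  have hxy : ∀ i j, star (s 1 i) * s 1 j = if i = j then 1 else 0 := by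
    intro i j
    split_ifs with hij
    · rw [hij, (hs 1).star_mul_self, hε]
    · exact (hs 1).star_mul_of_ne hij
  have hsum : ∑ i, s 1 i * star (s 1 i) = 1 := by rw [(hs 1).sum_mul_star, hε]
  let f : LeavittRing (N 1) →+* A := LeavittRing.lift (fun i => star (s 1 i)) (s 1) hxy hsum
  have hfx : ∀ i, f (LeavittRing.x i) = star (s 1 i) := LeavittRing.lift_x _ _ _ _
  have hfy : ∀ i, f (LeavittRing.y i) = s 1 i := LeavittRing.lift_y _ _ _ _
  have hsK : ∀ i, s 1 i ∈ K := fun i => hK 1 (1, s 1 i) (by rw [hFs]; simp)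
  have hfK : ∀ a ∈ LeavittRing.posCone (N 1), f a ∈ K := by
    intro a ha
    induction ha using AddSubmonoid.closure_induction with
    | mem a ha =>
      replace ha : a ∈ LeavittRing.monomials (N 1) := ha
      induction ha using Submonoid.closure_induction with
      | mem a ha =>
        rcases ha with ⟨i, rfl⟩ | ⟨i, rfl⟩
        · rw [hfx]; exact hstar _ (hsK i)
        · rw [hfy]; exact hsK i
      | one => rwa [map_one]
      | mul a b _ _ h1 h2 => rw [map_mul]; exact hmul _ h1 _ h2
    | zero => rw [map_zero]; exact zero_mem _
    | add a b _ _ h1 h2 => rw [map_add]; exact add_mem h1 h2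
  have hfstar : ∀ a, f (star a) = star (f a) := by
    -- both sides are ring homomorphisms to the opposite ring
    let g₁ : LeavittRing (N 1) →+* Aᵐᵒᵖ :=
      (RingHom.op f).comp (starRingEquiv : LeavittRing (N 1) ≃+* _).toRingHom
    let g₂ : LeavittRing (N 1) →+* Aᵐᵒᵖ := (starRingEquiv : A ≃+* _).toRingHom.comp f
    have hg : g₁ = g₂ := by
      apply LeavittRing.hom_ext <;> intro i <;> simp [g₁, g₂, hfx, hfy]
    intro a
    exact MulOpposite.op_injective (DFunLike.congr_fun hg a)
  let P : AddSubmonoid A := (LeavittRing.posCone (N 1)).map f.toAddMonoidHom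
  have hP : ∀ {a}, a ∈ P ↔ ∃ b ∈ LeavittRing.posCone (N 1), f b = a := AddSubmonoid.mem_map
  have hPmul : ∀ {a b}, a ∈ P → b ∈ P → a * b ∈ P := by
    intro a b ha hb
    obtain ⟨a, ha', rfl⟩ := hP.1 ha
    obtain ⟨b, hb', rfl⟩ := hP.1 hb
    exact hP.2 ⟨_, LeavittRing.mul_mem_posCone ha' hb', map_mul f a b⟩
  have hPstar : ∀ {a}, a ∈ P → star a ∈ P := by
    intro a ha
    obtain ⟨a, ha', rfl⟩ := hP.1 ha
    exact hP.2 ⟨_, LeavittRing.star_mem_posCone ha', hfstar a⟩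
  have hPs : ∀ i, s 1 i ∈ P := fun i =>
    hP.2 ⟨LeavittRing.y i, by simpa using LeavittRing.prod_y_mem [i], hfy i⟩
  have hP0 : (0 : A) ∈ P := zero_mem _
  -- the maps that have all their matrix entries, with respect to the decompositions, in `P`
  let B : ClosedSystem (Fin 3) A :=
    { hom := fun u v =>
        { carrier := {a | ε u * a = a ∧ a * ε v = a ∧ ∀ i j, star (s u i) * a * s v j ∈ P}
          zero_mem' := ⟨mul_zero _, zero_mul _, fun i j => by simp [hP0]⟩
          add_mem' := fun {a b} ha hb => ⟨by rw [mul_add, ha.1, hb.1],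
            by rw [add_mul, ha.2.1, hb.2.1], fun i j => by
              rw [mul_add, add_mul]; exact add_mem (ha.2.2 i j) (hb.2.2 i j)⟩ }
      mul_mem := fun {u v w a b} ha hb => ⟨by rw [← mul_assoc, ha.1],
        by rw [mul_assoc, hb.2.1], fun i j => by
          have : star (s u i) * (a * b) * s w j =
              ∑ k, (star (s u i) * a * s v k) * (star (s v k) * b * s w j) := by
            conv_lhs => rw [← ha.2.1, ← (hs v).sum_mul_star]
            simp only [Finset.mul_sum, Finset.sum_mul, mul_assoc]
          rw [this]
          exact AddSubmonoid.sum_mem _ fun k _ => hPmul (ha.2.2 i k) (hb.2.2 k j)⟩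
      star_mem := fun {u v a} ha => ⟨by rw [← (hs v).star_proj, ← star_mul, ha.2.1],
        by rw [← (hs u).star_proj, ← star_mul, ha.1], fun i j => by
          simpa [mul_assoc] using hPstar (ha.2.2 j i)⟩ }
  have hKP : ∀ a ∈ K, a ∈ P := by
    intro a ha
    have haB : a ∈ B.hom 1 1 := by
      refine hgen B (fun v p hp => ?_) a ha
      rw [hFs] at hp
      obtain ⟨j, _, rfl⟩ := Multiset.mem_map.1 hp
      refine ⟨(hs v).proj_mul j, (hs v).mul_proj j, fun i k => ?_⟩
      by_cases hij : i = j
      · subst hij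
        change star (s v i) * s v i * s 1 k ∈ P
        rw [(hs v).star_mul_self, hε, one_mul]
        exact hPs k
      · change star (s v i) * s v j * s 1 k ∈ P
        rw [(hs v).star_mul_of_ne hij, zero_mul]
        exact hP0
    have : a = ∑ i, ∑ j, s 1 i * (star (s 1 i) * a * s 1 j) * star (s 1 j) := by
      have : (∑ i, s 1 i * star (s 1 i)) * a * (∑ j, s 1 j * star (s 1 j)) = a := by
        rw [hsum, one_mul, mul_one]
      conv_lhs => rw [← this]
      simp only [Finset.mul_sum, Finset.sum_mul, mul_assoc]
      exact Finset.sum_comm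
    rw [this]
    exact AddSubmonoid.sum_mem _ fun i _ => AddSubmonoid.sum_mem _ fun j _ =>
      hPmul (hPmul (hPs i) (haB.2.2 i j)) (hPstar (hPs j))
  have hinj : Function.Injective f := LeavittRing.injective_of_charZero hr hchar f
  have hsurj : Function.Surjective f := by
    intro a
    obtain ⟨p, hp, q, hq, rfl⟩ := hsub a
    obtain ⟨p, _, rfl⟩ := hP.1 (hKP p hp)
    obtain ⟨q, _, rfl⟩ := hP.1 (hKP q hq)
    exact ⟨p - q, map_sub f p q⟩
  refine ⟨RingEquiv.ofBijective f ⟨hinj, hsurj⟩, hfstar, fun a => ⟨fun ha => ?_, hfK a⟩⟩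
  obtain ⟨b, hb, hba⟩ := hP.1 (hKP _ ha)
  rwa [← hinj hba]

end EndOfChain

namespace LeavittRing

/-- The matrices with entries in the positive cone. -/
def matrixPosCone (d r : ℕ) : AddSubmonoid (Matrix (Fin d) (Fin d) (LeavittRing r)) where
  carrier := {a | ∀ i j, a i j ∈ posCone r}
  zero_mem' _ _ := zero_mem _
  add_mem' ha hb i j := add_mem (ha i j) (hb i j)

variable {d r : ℕ}

theorem single_mem_matrixPosCone (i j : Fin d) {p : LeavittRing r} (hp : p ∈ posCone r) :
    Matrix.single i j p ∈ matrixPosCone d r := by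
  intro k l
  rw [Matrix.single_apply]
  split_ifs
  · exact hp
  · exact zero_mem _

theorem x_mem_posCone (i : Fin r) : x i ∈ posCone r := by simpa using prod_x_mem [i]

theorem y_mem_posCone (i : Fin r) : y i ∈ posCone r := by simpa using prod_y_mem [i]

/-- The projections of `M_{d+1}(L_{n+1})` at the start of the chain: a rank one projection, the
identity, and the part of the rank one projection complementary to the range of `y 0`. -/
def chainProj (d n : ℕ) : Fin 3 → Matrix (Fin (d + 1)) (Fin (d + 1)) (LeavittRing (n + 1)) :=
  ![Matrix.single 0 0 1, 1, Matrix.single 0 0 (∑ i : Fin n, y i.succ * x i.succ)]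

theorem y_zero_mul_x_zero_add {n : ℕ} :
    y 0 * x 0 + ∑ i : Fin n, y i.succ * x i.succ = (1 : LeavittRing (n + 1)) := by
  rw [← sum_y_mul_x, Fin.sum_univ_succ]

theorem sum_succ_mul_y_succ {n : ℕ} (j : Fin n) :
    (∑ i : Fin n, y i.succ * x i.succ) * y j.succ = (y j.succ : LeavittRing (n + 1)) := by
  simp [Finset.sum_mul, mul_assoc, x_mul_y]

theorem sum_succ_mul_y_zero {n : ℕ} :
    (∑ i : Fin n, y i.succ * x i.succ) * y 0 = (0 : LeavittRing (n + 1)) := by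
  simp [Finset.sum_mul, mul_assoc, x_mul_y]

theorem x_zero_mul_sum_succ {n : ℕ} :
    x 0 * (∑ i : Fin n, y i.succ * x i.succ) = (0 : LeavittRing (n + 1)) := by
  simp [Finset.mul_sum, ← mul_assoc, x_mul_y, (Fin.succ_ne_zero _).symm]

theorem star_sum_succ {n : ℕ} :
    star (∑ i : Fin n, y i.succ * x i.succ) =
      (∑ i : Fin n, y i.succ * x i.succ : LeavittRing (n + 1)) := by
  simp

theorem sum_succ_mul_self {n : ℕ} :
    (∑ i : Fin n, y i.succ * x i.succ) * (∑ i : Fin n, y i.succ * x i.succ) =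
      (∑ i : Fin n, y i.succ * x i.succ : LeavittRing (n + 1)) := by
  simp only [Finset.mul_sum, ← mul_assoc, sum_succ_mul_y_succ]

/-- The three decompositions `P = P ⊕ R`, `Q = (d + 1) P` and `R = n P`, where the first one is
`y 0 * x 0 + R = 1` in the corner of `P`, generate the positive cone of `M_{d+1}(L_{n+1})`. -/
theorem presents_start (d n : ℕ) :
    Presents (chainProj d n) (matrixPosCone (d + 1) (n + 1)) 1
      ![![1, 0, 1], ![d + 1, 0, 0], ![n, 0, 0]] := by
  set R : LeavittRing (n + 1) := ∑ i : Fin n, y i.succ * x i.succ with hR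
  have hRpos : R ∈ posCone (n + 1) := AddSubmonoid.sum_mem _ fun i _ =>
    mul_mem_posCone (y_mem_posCone _) (x_mem_posCone _)
  have hfam0 : IsIsometryFamily (chainProj d n) 0 ![0, 2]
      ![Matrix.single 0 0 (y 0), Matrix.single 0 0 R] := by
    refine ⟨?_, ?_, ?_, ?_⟩
    · intro j
      fin_cases j
      · simp [chainProj]
      · have := sum_succ_mul_self (n := n)
        rw [← hR] at this
        simp [chainProj, ← hR, this]
    · intro j
      fin_cases j
      · simp [chainProj, Matrix.star_eq_conjTranspose, x_mul_y]
      · simp [chainProj, Matrix.star_eq_conjTranspose, hR, -star_sum, star_sum_succ,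
          sum_succ_mul_self]
    · intro i j hij
      fin_cases i <;> fin_cases j
      · exact absurd rfl hij
      · simp [Matrix.star_eq_conjTranspose, hR, x_zero_mul_sum_succ]
      · simp [Matrix.star_eq_conjTranspose, hR, -star_sum, star_sum_succ, sum_succ_mul_y_zero]
      · exact absurd rfl hij
    · simp [chainProj, Matrix.star_eq_conjTranspose, hR, -star_sum, star_sum_succ,
        sum_succ_mul_self, ← Matrix.single_add, y_zero_mul_x_zero_add]
  have hfam1 : IsIsometryFamily (chainProj d n) 1 (fun _ : Fin (d + 1) => 0)
      fun j => Matrix.single j 0 1 := by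
    refine ⟨?_, ?_, ?_, ?_⟩
    · intro j
      simp [chainProj]
    · intro j
      simp [chainProj, Matrix.star_eq_conjTranspose]
    · intro i j hij
      simp [Matrix.star_eq_conjTranspose, hij]
    · simp [chainProj, Matrix.star_eq_conjTranspose, Matrix.sum_single_one]
  have hfam2 : IsIsometryFamily (chainProj d n) 2 (fun _ : Fin n => 0)
      fun j => Matrix.single 0 0 (y j.succ) := by
    refine ⟨?_, ?_, ?_, ?_⟩
    · intro j
      simp [chainProj]
    · intro j
      simp [chainProj, Matrix.star_eq_conjTranspose, x_mul_y]
    · intro i j hij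
      simp [Matrix.star_eq_conjTranspose, x_mul_y, hij]
    · simp only [chainProj, Matrix.star_eq_conjTranspose, Matrix.conjTranspose_single, star_y,
        Matrix.single_mul_single_same]
      exact (map_sum (Matrix.singleAddMonoidHom (α := LeavittRing (n + 1)) (0 : Fin (d + 1))
        (0 : Fin (d + 1))) _ _).symm
  let D : Fin 3 → Multiset (Fin 3 × Matrix (Fin (d + 1)) (Fin (d + 1)) (LeavittRing (n + 1))) :=
    ![Finset.univ.val.map fun j => (![0, 2] j, ![Matrix.single 0 0 (y 0), Matrix.single 0 0 R] j),
      Finset.univ.val.map fun j : Fin (d + 1) => (0, Matrix.single j 0 1),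
      Finset.univ.val.map fun j : Fin n => (0, Matrix.single 0 0 (y j.succ))]
  -- a property of all members of the three families is checked on each of them
  have hD : ∀ p : Fin 3 → Fin 3 × Matrix (Fin (d + 1)) (Fin (d + 1)) (LeavittRing (n + 1)) → Prop,
      (∀ v, ∀ b ∈ D v, p v b) ↔ (p 0 (0, Matrix.single 0 0 (y 0)) ∧
        p 0 (2, Matrix.single 0 0 R)) ∧ (∀ j, p 1 (0, Matrix.single j 0 1)) ∧
        ∀ j : Fin n, p 2 (0, Matrix.single 0 0 (y j.succ)) := by
    intro p
    simp [D, Fin.forall_fin_succ]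
  refine ⟨D, ?_, ?_, (hD _).2 ⟨⟨?_, ?_⟩, ?_, ?_⟩, ?_⟩
  · intro v
    fin_cases v
    · simp [D, Fin.sum_univ_three]
      rfl
    · refine (Multiset.map_map Prod.fst (fun j : Fin (d + 1) => ((0 : Fin 3),
        (Matrix.single j 0 1 : Matrix (Fin (d + 1)) (Fin (d + 1)) (LeavittRing (n + 1)))))
        Finset.univ.val).trans ?_
      simp [Fin.sum_univ_three, Multiset.nsmul_singleton, -Fin.univ_val_map]
    · refine (Multiset.map_map Prod.fst (fun j : Fin n => ((0 : Fin 3),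
        (Matrix.single 0 0 (y j.succ) : Matrix (Fin (d + 1)) (Fin (d + 1)) (LeavittRing (n + 1)))))
        Finset.univ.val).trans ?_
      simp [Fin.sum_univ_three, Multiset.nsmul_singleton, -Fin.univ_val_map]
  · intro v
    fin_cases v
    · exact ⟨_, _, _, _, hfam0, rfl⟩
    · exact ⟨_, _, _, _, hfam1, rfl⟩
    · exact ⟨_, _, _, _, hfam2, rfl⟩
  · exact single_mem_matrixPosCone _ _ (y_mem_posCone _)
  · exact single_mem_matrixPosCone _ _ hRpos
  · exact fun j => single_mem_matrixPosCone _ _ one_mem_posCone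
  · exact fun j => single_mem_matrixPosCone _ _ (y_mem_posCone _)
  · intro B hB a ha
    obtain ⟨⟨hy0, hRB⟩, h1, h2⟩ := (hD fun v p => p.2 ∈ B.hom v p.1).1 hB
    have h1' : ∀ j, Matrix.single 0 j 1 ∈ B.hom 0 1 := fun j => by
      simpa [Matrix.star_eq_conjTranspose] using B.star_mem (h1 j)
    have hy : ∀ j, Matrix.single 0 0 (y j) ∈ B.hom 0 0 := by
      intro j
      refine Fin.cases hy0 (fun j => ?_) j
      have := B.mul_mem hRB (h2 j)
      rwa [Matrix.single_mul_single_same, sum_succ_mul_y_succ] at this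
    have hpos : ∀ p ∈ posCone (n + 1), Matrix.single 0 0 p ∈ B.hom 0 0 := by
      intro p hp
      induction hp using AddSubmonoid.closure_induction with
      | mem p hp =>
        replace hp : p ∈ monomials (n + 1) := hp
        induction hp using Submonoid.closure_induction with
        | mem p hp =>
          rcases hp with ⟨i, rfl⟩ | ⟨i, rfl⟩
          · simpa [Matrix.star_eq_conjTranspose] using B.star_mem (hy i)
          · exact hy i
        | one => simpa using B.mul_mem (h1' 0) (h1 0)
        | mul a b _ _ ha hb => simpa using B.mul_mem ha hb
      | zero => simp
      | add a b _ _ ha hb => rw [Matrix.single_add]; exact add_mem ha hb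
    rw [Matrix.matrix_eq_sum_single a]
    refine AddSubmonoid.sum_mem _ fun i _ => AddSubmonoid.sum_mem _ fun j _ => ?_
    simpa using B.mul_mem (B.mul_mem (h1 i) (hpos _ (ha i j))) (h1' j)

theorem exists_mul_eq_one_add {d n : ℕ} (hd : 1 ≤ d) (hn : 1 ≤ n) (h : Nat.Coprime d n) :
    ∃ e k, d * e = 1 + k * n := by
  rcases hn.eq_or_lt with rfl | hn
  · exact ⟨1, d - 1, by omega⟩
  · obtain ⟨e, -, he⟩ := Nat.exists_mul_mod_eq_one_of_coprime h hn
    refine ⟨e, d * e / n, ?_⟩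
    rw [mul_comm (d * e / n), ← he, add_comm, Nat.div_add_mod]

/-- If `d` is coprime to `r - 1`, then `L_r` and `M_d(L_r)` are isomorphic as partially ordered
rings with involution. -/
theorem exists_equiv_matrix (hr : 2 ≤ r) (hd : 1 ≤ d) (h : Nat.Coprime d (r - 1)) :
    ∃ f : LeavittRing r ≃+* Matrix (Fin d) (Fin d) (LeavittRing r),
      (∀ a, f (star a) = star (f a)) ∧ ∀ a, f a ∈ matrixPosCone d r ↔ a ∈ posCone r := by
  obtain ⟨n, rfl⟩ : ∃ n, r = n + 1 := ⟨r - 1, by omega⟩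
  obtain ⟨d, rfl⟩ : ∃ d', d = d' + 1 := ⟨d - 1, by omega⟩
  obtain ⟨e, k, hek⟩ := exists_mul_eq_one_add hd (by omega : 1 ≤ n) h
  have hmul : ∀ a ∈ matrixPosCone (d + 1) (n + 1), ∀ b ∈ matrixPosCone (d + 1) (n + 1),
      a * b ∈ matrixPosCone (d + 1) (n + 1) := fun a ha b hb i j => by
    rw [Matrix.mul_apply]
    exact AddSubmonoid.sum_mem _ fun k _ => mul_mem_posCone (ha i k) (hb k j)
  have hstar : ∀ a ∈ matrixPosCone (d + 1) (n + 1), star a ∈ matrixPosCone (d + 1) (n + 1) :=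
    fun a ha i j => star_mem_posCone (ha j i)
  have hend := presents_chain hmul hstar (by omega : 1 ≤ n) hek (presents_start d n)
  have hN : (![![0, e, 0], ![0, 1 + n, 0], ![0, n, 0]] : Fin 3 → Fin 3 → ℕ) =
      fun v => ![0, ![e, 1 + n, n] v, 0] := by
    funext v
    fin_cases v <;> rfl
  rw [hN] at hend
  refine hend.exists_leavittRing_equiv hr hmul hstar ?_ ?_ ?_ rfl (add_comm 1 n)
  · intro i j
    rw [Matrix.one_apply]
    split_ifs
    · exact one_mem_posCone
    · exact zero_mem _
  · intro a
    choose p hp q hq hpq using fun i j => exists_eq_sub (a i j)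
    exact ⟨Matrix.of p, hp, Matrix.of q, hq, by ext i j; exact hpq i j⟩
  · intro k hk
    have := congrFun (congrFun hk 0) 0
    rw [← zsmul_one, Matrix.smul_apply, Matrix.one_apply_eq, zsmul_one] at this
    exact intCast_eq_zero (by omega) this

end LeavittRing

/-! ### Additive maps acting on one tensor factor -/

namespace LeavittTensor

variable {r t : ℕ}

theorem sum_tprod_update {I : Type*} (s : Finset I) (p : Fin t → LeavittRing r) (l : Fin t)
    (a : I → LeavittRing r) :
    tprod (Function.update p l (∑ i ∈ s, a i)) = ∑ i ∈ s, tprod (Function.update p l (a i)) :=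
  (PiTensorProduct.tprod ℤ (s := fun _ : Fin t => LeavittRing r)).map_update_sum s l a p

/-- The additive map of the tensor power given by an additive map of the factor with index `l`. -/
def mapFactor (l : Fin t) (g : LeavittRing r →+ LeavittRing r) :
    LeavittTensor r t →+ LeavittTensor r t :=
  (PiTensorProduct.map (R := ℤ) (s := fun _ : Fin t => LeavittRing r)
    (Function.update (fun _ => LinearMap.id) l g.toIntLinearMap)).toAddMonoidHom

theorem mapFactor_tprod (l : Fin t) (g : LeavittRing r →+ LeavittRing r)
    (p : Fin t → LeavittRing r) :
    mapFactor l g (tprod p) = tprod (Function.update p l (g (p l))) := by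
  refine (PiTensorProduct.map_tprod _ _).trans ?_
  refine congrArg tprod (funext fun k => ?_)
  by_cases h : k = l
  · subst h; simp
  · simp [h]

/-- An identity between additive maps is checked on pure tensors. -/
theorem addHom_ext {G : Type*} [AddGroup G] {f g : LeavittTensor r t →+ G}
    (h : ∀ p, f (tprod p) = g (tprod p)) : f = g := by
  ext a
  induction a using induction with
  | hp p => exact h p
  | hn a ha => rw [map_neg, map_neg, ha]
  | ha a b ha hb => rw [map_add, map_add, ha, hb]

variable (l : Fin t)

theorem mapFactor_mapFactor (g h : LeavittRing r →+ LeavittRing r) (a : LeavittTensor r t) :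
    mapFactor l g (mapFactor l h a) = mapFactor l (g.comp h) a := by
  refine DFunLike.congr_fun (addHom_ext (f := (mapFactor l g).comp (mapFactor l h)) fun p => ?_) a
  simp [mapFactor_tprod]

theorem mapFactor_id (a : LeavittTensor r t) : mapFactor l (AddMonoidHom.id _) a = a := by
  refine DFunLike.congr_fun (addHom_ext (g := AddMonoidHom.id _) fun p => ?_) a
  simp [mapFactor_tprod]

theorem mapFactor_sum {I : Type*} (s : Finset I) (g : I → LeavittRing r →+ LeavittRing r)
    (a : LeavittTensor r t) : mapFactor l (∑ i ∈ s, g i) a = ∑ i ∈ s, mapFactor l (g i) a := by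
  rw [← AddMonoidHom.finsetSum_apply]
  refine DFunLike.congr_fun (addHom_ext fun p => ?_) a
  simp only [mapFactor_tprod, AddMonoidHom.finsetSum_apply, sum_tprod_update]

theorem mapFactor_zero (a : LeavittTensor r t) : mapFactor l 0 a = 0 := by
  simpa using mapFactor_sum l (∅ : Finset ℕ) (fun _ => 0) a

theorem star_mapFactor {g h : LeavittRing r →+ LeavittRing r} (hgh : ∀ a, star (g a) = h (star a))
    (a : LeavittTensor r t) : star (mapFactor l g a) = mapFactor l h (star a) := by
  refine DFunLike.congr_fun (addHom_ext (f := (starHom r t).comp (mapFactor l g))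
    (g := (mapFactor l h).comp (starHom r t)) fun p => ?_) a
  simp only [AddMonoidHom.comp_apply, mapFactor_tprod, starHom_tprod]
  congr 1
  funext k
  by_cases hk : k = l
  · subst hk; simp [hgh]
  · simp [hk]

theorem mapFactor_mul {I : Type*} (s : Finset I) {g : LeavittRing r →+ LeavittRing r}
    {h h' : I → LeavittRing r →+ LeavittRing r}
    (hg : ∀ a b, g (a * b) = ∑ i ∈ s, h i a * h' i b) (a b : LeavittTensor r t) :
    mapFactor l g (a * b) = ∑ i ∈ s, mapFactor l (h i) a * mapFactor l (h' i) b := by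
  induction a using induction with
  | hp p =>
    induction b using induction with
    | hp q =>
      simp only [tprod_mul, mapFactor_tprod, Pi.mul_apply, hg, sum_tprod_update]
      refine Finset.sum_congr rfl fun i _ => congrArg tprod (funext fun k => ?_)
      by_cases hk : k = l
      · subst hk; simp
      · simp [hk]
    | hn b hb => simp only [mul_neg, map_neg, hb, Finset.sum_neg_distrib]
    | ha b c hb hc => simp only [mul_add, map_add, hb, hc, Finset.sum_add_distrib]
  | hn a ha => simp only [neg_mul, map_neg, ha, Finset.sum_neg_distrib]
  | ha a c ha hc => simp only [add_mul, map_add, ha, hc, Finset.sum_add_distrib]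

theorem mapFactor_mem_posCone {g : LeavittRing r →+ LeavittRing r}
    (hg : ∀ a ∈ LeavittRing.posCone r, g a ∈ LeavittRing.posCone r) {a : LeavittTensor r t}
    (ha : a ∈ posCone r t) : mapFactor l g a ∈ posCone r t := by
  induction ha using AddSubmonoid.closure_induction with
  | mem a ha =>
    obtain ⟨p, hp, rfl⟩ := ha
    rw [mapFactor_tprod]
    refine AddSubmonoid.subset_closure ⟨_, fun k => ?_, rfl⟩
    by_cases hk : k = l
    · subst hk; simpa using hg _ (hp k)
    · simpa [hk] using hp k
  | zero => simp
  | add a b _ _ h1 h2 => rw [map_add]; exact add_mem h1 h2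

/-- If `d` is coprime to `r - 1`, then the tensor power is isomorphic to a ring of `d × d` matrices
over itself, as a partially ordered ring with involution. -/
theorem exists_equiv_matrix (hr : 2 ≤ r) {d : ℕ} (hd : 1 ≤ d) (h : Nat.Coprime d (r - 1))
    (ht : 1 ≤ t) :
    ∃ f : LeavittTensor r t ≃+* Matrix (Fin d) (Fin d) (LeavittTensor r t),
      (∀ a, f (star a) = star (f a)) ∧ ∀ a, (∀ i j, f a i j ∈ posCone r t) ↔ a ∈ posCone r t := by
  obtain ⟨φ, hφstar, hφpos⟩ := LeavittRing.exists_equiv_matrix hr hd h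
  let l : Fin t := ⟨0, ht⟩
  let c : Fin d → Fin d → LeavittRing r →+ LeavittRing r := fun i j =>
    { toFun := fun a => φ a i j
      map_zero' := by simp
      map_add' := by simp }
  let e : Fin d → Fin d → LeavittRing r →+ LeavittRing r := fun i j =>
    (φ.symm : _ →+ LeavittRing r).comp (Matrix.singleAddMonoidHom i j)
  have hec : ∑ i, ∑ j, (e i j).comp (c i j) = AddMonoidHom.id _ := by
    ext a
    simp only [AddMonoidHom.finsetSum_apply, AddMonoidHom.comp_apply, AddMonoidHom.id_apply]
    apply φ.injective
    rw [map_sum]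
    conv_rhs => rw [Matrix.matrix_eq_sum_single (φ a)]
    refine Finset.sum_congr rfl fun i _ => ?_
    rw [map_sum]
    refine Finset.sum_congr rfl fun j _ => ?_
    exact φ.apply_symm_apply _
  have hce : ∀ i j i' j', (c i j).comp (e i' j') =
      if i' = i ∧ j' = j then AddMonoidHom.id _ else 0 := by
    intro i j i' j'
    ext a
    have : c i j (e i' j' a) = Matrix.single i' j' a i j :=
      congrFun (congrFun (φ.apply_symm_apply _) i) j
    rw [AddMonoidHom.comp_apply, this, Matrix.single_apply]
    split_ifs <;> rfl
  have hcmul : ∀ i j a b, c i j (a * b) = ∑ k, c i k a * c k j b := by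
    intro i j a b
    change φ (a * b) i j = _
    rw [map_mul]
    rfl
  have hcstar : ∀ i j a, star (c i j a) = c j i (star a) := by
    intro i j a
    change star (φ a i j) = φ (star a) j i
    rw [hφstar]
    rfl
  have hcpos : ∀ i j, ∀ a ∈ LeavittRing.posCone r, c i j a ∈ LeavittRing.posCone r :=
    fun i j a ha => (hφpos a).2 ha i j
  have hepos : ∀ i j, ∀ a ∈ LeavittRing.posCone r, e i j a ∈ LeavittRing.posCone r := by
    intro i j a ha
    rw [← hφpos]
    change φ (φ.symm _) ∈ _
    rw [φ.apply_symm_apply]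
    exact LeavittRing.single_mem_matrixPosCone i j ha
  have hinv : ∀ a : LeavittTensor r t,
      ∑ i, ∑ j, mapFactor l (e i j) (mapFactor l (c i j) a) = a := by
    intro a
    simp only [mapFactor_mapFactor, ← mapFactor_sum, hec, mapFactor_id]
  let f : LeavittTensor r t ≃+* Matrix (Fin d) (Fin d) (LeavittTensor r t) :=
    { toFun := fun a => Matrix.of fun i j => mapFactor l (c i j) a
      invFun := fun A => ∑ i, ∑ j, mapFactor l (e i j) (A i j)
      left_inv := hinv
      right_inv := fun A => by
        ext i j
        simp only [Matrix.of_apply, map_sum, mapFactor_mapFactor, hce]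
        rw [Finset.sum_eq_single i, Finset.sum_eq_single j]
        · simp [mapFactor_id]
        · intro j' _ hj
          simp [hj, mapFactor_zero]
        · simp
        · intro i' _ hi
          simp [hi, mapFactor_zero]
        · simp
      map_mul' := fun a b => by
        ext i j
        rw [Matrix.mul_apply]
        exact mapFactor_mul l Finset.univ (hcmul i j) a b
      map_add' := fun a b => by
        ext i j
        exact map_add (mapFactor l (c i j)) a b }
  refine ⟨f, fun a => ?_, fun a => ⟨fun ha => ?_, fun ha i j => ?_⟩⟩
  · ext i j
    exact (star_mapFactor l (hcstar j i) a).symm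
  · rw [← hinv a]
    exact AddSubmonoid.sum_mem _ fun i _ => AddSubmonoid.sum_mem _ fun j _ =>
      mapFactor_mem_posCone l (hepos i j) (ha i j)
  · exact mapFactor_mem_posCone l (hcpos i j) ha

end LeavittTensor

/-! ### Isomorphisms of matrix rings -/

namespace LeavittMatrix

/-- Two matrix rings over the tensor power are isomorphic as partially ordered rings with
involution. -/
def OrderIsomorphic (r t m m' : ℕ) : Prop :=
  ∃ f : LeavittMatrix m r t ≃⋆+* LeavittMatrix m' r t, ∀ a b, f a ≤ f b ↔ a ≤ b

variable {r t m m' m'' : ℕ}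

theorem OrderIsomorphic.of_ringEquiv (f : LeavittMatrix m r t ≃+* LeavittMatrix m' r t)
    (hstar : ∀ a, f (star a) = star (f a))
    (hpos : ∀ a, (∀ i j, f a i j ∈ LeavittTensor.posCone r t) ↔
      ∀ i j, a i j ∈ LeavittTensor.posCone r t) : OrderIsomorphic r t m m' := by
  refine ⟨{ f with map_star' := hstar }, fun a b => ?_⟩
  change f a ≤ f b ↔ a ≤ b
  rw [le_def, le_def, ← map_sub, mem_posCone_iff, mem_posCone_iff, hpos]

theorem OrderIsomorphic.symm (h : OrderIsomorphic r t m m') : OrderIsomorphic r t m' m := by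
  obtain ⟨f, hf⟩ := h
  refine ⟨f.symm, fun a b => ?_⟩
  rw [← hf, f.apply_symm_apply, f.apply_symm_apply]

theorem OrderIsomorphic.trans (h : OrderIsomorphic r t m m') (h' : OrderIsomorphic r t m' m'') :
    OrderIsomorphic r t m m'' := by
  obtain ⟨f, hf⟩ := h
  obtain ⟨g, hg⟩ := h'
  exact ⟨f.trans g, fun a b => (hg _ _).trans (hf a b)⟩

theorem OrderIsomorphic.refl (r t m : ℕ) : OrderIsomorphic r t m m :=
  ⟨StarRingEquiv.refl, fun _ _ => Iff.rfl⟩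

/-- Cutting each entry of a matrix into `d × d` blocks. -/
theorem orderIsomorphic_mul (hr : 2 ≤ r) (ht : 1 ≤ t) (m : ℕ) {d : ℕ} (hd : 1 ≤ d)
    (h : Nat.Coprime d (r - 1)) : OrderIsomorphic r t m (m * d) := by
  obtain ⟨f, hfstar, hfpos⟩ := LeavittTensor.exists_equiv_matrix hr hd h ht
  let F : Matrix (Fin m) (Fin m) (LeavittTensor r t) ≃+*
      Matrix (Fin (m * d)) (Fin (m * d)) (LeavittTensor r t) :=
    (f.mapMatrix.trans (Matrix.compRingEquiv (Fin m) (Fin d) (LeavittTensor r t))).trans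
      (Matrix.reindexRingEquiv (LeavittTensor r t) finProdFinEquiv)
  have hF : ∀ a i j, F a i j = f (a (finProdFinEquiv.symm i).1 (finProdFinEquiv.symm j).1)
      (finProdFinEquiv.symm i).2 (finProdFinEquiv.symm j).2 := fun _ _ _ => rfl
  refine OrderIsomorphic.of_ringEquiv F (fun a => ?_) fun a => ?_
  · refine Matrix.ext fun i j => ?_
    refine (hF _ _ _).trans ?_
    exact congrFun (congrFun (hfstar _) _) _
  · refine (forall_congr' fun i => forall_congr' fun j => iff_of_eq
      (congrArg (· ∈ LeavittTensor.posCone r t) (hF a i j))).trans ?_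
    constructor
    · intro ha i j
      rw [← hfpos]
      intro k l
      simpa using ha (finProdFinEquiv (i, k)) (finProdFinEquiv (j, l))
    · intro ha i j
      exact (hfpos _).2 (ha _ _) _ _

/-- Conjugation by a positive unitary rectangular matrix. -/
theorem OrderIsomorphic.of_unitary {I J : Type} [Fintype I] [Fintype J] [DecidableEq I]
    [DecidableEq J] (eI : I ≃ Fin m) (eJ : J ≃ Fin m') (U : Matrix I J (LeavittTensor r t))
    (hU : U * U.conjTranspose = 1) (hU' : U.conjTranspose * U = 1)
    (hpos : ∀ i j, U i j ∈ LeavittTensor.posCone r t) : OrderIsomorphic r t m m' := by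
  have hconj : ∀ {I J : Type} [Fintype I] [Fintype J] (V : Matrix I J (LeavittTensor r t))
      (a : Matrix I I (LeavittTensor r t)), (∀ i j, V i j ∈ LeavittTensor.posCone r t) →
      (∀ i j, a i j ∈ LeavittTensor.posCone r t) →
      ∀ i j, (V.conjTranspose * a * V) i j ∈ LeavittTensor.posCone r t := by
    intro I J _ _ V a hV ha i j
    rw [Matrix.mul_apply]
    refine AddSubmonoid.sum_mem _ fun k _ => LeavittTensor.mul_mem_posCone ?_ (hV _ _)
    rw [Matrix.mul_apply]
    exact AddSubmonoid.sum_mem _ fun l _ => LeavittTensor.mul_mem_posCone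
      (LeavittTensor.star_mem_posCone (hV _ _)) (ha _ _)
  let g : Matrix I I (LeavittTensor r t) ≃+* Matrix J J (LeavittTensor r t) :=
    { toFun := fun a => U.conjTranspose * a * U
      invFun := fun b => U * b * U.conjTranspose
      left_inv := fun a => by
        have : U * (U.conjTranspose * a * U) * U.conjTranspose =
            (U * U.conjTranspose) * a * (U * U.conjTranspose) := by simp only [Matrix.mul_assoc]
        exact this.trans (by rw [hU, Matrix.one_mul, Matrix.mul_one])
      right_inv := fun a => by
        have : U.conjTranspose * (U * a * U.conjTranspose) * U =
            (U.conjTranspose * U) * a * (U.conjTranspose * U) := by simp only [Matrix.mul_assoc]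
        exact this.trans (by rw [hU', Matrix.one_mul, Matrix.mul_one])
      map_mul' := fun a b => by
        have : U.conjTranspose * a * U * (U.conjTranspose * b * U) =
            U.conjTranspose * a * (U * U.conjTranspose) * b * U := by simp only [Matrix.mul_assoc]
        rw [this, hU, Matrix.mul_one, Matrix.mul_assoc U.conjTranspose a b]
      map_add' := fun a b => by rw [Matrix.mul_add, Matrix.add_mul] }
  have hgsymm : ∀ b, g.symm b = U * b * U.conjTranspose := fun _ => rfl
  have hgpos : ∀ a, (∀ i j, g a i j ∈ LeavittTensor.posCone r t) ↔
      ∀ i j, a i j ∈ LeavittTensor.posCone r t := by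
    intro a
    refine ⟨fun ha => ?_, hconj U a hpos⟩
    have := hconj U.conjTranspose (g a) (fun i j => LeavittTensor.star_mem_posCone (hpos j i)) ha
    rwa [Matrix.conjTranspose_conjTranspose, ← hgsymm, g.symm_apply_apply] at this
  let F : Matrix (Fin m) (Fin m) (LeavittTensor r t) ≃+*
      Matrix (Fin m') (Fin m') (LeavittTensor r t) :=
    ((Matrix.reindexRingEquiv (LeavittTensor r t) eI).symm.trans g).trans
      (Matrix.reindexRingEquiv (LeavittTensor r t) eJ)
  have hF : ∀ a i j, F a i j = g (a.submatrix eI eI) (eJ.symm i) (eJ.symm j) := fun _ _ _ => rfl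
  refine OrderIsomorphic.of_ringEquiv F (fun a => ?_) fun a => ?_
  · refine Matrix.ext fun i j => ?_
    refine (hF _ _ _).trans ?_
    have : g (star (a.submatrix eI eI)) = star (g (a.submatrix eI eI)) := by
      change U.conjTranspose * (Matrix.submatrix a eI eI).conjTranspose * U =
        (U.conjTranspose * (Matrix.submatrix a eI eI) * U).conjTranspose
      simp [Matrix.mul_assoc]
    exact congrFun (congrFun this _) _
  · refine (forall_congr' fun i => forall_congr' fun j => iff_of_eq
      (congrArg (· ∈ LeavittTensor.posCone r t) (hF a i j))).trans ?_
    refine Iff.trans ?_ ((hgpos (a.submatrix eI eI)).trans ?_)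
    · exact ⟨fun h i j => by simpa using h (eJ i) (eJ j), fun h i j => h _ _⟩
    · exact ⟨fun h i j => by
        have := h (eI.symm i) (eI.symm j)
        change a (eI (eI.symm i)) (eI (eI.symm j)) ∈ _ at this
        rwa [eI.apply_symm_apply, eI.apply_symm_apply] at this, fun h i j => h _ _⟩

end LeavittMatrix

namespace LeavittTensor

variable {r t : ℕ}

/-- The generator `y i` of the factor with index `l`. -/
def yAt (l : Fin t) (i : Fin r) : LeavittTensor r t :=
  tprod (Function.update 1 l (LeavittRing.y i))

theorem star_yAt (l : Fin t) (i : Fin r) :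
    star (yAt l i) = tprod (Function.update 1 l (LeavittRing.x i)) := by
  rw [yAt, star_tprod]
  congr 1
  funext k
  by_cases hk : k = l
  · subst hk; simp
  · simp [hk]

theorem yAt_mem_posCone (l : Fin t) (i : Fin r) : yAt l i ∈ posCone r t := by
  refine AddSubmonoid.subset_closure ⟨_, fun k => ?_, rfl⟩
  by_cases hk : k = l
  · subst hk; simpa using LeavittRing.y_mem_posCone i
  · simpa [hk] using LeavittRing.one_mem_posCone

theorem tprod_update_mul (l : Fin t) (a b : LeavittRing r) :
    tprod (Function.update (1 : Fin t → LeavittRing r) l a) * tprod (Function.update 1 l b) =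
      tprod (Function.update 1 l (a * b)) := by
  rw [tprod_mul]
  congr 1
  funext k
  by_cases hk : k = l
  · subst hk; simp
  · simp [hk]

theorem star_yAt_mul_yAt (l : Fin t) (i j : Fin r) :
    star (yAt l i) * yAt l j = if i = j then 1 else 0 := by
  rw [star_yAt, yAt, tprod_update_mul, LeavittRing.x_mul_y]
  split_ifs
  · rw [← tprod_one]
    congr 1
    exact Function.update_eq_self l 1
  · exact (PiTensorProduct.tprod ℤ).map_update_zero _ _

theorem sum_yAt_mul_star (l : Fin t) : ∑ i : Fin r, yAt l i * star (yAt l i) = 1 := by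
  simp only [star_yAt]
  simp only [yAt, tprod_update_mul]
  rw [← sum_tprod_update, LeavittRing.sum_y_mul_x, ← tprod_one]
  congr 1
  exact Function.update_eq_self l 1

end LeavittTensor

namespace LeavittMatrix

variable {r t : ℕ}

/-- The row `(y_1, …, y_r)` is unitary, so that one free generator may be replaced by `r`. -/
theorem orderIsomorphic_add (ht : 1 ≤ t) (m : ℕ) : OrderIsomorphic r t (m + 1) (m + r) := by
  let l : Fin t := ⟨0, ht⟩
  let Y : Matrix (Fin 1) (Fin r) (LeavittTensor r t) :=
    Matrix.of fun _ j => LeavittTensor.yAt l j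
  have hY : Y * Y.conjTranspose = 1 := by
    ext i j
    rw [Matrix.mul_apply, Subsingleton.elim i j, Matrix.one_apply_eq,
      ← LeavittTensor.sum_yAt_mul_star l]
    rfl
  have hY' : Y.conjTranspose * Y = 1 := by
    ext i j
    rw [Matrix.mul_apply, Matrix.one_apply, ← LeavittTensor.star_yAt_mul_yAt l]
    simp [Y]
  refine OrderIsomorphic.of_unitary (I := Fin m ⊕ Fin 1) (J := Fin m ⊕ Fin r) finSumFinEquiv
    finSumFinEquiv (Matrix.fromBlocks 1 0 0 Y) ?_ ?_ ?_
  · rw [Matrix.fromBlocks_conjTranspose, Matrix.fromBlocks_multiply]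
    simp [hY]
  · rw [Matrix.fromBlocks_conjTranspose, Matrix.fromBlocks_multiply]
    simp [hY']
  · rintro (i | i) (j | j)
    · rw [Matrix.fromBlocks_apply₁₁, Matrix.one_apply]
      split_ifs
      · exact LeavittTensor.one_mem_posCone
      · exact zero_mem _
    · exact zero_mem _
    · exact zero_mem _
    · exact LeavittTensor.yAt_mem_posCone l j

theorem orderIsomorphic_of_modEq (hr : 1 ≤ r) (ht : 1 ≤ t) {m m' : ℕ} (hm : 1 ≤ m)
    (hm' : 1 ≤ m') (h : m ≡ m' [MOD r - 1]) : OrderIsomorphic r t m m' := by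
  have key : ∀ k m, 1 ≤ m → OrderIsomorphic r t m (m + k * (r - 1)) := by
    intro k m hm
    induction k with
    | zero => simpa using OrderIsomorphic.refl r t m
    | succ k ih =>
      obtain ⟨a, ha⟩ : ∃ a, m + k * (r - 1) = a + 1 := ⟨m + k * (r - 1) - 1, by omega⟩
      have := orderIsomorphic_add (r := r) ht a
      rw [← ha, show a + r = m + (k + 1) * (r - 1) by rw [Nat.succ_mul]; omega] at this
      exact ih.trans this
  rcases le_total m m' with hle | hle
  · obtain ⟨k, hk⟩ := (Nat.modEq_iff_dvd' hle).1 h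
    have := key k m hm
    rwa [mul_comm, ← hk, Nat.add_sub_cancel' hle] at this
  · obtain ⟨k, hk⟩ := (Nat.modEq_iff_dvd' hle).1 h.symm
    have := key k m' hm'
    rw [mul_comm, ← hk, Nat.add_sub_cancel' hle] at this
    exact this.symm

/-- Numbers with the same greatest common divisor with `n` differ by a unit modulo `n`. -/
theorem exists_coprime_mul_modEq {n m m' : ℕ} (hn : 1 ≤ n) (h : m'.gcd n = m.gcd n) :
    ∃ d, 1 ≤ d ∧ d.Coprime n ∧ m' * d ≡ m [MOD n] := by
  have : NeZero n := ⟨by omega⟩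
  have key : ∀ a : ℕ, ∃ u : (ZMod n)ˣ, (a : ZMod n) = u * (a.gcd n : ℕ) := by
    intro a
    obtain ⟨d, hd, u, hu, hau⟩ := ZMod.eq_unit_mul_divisor (a : ZMod n)
    obtain ⟨u, rfl⟩ := hu
    refine ⟨u, ?_⟩
    have hv : (a : ZMod n) = ((u : ZMod n).val * d : ℕ) := by
      rw [hau]; simp
    have hgcd : a.gcd n = d := by
      rw [((ZMod.natCast_eq_natCast_iff _ _ _).1 hv).gcd_eq,
        Nat.Coprime.gcd_mul_left_cancel d (ZMod.val_coe_unit_coprime u), Nat.gcd_eq_left hd]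
    rw [hgcd, hau]
  obtain ⟨u, hu⟩ := key m
  obtain ⟨u', hu'⟩ := key m'
  refine ⟨((u'⁻¹ * u : (ZMod n)ˣ) : ZMod n).val + n, by omega, ?_, ?_⟩
  · rw [Nat.coprime_add_self_left]
    exact ZMod.val_coe_unit_coprime _
  · rw [← ZMod.natCast_eq_natCast_iff]
    push_cast
    rw [ZMod.natCast_zmod_val, hu', hu, h]
    simp only [CharP.cast_eq_zero, add_zero]
    rw [mul_comm (u' : ZMod n), mul_assoc, ← mul_assoc (u' : ZMod n), Units.mul_inv, one_mul,
      mul_comm]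

theorem orderIsomorphic_of_gcd_eq (hr : 2 ≤ r) (ht : 1 ≤ t) {m m' : ℕ} (hm : 1 ≤ m)
    (hm' : 1 ≤ m') (h : m'.gcd (r - 1) = m.gcd (r - 1)) : OrderIsomorphic r t m' m := by
  obtain ⟨d, hd, hcop, hmod⟩ := exists_coprime_mul_modEq (by omega : 1 ≤ r - 1) h
  exact (orderIsomorphic_mul hr ht m' hd hcop).trans
    (orderIsomorphic_of_modEq (by omega) ht (Nat.mul_pos hm' hd) hm hmod)

theorem OrderIsomorphic.nonempty_PU_mulEquiv {m m' : ℕ} (h : OrderIsomorphic r t m m') :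
    Nonempty (PU m r t ≃* PU m' r t) := by
  obtain ⟨f, hf⟩ := h
  have hpos : ∀ a, 0 ≤ f a ↔ 0 ≤ a := fun a => by rw [← hf 0 a, map_zero]
  let g : LeavittMatrix m r t ≃⋆* LeavittMatrix m' r t := { f with }
  let G := Unitary.mapEquiv g
  have hG : ∀ u, G u ∈ PU m' r t ↔ u ∈ PU m r t := fun u => hpos u
  have hG' : ∀ u, G.symm u ∈ PU m r t ↔ u ∈ PU m' r t := fun u => by rw [← hG, G.apply_symm_apply]
  exact ⟨{ toFun := fun u => ⟨G u, (hG _).2 u.2⟩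
           invFun := fun u => ⟨G.symm u, (hG' _).2 u.2⟩
           left_inv := fun u => Subtype.ext (G.symm_apply_apply _)
           right_inv := fun u => Subtype.ext (G.apply_symm_apply _)
           map_mul' := fun u v => Subtype.ext (map_mul G _ _) }⟩

end LeavittMatrix

/-! ### Words as elements of the tensor power -/

namespace LeavittRing

variable {r : ℕ}

theorem star_prod_y (u : List (Fin r)) : star (u.map y).prod = (u.reverse.map x).prod := by
  induction u with
  | nil => simp
  | cons i u ih => simp [ih]

theorem star_prod_y_mul_self (u : List (Fin r)) :
    star (u.map y).prod * (u.map y).prod = (1 : LeavittRing r) := by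
  rw [star_prod_y, prod_x_mul_prod_y]

/-- `x_u y_v` vanishes unless one of the words `u` and `v` is a prefix of the other. -/
theorem exists_append_eq_of_star_mul_ne_zero {u v : List (Fin r)}
    (h : star (u.map y).prod * (v.map y).prod ≠ (0 : LeavittRing r)) :
    ∃ u' v', u ++ u' = v ++ v' := by
  induction u generalizing v with
  | nil => exact ⟨v, [], by simp⟩
  | cons i u ih =>
    cases v with
    | nil => exact ⟨[], i :: u, by simp⟩
    | cons j v =>
      rw [List.map_cons, List.map_cons, List.prod_cons, List.prod_cons, star_mul, star_y, mul_assoc,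
        ← mul_assoc (x i), x_mul_y] at h
      by_cases hij : i = j
      · subst hij
        rw [if_pos rfl, one_mul] at h
        obtain ⟨u', v', h'⟩ := ih h
        exact ⟨u', v', by simp [h']⟩
      · simp [hij] at h

end LeavittRing

namespace BrinHigmanThompson

variable {m r t : ℕ}

/-- The product of the letters of a word, as an element of the tensor power. -/
def yWord (u : MultiWord r t) : LeavittTensor r t :=
  LeavittTensor.tprod fun l => ((u l).map LeavittRing.y).prod

theorem yWord_append (u v : MultiWord r t) : yWord (fun l => u l ++ v l) = yWord u * yWord v := by
  rw [yWord, yWord, yWord, LeavittTensor.tprod_mul]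
  congr 1
  funext l
  simp

theorem yWord_nil : yWord (fun _ => [] : MultiWord r t) = 1 := by
  rw [yWord, ← LeavittTensor.tprod_one]
  rfl

theorem yWord_letter (l : Fin t) (k : Fin r) : yWord (letter l k) = LeavittTensor.yAt l k := by
  rw [yWord, LeavittTensor.yAt]
  congr 1
  funext i
  by_cases h : i = l
  · subst h; simp [letter]
  · simp [letter, h]

theorem star_yWord_mul (u v : MultiWord r t) : star (yWord u) * yWord v =
    LeavittTensor.tprod fun l =>
      star ((u l).map LeavittRing.y).prod * ((v l).map LeavittRing.y).prod := by
  rw [yWord, yWord, LeavittTensor.star_tprod, LeavittTensor.tprod_mul]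
  rfl

theorem star_yWord_mul_self (u : MultiWord r t) : star (yWord u) * yWord u = 1 := by
  rw [star_yWord_mul, ← LeavittTensor.tprod_one]
  congr 1
  funext l
  exact LeavittRing.star_prod_y_mul_self _

theorem exists_append_eq_of_star_yWord_mul_ne_zero {u v : MultiWord r t}
    (h : star (yWord u) * yWord v ≠ 0) :
    ∃ u' v' : MultiWord r t, (fun l => u l ++ u' l) = fun l => v l ++ v' l := by
  have h' : ∀ l, ∃ u' v', u l ++ u' = v l ++ v' := by
    intro l
    apply LeavittRing.exists_append_eq_of_star_mul_ne_zero
    intro h0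
    rw [star_yWord_mul] at h
    exact h ((PiTensorProduct.tprod ℤ (s := fun _ : Fin t => LeavittRing r)).map_coord_zero l h0)
  choose u' v' h' using h'
  exact ⟨u', v', funext h'⟩

theorem yWord_mem_posCone (u : MultiWord r t) : yWord u ∈ LeavittTensor.posCone r t :=
  AddSubmonoid.subset_closure ⟨_, fun _ => LeavittRing.prod_y_mem _, rfl⟩

theorem tensor_one_ne_zero (hr : 1 ≤ r) : (1 : LeavittTensor r t) ≠ 0 := by
  intro h
  have := congrArg (LeavittTensor.state fun _ _ => (⟨0, hr⟩ : Fin r)) h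
  rw [← LeavittTensor.tprod_one, LeavittTensor.state_tprod, map_zero] at this
  simp [LeavittRing.state_one] at this

theorem yWord_injective (hr : 2 ≤ r) :
    Function.Injective (yWord : MultiWord r t → LeavittTensor r t) := by
  have : Nontrivial (Fin r) := Fin.nontrivial_iff_two_le.2 hr
  -- a letter that does not continue the longer of two words distinguishes them
  have key : ∀ (u v : MultiWord r t) (l : Fin t) (k : Fin r) (w : List (Fin r)),
      v l = u l ++ k :: w → yWord u ≠ yWord v := by
    intro u v l k w hv h
    obtain ⟨k', hk'⟩ := exists_ne k
    have h1 : star (yWord (fun i => u i ++ letter l k' i)) * yWord v ≠ 0 := by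
      rw [← h]
      intro h0
      have h2 := star_yWord_mul_self (fun i => u i ++ letter l k' i)
      rw [yWord_append u, ← mul_assoc, ← yWord_append, h0, zero_mul] at h2
      exact tensor_one_ne_zero (by omega) h2.symm
    obtain ⟨u', v', h3⟩ := exists_append_eq_of_star_yWord_mul_ne_zero h1
    have h4 := congrFun h3 l
    simp only [hv, letter, Function.update_self, List.append_assoc, List.append_cancel_left_eq,
      List.cons_append, List.nil_append, List.cons.injEq] at h4
    exact hk' h4.1
  intro u v h
  have h1 : star (yWord u) * yWord v ≠ 0 := by
    rw [h, star_yWord_mul_self]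
    exact tensor_one_ne_zero (by omega)
  obtain ⟨u', v', h2⟩ := exists_append_eq_of_star_yWord_mul_ne_zero h1
  funext l
  rcases List.append_eq_append_iff.1 (congrFun h2 l) with ⟨w, hw, -⟩ | ⟨w, hw, -⟩
  · cases w with
    | nil => simpa using hw.symm
    | cons k w => exact absurd h (key u v l k w hw)
  · cases w with
    | nil => simpa using hw
    | cons k w => exact absurd h.symm (key v u l k w hw)

/-! ### Matrix units for pairs of words -/

/-- The elementary partial isometry `y_a x_b` of the matrix ring, for words `a` and `b`. -/
def unit (a b : Word m r t) : LeavittMatrix m r t :=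
  Matrix.single a.1 b.1 (yWord a.2 * star (yWord b.2))

theorem unit_mul_unit (a b c : Word m r t) : unit a b * unit b c = unit a c := by
  refine (Matrix.single_mul_single_same _ _ _ _ _).trans ?_
  rw [mul_assoc, ← mul_assoc (star _), star_yWord_mul_self, one_mul]
  rfl

theorem unit_app_mul (a b c : Word m r t) (u : MultiWord r t) :
    unit a (app b u) * unit b c = unit a (app c u) := by
  refine (Matrix.single_mul_single_same _ _ _ _ _).trans ?_
  simp only [app, yWord_append, star_mul]
  rw [mul_assoc, mul_assoc (star (yWord u)), ← mul_assoc (star (yWord b.2)), star_yWord_mul_self,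
    one_mul]
  simp [unit, yWord_append]

theorem star_unit (a b : Word m r t) : star (unit a b) = unit b a := by
  refine (Matrix.conjTranspose_single _ _ _).trans ?_
  simp [unit]

theorem exists_app_eq_of_unit_mul_ne_zero {a b c d : Word m r t} (h : unit a b * unit c d ≠ 0) :
    ∃ u v, app b u = app c v := by
  by_cases hbc : b.1 = c.1
  · have h' : star (yWord b.2) * yWord c.2 ≠ 0 := by
      intro h0
      apply h
      obtain ⟨i, b⟩ := b
      obtain ⟨j, c⟩ := c
      obtain rfl : i = j := hbc
      refine (Matrix.single_mul_single_same _ _ _ _ _).trans ?_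
      rw [mul_assoc, ← mul_assoc (star _), h0, zero_mul, mul_zero]
      exact Matrix.single_zero _ _
    obtain ⟨u, v, huv⟩ := exists_append_eq_of_star_yWord_mul_ne_zero h'
    exact ⟨u, v, Prod.ext hbc huv⟩
  · exact absurd (Matrix.single_mul_single_of_ne _ _ _ _ hbc _) h

theorem unit_mem_posCone (a b : Word m r t) : unit a b ∈ LeavittMatrix.posCone m r t :=
  AddSubmonoid.subset_closure ⟨_, _, _, LeavittTensor.mul_mem_posCone (yWord_mem_posCone _)
    (LeavittTensor.star_mem_posCone (yWord_mem_posCone _)), rfl⟩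

theorem sum_unit_app_letter (a b : Word m r t) (l : Fin t) :
    ∑ k, unit (app a (letter l k)) (app b (letter l k)) = unit a b := by
  have h : ∀ k, unit (app a (letter l k)) (app b (letter l k)) =
      Matrix.singleAddMonoidHom a.1 b.1 (yWord a.2 *
        (LeavittTensor.yAt l k * star (LeavittTensor.yAt l k)) * star (yWord b.2)) := by
    intro k
    simp only [unit, app, yWord_append, yWord_letter, star_mul, mul_assoc]
    rfl
  simp only [h]
  refine (map_sum (Matrix.singleAddMonoidHom (α := LeavittTensor r t) a.1 b.1) _
    Finset.univ).symm.trans ?_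
  rw [← Finset.sum_mul, ← Finset.mul_sum, LeavittTensor.sum_yAt_mul_star, mul_one]
  rfl

theorem unit_ne_zero (hr : 1 ≤ r) (a b : Word m r t) : unit a b ≠ 0 := by
  intro h
  have h1 : unit a a = 0 := by rw [← unit_mul_unit a b a, h, zero_mul]
  have h2 : yWord a.2 * star (yWord a.2) = 0 := by
    have := congrFun (congrFun h1 a.1) a.1
    rwa [unit, Matrix.single_apply_same] at this
  apply tensor_one_ne_zero (t := t) hr
  rw [← star_yWord_mul_self a.2, ← mul_one (star (yWord a.2) * yWord a.2),
    ← star_yWord_mul_self a.2, mul_assoc, ← mul_assoc (yWord a.2), h2, zero_mul, mul_zero]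

theorem unit_mul_ne_zero (hr : 1 ≤ r) {a b c d : Word m r t} {u v : MultiWord r t}
    (h : app b u = app c v) : unit a b * unit c d ≠ 0 := by
  intro h0
  have h1 : unit a (app a u) * (unit a b * unit c d) = unit a (app d v) := by
    rw [← mul_assoc, unit_app_mul, h, unit_app_mul]
  rw [h0, mul_zero] at h1
  exact unit_ne_zero hr _ _ h1.symm

theorem Indep.unit_mul_unit_of_ne {A : Finset (Word m r t)} (hA : Indep A) {b c : Word m r t}
    (hb : b ∈ A) (hc : c ∈ A) (hbc : b ≠ c) (a d : Word m r t) : unit a b * unit c d = 0 := by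
  by_contra h
  obtain ⟨u, v, huv⟩ := exists_app_eq_of_unit_mul_ne_zero h
  exact hbc (hA b hb c hc u v huv)

theorem unit_right_injective (hr : 2 ≤ r) {a b c : Word m r t} (h : unit a b = unit a c) :
    b = c := by
  have h1 : unit b b = unit b c := by rw [← unit_mul_unit b a b, h, unit_mul_unit]
  have h3 : b.1 = c.1 := by
    have hne : unit b b * unit c b ≠ 0 := by
      rw [h1, unit_mul_unit]
      exact unit_ne_zero (by omega) _ _
    obtain ⟨u, v, huv⟩ := exists_app_eq_of_unit_mul_ne_zero hne
    exact (Prod.ext_iff.1 huv).1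
  have h4 : yWord b.2 * star (yWord b.2) = yWord b.2 * star (yWord c.2) := by
    have := congrFun (congrFun h1 b.1) b.1
    rw [unit, unit, Matrix.single_apply_same, h3, Matrix.single_apply_same] at this
    exact this
  have h5 : star (yWord b.2) = star (yWord c.2) := by
    have := congrArg (star (yWord b.2) * ·) h4
    simpa only [← mul_assoc, star_yWord_mul_self, one_mul] using this
  exact Prod.ext h3 (yWord_injective hr (star_injective h5))

/-! ### From bijections between bases to unitary matrices -/

/-- The sum of `f` is unchanged when an element `p` is replaced by elements whose values add up
to `f p`. -/
theorem sum_erase_union_image {β G : Type*} [DecidableEq β] [AddCommMonoid G] {s : Finset β} {p : β}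
    (hp : p ∈ s) {c : Fin r → β} (hc : Function.Injective c) (hcs : ∀ k, c k ∈ s → c k = p)
    (f : β → G) (hf : ∑ k, f (c k) = f p) :
    ∑ b ∈ s.erase p ∪ Finset.univ.image c, f b = ∑ b ∈ s, f b := by
  rw [Finset.sum_union, Finset.sum_image fun _ _ _ _ h => hc h, hf, Finset.sum_erase_add _ _ hp]
  rw [Finset.disjoint_left]
  intro b hb hb'
  obtain ⟨k, _, rfl⟩ := Finset.mem_image.1 hb'
  exact (Finset.mem_erase.1 hb).1 (hcs k (Finset.mem_erase.1 hb).2)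

theorem sum_unit_expand {A : Finset (Word m r t)} (hA : Indep A) {a : Word m r t} (ha : a ∈ A)
    (l : Fin t) : ∑ b ∈ expand l a A, unit b b = ∑ b ∈ A, unit b b :=
  sum_erase_union_image ha (fun _ _ h => app_letter_inj h)
    (fun _ hk => hA.eq_of_app hk ha rfl) _ (sum_unit_app_letter a a l)

/-- A sum over a graph is unchanged by an expansion whose new terms add up to the removed one. -/
theorem sum_unit_expand₂ {G : Finset (Word m r t × Word m r t)}
    (hG : Set.InjOn Prod.fst (G : Set (Word m r t × Word m r t))) (hI : Indep (G.image Prod.fst))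
    {p : Word m r t × Word m r t} (hp : p ∈ G) (l : Fin t)
    (f : Word m r t × Word m r t → LeavittMatrix m r t)
    (hf : ∑ k, f (app₂ p (letter l k)) = f p) : ∑ q ∈ expand₂ l p G, f q = ∑ q ∈ G, f q :=
  sum_erase_union_image hp (fun _ _ h => app_letter_inj (congrArg Prod.fst h))
    (fun _ hk => hG hk hp (hI.eq_of_app (Finset.mem_image_of_mem _ hk)
      (Finset.mem_image_of_mem _ hp) rfl)) _ hf

theorem IsBasis.sum_unit {A : Finset (Word m r t)} (hA : IsBasis A) : ∑ a ∈ A, unit a a = 1 := by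
  induction hA with
  | initial =>
    rw [BrinHigmanThompson.initial, Finset.sum_image fun i _ j _ h => congrArg Prod.fst h]
    simp only [unit, yWord_nil, star_one, mul_one]
    exact Matrix.sum_single_one
  | expand l ha hA ih => rw [sum_unit_expand hA.indep ha, ih]

namespace BasisBij

/-- The matrix `∑ y_a x_{φ a}` of a bijection `φ` between bases. -/
def toMatrix (φ : BasisBij m r t) : LeavittMatrix m r t := ∑ p ∈ φ.graph, unit p.1 p.2

theorem toMatrix_eq_of_expansion {φ ψ : BasisBij m r t} (h : Expansion φ ψ) :
    φ.toMatrix = ψ.toMatrix := by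
  obtain ⟨l, p, hp, h⟩ := h
  rw [toMatrix, toMatrix, h]
  exact (sum_unit_expand₂ φ.injOn_fst φ.isBasis_dom.indep hp l _
    (sum_unit_app_letter p.1 p.2 l)).symm

theorem unit_mul_toMatrix (φ : BasisBij m r t) {p : Word m r t × Word m r t} (hp : p ∈ φ.graph)
    (c : Word m r t) : unit c p.1 * φ.toMatrix = unit c p.2 := by
  rw [toMatrix, Finset.mul_sum, Finset.sum_eq_single p]
  · exact unit_mul_unit _ _ _
  · intro q hq hqp
    exact φ.isBasis_dom.indep.unit_mul_unit_of_ne (Finset.mem_image_of_mem _ hp)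
      (Finset.mem_image_of_mem _ hq) (fun h => hqp (φ.injOn_fst hq hp h.symm)) _ _
  · exact fun h => absurd hp h

theorem toMatrix_comp (φ ψ : BasisBij m r t) (h : φ.cod = ψ.dom) :
    (comp φ ψ h).toMatrix = φ.toMatrix * ψ.toMatrix := by
  have key : ∀ p ∈ φ.graph, ∃ c, (p.2, c) ∈ ψ.graph := fun p hp =>
    mem_dom.1 (h ▸ Finset.mem_image_of_mem Prod.snd hp)
  rw [toMatrix, toMatrix, Finset.sum_mul]
  symm
  choose c hc using key
  refine Finset.sum_bij (fun p hp => (p.1, c p hp)) ?_ ?_ ?_ ?_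
  · intro p hp
    exact mem_comp.2 ⟨p.2, hp, hc p hp⟩
  · intro p hp q hq hpq
    exact φ.injOn_fst hp hq (Prod.ext_iff.1 hpq).1
  · rintro ⟨a, b⟩ hab
    obtain ⟨d, hd, hdb⟩ := mem_comp.1 hab
    refine ⟨(a, d), hd, Prod.ext rfl ?_⟩
    have hcb : (d, c (a, d) hd) = (d, b) := ψ.injOn_fst (hc _ hd) hdb rfl
    exact (Prod.ext_iff.1 hcb).2
  · intro p hp
    exact ψ.unit_mul_toMatrix (hc p hp) p.1

theorem toMatrix_inv (φ : BasisBij m r t) : φ.inv.toMatrix = star φ.toMatrix := by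
  rw [toMatrix, toMatrix, star_sum]
  refine (Finset.sum_image fun p _ q _ h => Prod.swap_injective h).trans ?_
  exact Finset.sum_congr rfl fun p _ => (star_unit _ _).symm

theorem toMatrix_refl (A : Finset (Word m r t)) (hA : IsBasis A) : (refl A hA).toMatrix = 1 := by
  rw [← hA.sum_unit]
  exact Finset.sum_image fun a _ b _ h => congrArg Prod.fst h

end BasisBij

end BrinHigmanThompson

namespace BrinHigmanThompsonGroup

open BrinHigmanThompson BrinHigmanThompson.BasisBij

variable {m r t : ℕ}

/-- The matrix of an element of the Brin-Higman-Thompson group. -/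
def toMatrix : BrinHigmanThompsonGroup t r m → LeavittMatrix m r t :=
  Quot.lift BasisBij.toMatrix fun _ _ h => toMatrix_eq_of_expansion h

theorem toMatrix_mul (g h : BrinHigmanThompsonGroup t r m) :
    toMatrix (g * h) = toMatrix g * toMatrix h := by
  obtain ⟨φ, ψ, hφψ, rfl, rfl⟩ := exists_rep g h
  rw [toGroup_mul_toGroup φ ψ hφψ]
  exact toMatrix_comp φ ψ hφψ

theorem toMatrix_one : toMatrix (1 : BrinHigmanThompsonGroup t r m) = 1 :=
  toMatrix_refl _ IsBasis.initial

theorem toMatrix_inv (g : BrinHigmanThompsonGroup t r m) : toMatrix g⁻¹ = star (toMatrix g) := by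
  obtain ⟨φ, rfl⟩ : ∃ φ : BasisBij m r t, φ.toGroup = g := Quot.exists_rep g
  exact φ.toMatrix_inv

theorem toMatrix_mem_unitary (g : BrinHigmanThompsonGroup t r m) :
    toMatrix g ∈ unitary (LeavittMatrix m r t) := by
  rw [Unitary.mem_iff, ← toMatrix_inv, ← toMatrix_mul, ← toMatrix_mul, inv_mul_cancel,
    mul_inv_cancel, toMatrix_one]
  exact ⟨rfl, rfl⟩

theorem toMatrix_nonneg (g : BrinHigmanThompsonGroup t r m) : 0 ≤ toMatrix g := by
  obtain ⟨φ, rfl⟩ : ∃ φ : BasisBij m r t, φ.toGroup = g := Quot.exists_rep g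
  exact LeavittMatrix.nonneg_iff.2 (AddSubmonoid.sum_mem _ fun p _ => unit_mem_posCone _ _)

theorem toMatrix_injective (hr : 2 ≤ r) :
    Function.Injective (toMatrix : BrinHigmanThompsonGroup t r m → LeavittMatrix m r t) := by
  have key : ∀ g : BrinHigmanThompsonGroup t r m, toMatrix g = 1 → g = 1 := by
    intro g hg
    obtain ⟨φ, rfl⟩ : ∃ φ : BasisBij m r t, φ.toGroup = g := Quot.exists_rep g
    have hφ : ∀ p ∈ φ.graph, p.1 = p.2 := by
      intro p hp
      have := φ.unit_mul_toMatrix hp p.1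
      rw [show φ.toMatrix = 1 from hg, mul_one] at this
      exact unit_right_injective hr this
    rw [one_eq φ.dom φ.basis_dom]
    refine congrArg toGroup (BasisBij.ext ?_)
    ext ⟨a, b⟩
    rw [mem_refl]
    constructor
    · intro h
      exact ⟨Finset.mem_image_of_mem Prod.fst h, hφ _ h⟩
    · rintro ⟨h, rfl⟩
      obtain ⟨⟨a, b⟩, hq, rfl⟩ := Finset.mem_image.1 h
      obtain rfl : a = b := hφ _ hq
      exact hq
  intro g h hgh
  rw [← inv_mul_eq_one]
  apply key
  rw [toMatrix_mul, toMatrix_inv, hgh]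
  exact (Unitary.mem_iff.1 (toMatrix_mem_unitary h)).1

end BrinHigmanThompsonGroup

/-! ### Positive matrices as sums of matrix units -/

namespace LeavittRing

variable {r : ℕ}

theorem posCone_le_closure : posCone r ≤ AddSubmonoid.closure
    {a | ∃ u v : List (Fin r), a = (u.map y).prod * star (v.map y).prod} := by
  refine AddSubmonoid.closure_le.2 fun a ha => ?_
  rcases monomial_normal_form ha with rfl | ⟨u, v, rfl⟩
  · exact zero_mem _
  · refine AddSubmonoid.subset_closure ⟨u, v.reverse, ?_⟩
    rw [star_prod_y, List.reverse_reverse]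

end LeavittRing

namespace BrinHigmanThompson

variable {m r t : ℕ}

theorem tensor_posCone_le_closure : LeavittTensor.posCone r t ≤ AddSubmonoid.closure
    {a | ∃ u v : MultiWord r t, a = yWord u * star (yWord v)} := by
  refine AddSubmonoid.closure_le.2 ?_
  rintro _ ⟨p, hp, rfl⟩
  -- the factors outside `s` are already of the form `y_u x_v`
  have key : ∀ (s : Finset (Fin t)) (p : Fin t → LeavittRing r),
      (∀ l ∈ s, p l ∈ LeavittRing.posCone r) →
      (∀ l ∉ s, ∃ u v : List (Fin r),
        p l = (u.map LeavittRing.y).prod * star (v.map LeavittRing.y).prod) →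
      LeavittTensor.tprod p ∈ AddSubmonoid.closure
        {a | ∃ u v : MultiWord r t, a = yWord u * star (yWord v)} := by
    intro s
    induction s using Finset.induction_on with
    | empty =>
      intro p _ h
      choose u v h using fun l => h l (Finset.notMem_empty l)
      refine AddSubmonoid.subset_closure ⟨u, v, ?_⟩
      rw [yWord, yWord, LeavittTensor.star_tprod, LeavittTensor.tprod_mul]
      exact congrArg _ (funext h)
    | insert l s hl ih =>
      intro p hp h
      have hpl := LeavittRing.posCone_le_closure (hp l (Finset.mem_insert_self l s))
      rw [← Function.update_eq_self l p]
      generalize p l = a at hpl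
      induction hpl using AddSubmonoid.closure_induction with
      | mem a ha =>
        refine ih _ (fun i hi => ?_) fun i hi => ?_
        · rw [Function.update_of_ne (ne_of_mem_of_not_mem hi hl)]
          exact hp i (Finset.mem_insert_of_mem hi)
        · by_cases hil : i = l
          · subst hil
            rwa [Function.update_self]
          · rw [Function.update_of_ne hil]
            exact h i (by simp [hil, hi])
      | zero =>
        convert zero_mem (AddSubmonoid.closure _)
        exact (PiTensorProduct.tprod ℤ (s := fun _ : Fin t => LeavittRing r)).map_update_zero p l
      | add a b _ _ ha hb =>
        convert add_mem ha hb
        exact (PiTensorProduct.tprod ℤ (s := fun _ : Fin t => LeavittRing r)).map_update_add p l a b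
  exact key Finset.univ p (fun l _ => hp l) fun l hl => absurd (Finset.mem_univ l) hl

theorem matrix_posCone_le_closure : LeavittMatrix.posCone m r t ≤ AddSubmonoid.closure
    {x | ∃ a b : Word m r t, x = unit a b} := by
  refine AddSubmonoid.closure_le.2 ?_
  rintro _ ⟨i, j, p, hp, rfl⟩
  replace hp := tensor_posCone_le_closure hp
  induction hp using AddSubmonoid.closure_induction with
  | mem p hp =>
    obtain ⟨u, v, rfl⟩ := hp
    exact AddSubmonoid.subset_closure ⟨(i, u), (j, v), rfl⟩
  | zero =>
    rw [Matrix.single_zero]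
    exact zero_mem (AddSubmonoid.closure _)
  | add p q _ _ hp hq =>
    rw [Matrix.single_add]
    exact add_mem (S := AddSubmonoid (LeavittMatrix m r t)) hp hq

theorem length_app_letter (a : Word m r t) (l i : Fin t) (k : Fin r) :
    ((app a (letter l k)).2 i).length = (a.2 i).length + if i = l then 1 else 0 := by
  by_cases h : i = l
  · subst h; simp [app, letter]
  · simp [app, letter, h]

/-- The sums of matrix units `y_a x_b` for which all the components of `b` have length `N`. -/
def levelCone (m r t N : ℕ) : AddSubmonoid (LeavittMatrix m r t) :=
  AddSubmonoid.closure {x | ∃ a b : Word m r t, (∀ l, (b.2 l).length = N) ∧ x = unit a b}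

/-- A matrix unit `y_a x_b` is the sum of the `y_a y_u x_u x_b` over all words `u` of given
lengths. -/
theorem unit_mem_levelCone {N : ℕ} (a : Word m r t) {b : Word m r t}
    (hb : ∀ l, (b.2 l).length ≤ N) : unit a b ∈ levelCone m r t N := by
  obtain ⟨k, hk⟩ : ∃ k, ∑ l, (N - (b.2 l).length) = k := ⟨_, rfl⟩
  induction k generalizing a b with
  | zero =>
    refine AddSubmonoid.subset_closure ⟨a, b, fun l => ?_, rfl⟩
    have := (Finset.sum_eq_zero_iff.1 hk) l (Finset.mem_univ l)
    have := hb l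
    omega
  | succ k ih =>
    obtain ⟨l, -, hl⟩ := Finset.exists_ne_zero_of_sum_ne_zero (hk.trans_ne k.succ_ne_zero)
    rw [← sum_unit_app_letter a b l]
    refine AddSubmonoid.sum_mem _ fun j _ => ih _ (fun i => ?_) ?_
    · rw [length_app_letter]
      have := hb i
      split_ifs with h
      · subst h; omega
      · omega
    · have h : ∑ i, (N - (b.2 i).length) =
          ∑ i, (N - ((app b (letter l j)).2 i).length) + ∑ i, if i = l then 1 else 0 := by
        rw [← Finset.sum_add_distrib]
        refine Finset.sum_congr rfl fun i _ => ?_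
        rw [length_app_letter]
        split_ifs with h
        · subst h; omega
        · omega
      simp only [Finset.sum_ite_eq', Finset.mem_univ, if_true] at h
      omega

theorem levelCone_mono {N M : ℕ} (h : N ≤ M) : levelCone m r t N ≤ levelCone m r t M := by
  refine AddSubmonoid.closure_le.2 ?_
  rintro _ ⟨a, b, hb, rfl⟩
  exact unit_mem_levelCone a fun l => (hb l).trans_le h

theorem exists_mem_levelCone {x : LeavittMatrix m r t} (hx : x ∈ LeavittMatrix.posCone m r t) :
    ∃ N, x ∈ levelCone m r t N := by
  replace hx := matrix_posCone_le_closure hx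
  induction hx using AddSubmonoid.closure_induction with
  | mem x hx =>
    obtain ⟨a, b, rfl⟩ := hx
    exact ⟨_, unit_mem_levelCone a fun l => Finset.le_sup (f := fun l => (b.2 l).length)
      (Finset.mem_univ l)⟩
  | zero => exact ⟨0, zero_mem _⟩
  | add x y _ _ hx hy =>
    obtain ⟨N, hN⟩ := hx
    obtain ⟨M, hM⟩ := hy
    exact ⟨max N M, add_mem (levelCone_mono (le_max_left N M) hN)
      (levelCone_mono (le_max_right N M) hM)⟩

/-- The words whose components have prescribed lengths form a basis. -/
theorem exists_basis_lengths (n : Fin t → ℕ) :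
    ∃ A : Finset (Word m r t), IsBasis A ∧ ∀ b, b ∈ A ↔ ∀ l, (b.2 l).length = n l := by
  obtain ⟨k, hk⟩ : ∃ k, ∑ l, n l = k := ⟨_, rfl⟩
  induction k generalizing n with
  | zero =>
    refine ⟨initial m r t, IsBasis.initial, fun b => ?_⟩
    have hn : ∀ l, n l = 0 := fun l => Finset.sum_eq_zero_iff.1 hk l (Finset.mem_univ l)
    simp only [hn, List.length_eq_zero_iff, initial, Finset.mem_image, Finset.mem_univ, true_and]
    constructor
    · rintro ⟨i, rfl⟩ l
      rfl
    · exact fun h => ⟨b.1, Prod.ext rfl (funext h).symm⟩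
  | succ k ih =>
    obtain ⟨l, -, hl⟩ := Finset.exists_ne_zero_of_sum_ne_zero (hk.trans_ne k.succ_ne_zero)
    obtain ⟨A, hA, hAn⟩ := ih (fun i => n i - if i = l then 1 else 0) (by
      have h : ∑ i, n i = ∑ i, (n i - if i = l then 1 else 0) + ∑ i, if i = l then 1 else 0 := by
        rw [← Finset.sum_add_distrib]
        refine Finset.sum_congr rfl fun i _ => ?_
        split_ifs with h
        · subst h; omega
        · omega
      simp only [Finset.sum_ite_eq', Finset.mem_univ, if_true] at h
      omega)
    refine ⟨full l A, hA.reach (hA.indep.reach_full l), fun b => ?_⟩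
    rw [mem_full]
    constructor
    · rintro ⟨a, ha, j, rfl⟩ i
      rw [length_app_letter, (hAn a).1 ha i]
      split_ifs with h
      · subst h; omega
      · omega
    · intro hb
      have hbl : b.2 l ≠ [] := by
        rw [← List.length_pos_iff, hb l]
        omega
      refine ⟨(b.1, Function.update b.2 l (b.2 l).dropLast), (hAn _).2 fun i => ?_,
        (b.2 l).getLast hbl, Prod.ext rfl (funext fun i => ?_)⟩
      · by_cases h : i = l
        · subst h; simp [hb]
        · simp [h, hb]
      · by_cases h : i = l
        · subst h; simp [app, letter, List.dropLast_append_getLast]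
        · simp [app, letter, h]

end BrinHigmanThompson

namespace BrinHigmanThompson

variable {m r t : ℕ}

/-! ### Positive unitary matrices come from bijections between bases -/

/-- Two terms `y_a x_b` and `y_c x_b` in a positive isometry `x` would contribute `2 y_b x_b` to
`x* x = 1`. -/
theorem nodup_snd_of_star_mul_self (hr : 1 ≤ r) {s : Multiset (Word m r t × Word m r t)}
    {x : LeavittMatrix m r t} (hx : x = (s.map fun p => unit p.1 p.2).sum) (h1 : star x * x = 1) :
    (s.map Prod.snd).Nodup := by
  have hnonneg : ∀ a b : Word m r t, 0 ≤ unit a b := fun a b =>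
    LeavittMatrix.nonneg_iff.2 (unit_mem_posCone a b)
  rw [Multiset.nodup_iff_le]
  intro b hb
  obtain ⟨p, hp, rfl⟩ := Multiset.mem_map.1
    ((Multiset.cons_subset.1 (Multiset.subset_of_le hb)).1)
  obtain ⟨s, rfl⟩ := Multiset.exists_cons_of_mem hp
  rw [Multiset.map_cons, Multiset.cons_le_cons_iff] at hb
  obtain ⟨q, hq, hqp⟩ := Multiset.mem_map.1
    ((Multiset.cons_subset.1 (Multiset.subset_of_le hb)).1)
  obtain ⟨s, rfl⟩ := Multiset.exists_cons_of_mem hq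
  obtain ⟨a, b⟩ := p
  obtain ⟨c, d⟩ := q
  obtain rfl : d = b := hqp
  simp only [Multiset.map_cons, Multiset.sum_cons] at hx
  set w := (s.map fun p => unit p.1 p.2).sum with hw
  have hw0 : 0 ≤ w := LeavittMatrix.nonneg_iff.2 (AddSubmonoid.multiset_sum_mem _ _ (by
    intro z hz
    obtain ⟨q, -, rfl⟩ := Multiset.mem_map.1 hz
    exact unit_mem_posCone _ _))
  have hws := LeavittMatrix.star_nonneg hw0
  have h2 : 1 - unit d d - unit d d = unit d a * (unit c d + w) + unit d c * (unit a d + w) +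
      star w * (unit a d + (unit c d + w)) := by
    rw [← h1, hx, star_add, star_add, star_unit, star_unit]
    nth_rewrite 1 [← unit_mul_unit d a d]
    rw [← unit_mul_unit d c d]
    noncomm_ring
  have h3 : 0 ≤ 1 - unit d d - unit d d := by
    rw [h2]
    exact add_nonneg (add_nonneg (mul_nonneg (hnonneg _ _) (add_nonneg (hnonneg _ _) hw0))
      (mul_nonneg (hnonneg _ _) (add_nonneg (hnonneg _ _) hw0)))
      (mul_nonneg hws (add_nonneg (hnonneg _ _) (add_nonneg (hnonneg _ _) hw0)))
  have h4 := mul_nonneg (hnonneg d d) h3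
  rw [mul_sub, mul_sub, mul_one, unit_mul_unit, sub_self, zero_sub] at h4
  exact unit_ne_zero hr d d (le_antisymm (neg_nonneg.1 h4) (hnonneg d d))

/-- The columns of a positive unitary matrix are single matrix units. -/
theorem exists_graph (hr : 1 ≤ r) {x : LeavittMatrix m r t} (hx : 0 ≤ x) (h1 : star x * x = 1) :
    ∃ G : Finset (Word m r t × Word m r t), Set.InjOn Prod.snd (G : Set (Word m r t × Word m r t)) ∧
      IsBasis (G.image Prod.snd) ∧ x = ∑ p ∈ G, unit p.1 p.2 := by
  obtain ⟨N, hN⟩ := exists_mem_levelCone (LeavittMatrix.nonneg_iff.1 hx)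
  obtain ⟨s, hsN, hxs⟩ : ∃ s : Multiset (Word m r t × Word m r t),
      (∀ p ∈ s, ∀ l, (p.2.2 l).length = N) ∧ x = (s.map fun p => unit p.1 p.2).sum := by
    clear hx h1
    induction hN using AddSubmonoid.closure_induction with
    | mem x hx =>
      obtain ⟨a, b, hb, rfl⟩ := hx
      exact ⟨{(a, b)}, by simpa using hb, by simp⟩
    | zero => exact ⟨0, by simp, by simp⟩
    | add x y _ _ hx hy =>
      obtain ⟨s, hs, rfl⟩ := hx
      obtain ⟨s', hs', rfl⟩ := hy
      refine ⟨s + s', fun p hp => ?_, by simp⟩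
      exact (Multiset.mem_add.1 hp).elim (hs p) (hs' p)
  have hnodup := nodup_snd_of_star_mul_self hr hxs h1
  let G : Finset (Word m r t × Word m r t) := ⟨s, hnodup.of_map _⟩
  have hxG : x = ∑ p ∈ G, unit p.1 p.2 := hxs
  obtain ⟨A, hA, hAN⟩ := exists_basis_lengths (m := m) (r := r) fun _ : Fin t => N
  have hGA : G.image Prod.snd = A := by
    ext b
    constructor
    · intro hb
      obtain ⟨p, hp, rfl⟩ := Finset.mem_image.1 hb
      exact (hAN _).2 (hsN p hp)
    · intro hb
      by_contra hnb
      apply unit_ne_zero hr b b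
      rw [← one_mul (unit b b), ← h1, mul_assoc]
      convert mul_zero (star x)
      rw [hxG, Finset.sum_mul]
      refine Finset.sum_eq_zero fun p hp => ?_
      exact hA.indep.unit_mul_unit_of_ne ((hAN _).2 (hsN p hp)) hb
        (fun h => hnb (h ▸ Finset.mem_image_of_mem _ hp)) _ _
  exact ⟨G, fun p hp q hq h => Multiset.inj_on_of_nodup_map hnodup p hp q hq h, hGA ▸ hA, hxG⟩

theorem mul_unit_of_graph {G : Finset (Word m r t × Word m r t)}
    (hG : Set.InjOn Prod.snd (G : Set (Word m r t × Word m r t))) (hI : Indep (G.image Prod.snd))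
    {p : Word m r t × Word m r t} (hp : p ∈ G) (c : Word m r t) :
    (∑ q ∈ G, unit q.1 q.2) * unit p.2 c = unit p.1 c := by
  rw [Finset.sum_mul, Finset.sum_eq_single p]
  · exact unit_mul_unit _ _ _
  · intro q hq hqp
    exact hI.unit_mul_unit_of_ne (Finset.mem_image_of_mem _ hq)
      (Finset.mem_image_of_mem _ hp) (fun h => hqp (hG hq hp h)) _ _
  · exact fun h => absurd hp h

/-- An independent set whose projections sum to `1` can be expanded to a basis: once all the
words have the same length in all components, none can be missing. -/
theorem exists_basisBij_of_sum_unit (hr : 1 ≤ r) (M : ℕ) {G : Finset (Word m r t × Word m r t)}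
    (hfst : Set.InjOn Prod.fst (G : Set (Word m r t × Word m r t)))
    (hsnd : Set.InjOn Prod.snd (G : Set (Word m r t × Word m r t)))
    (hI : Indep (G.image Prod.fst)) (hB : IsBasis (G.image Prod.snd))
    (hM : ∀ p ∈ G, ∀ l, (p.1.2 l).length ≤ M) (hone : ∑ p ∈ G, unit p.1 p.1 = 1) :
    ∃ φ : BasisBij m r t, φ.toMatrix = ∑ p ∈ G, unit p.1 p.2 := by
  -- an expansion replaces a summand `(r + 1) ^ (k + 1)` by `r` summands `(r + 1) ^ k`
  obtain ⟨k, hk⟩ : ∃ k, ∑ p ∈ G, (r + 1) ^ (∑ l, (M - (p.1.2 l).length)) = k := ⟨_, rfl⟩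
  induction k using Nat.strong_induction_on generalizing G with
  | h k ih =>
  by_cases hfull : ∀ p ∈ G, ∀ l, (p.1.2 l).length = M
  · obtain ⟨A, hA, hAM⟩ := exists_basis_lengths (m := m) (r := r) fun _ : Fin t => M
    have hGA : G.image Prod.fst = A := by
      ext a
      constructor
      · intro ha
        obtain ⟨p, hp, rfl⟩ := Finset.mem_image.1 ha
        exact (hAM _).2 (hfull p hp)
      · intro ha
        by_contra hna
        apply unit_ne_zero hr a a
        rw [← mul_one (unit a a), ← hone, Finset.mul_sum]
        refine Finset.sum_eq_zero fun p hp => ?_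
        exact hA.indep.unit_mul_unit_of_ne ha ((hAM _).2 (hfull p hp))
          (fun h => hna (h ▸ Finset.mem_image_of_mem _ hp)) _ _
    exact ⟨⟨G, hfst, hsnd, hGA ▸ hA, hB⟩, rfl⟩
  · push Not at hfull
    obtain ⟨p, hp, l, hl⟩ := hfull
    have hlt : (p.1.2 l).length < M := lt_of_le_of_ne (hM p hp l) hl
    have hI' : Indep ((expand₂ l p G).image Prod.fst) := by
      rw [image_expand₂ Prod.fst (fun _ _ => rfl) hfst hp]
      exact hI.expand (Finset.mem_image_of_mem _ hp) l
    have hB' : IsBasis ((expand₂ l p G).image Prod.snd) := by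
      rw [image_expand₂ Prod.snd (fun _ _ => rfl) hsnd hp]
      exact hB.expand l (Finset.mem_image_of_mem _ hp)
    have hM' : ∀ q ∈ expand₂ l p G, ∀ i, (q.1.2 i).length ≤ M := by
      intro q hq i
      rcases mem_expand₂.1 hq with ⟨_, hq⟩ | ⟨j, rfl⟩
      · exact hM q hq i
      · rw [app₂, length_app_letter]
        have := hM p hp i
        split_ifs with h
        · subst h; omega
        · omega
    have hmeas : ∑ q ∈ expand₂ l p G, (r + 1) ^ (∑ i, (M - (q.1.2 i).length)) < k := by
      have hexp : ∀ j, ∑ i, (M - (p.1.2 i).length) =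
          ∑ i, (M - ((app p.1 (letter l j)).2 i).length) + 1 := by
        intro j
        have h : ∑ i, (M - (p.1.2 i).length) =
            ∑ i, (M - ((app p.1 (letter l j)).2 i).length) + ∑ i, if i = l then 1 else 0 := by
          rw [← Finset.sum_add_distrib]
          refine Finset.sum_congr rfl fun i _ => ?_
          rw [length_app_letter]
          split_ifs with h
          · subst h; omega
          · omega
        simpa using h
      set e := ∑ i, (M - (p.1.2 i).length) with he
      have h1 : ∑ q ∈ Finset.univ.image (fun j => app₂ p (letter l j)),
          (r + 1) ^ (∑ i, (M - (q.1.2 i).length)) ≤ r * (r + 1) ^ (e - 1) := by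
        refine (Finset.sum_le_card_nsmul _ _ ((r + 1) ^ (e - 1)) fun q hq => ?_).trans ?_
        · obtain ⟨j, -, rfl⟩ := Finset.mem_image.1 hq
          rw [hexp j, Nat.add_sub_cancel]
          rfl
        · rw [smul_eq_mul]
          refine Nat.mul_le_mul_right _ (Finset.card_image_le.trans_eq ?_)
          simp
      have h2 : r * (r + 1) ^ (e - 1) < (r + 1) ^ e := by
        rw [hexp ⟨0, hr⟩, Nat.add_sub_cancel, pow_succ, mul_comm]
        exact Nat.mul_lt_mul_of_pos_left (Nat.lt_succ_self r) (by positivity)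
      have h3 := Finset.sum_erase_add G (fun q => (r + 1) ^ (∑ i, (M - (q.1.2 i).length))) hp
      have h4 := Finset.sum_union_inter (s₁ := G.erase p)
        (s₂ := Finset.univ.image fun j => app₂ p (letter l j))
        (f := fun q => (r + 1) ^ (∑ i, (M - (q.1.2 i).length)))
      rw [expand₂]
      simp only [← he] at h3
      omega
    obtain ⟨φ, hφ⟩ := ih _ hmeas (injOn_expand₂ Prod.fst (fun _ _ => rfl) hfst hI hp l)
      (injOn_expand₂ Prod.snd (fun _ _ => rfl) hsnd hB.indep hp l) hI' hB' hM'
      ((sum_unit_expand₂ hfst hI hp l (fun q => unit q.1 q.1)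
        (sum_unit_app_letter p.1 p.1 l)).trans hone) rfl
    exact ⟨φ, hφ.trans (sum_unit_expand₂ hfst hI hp l (fun q => unit q.1 q.2)
      (sum_unit_app_letter p.1 p.2 l))⟩

theorem exists_toMatrix_eq (hr : 1 ≤ r) {x : LeavittMatrix m r t} (hx : 0 ≤ x)
    (hxu : x ∈ unitary (LeavittMatrix m r t)) : ∃ φ : BasisBij m r t, φ.toMatrix = x := by
  obtain ⟨h1, h2⟩ := Unitary.mem_iff.1 hxu
  obtain ⟨G, hsnd, hB, hxG⟩ := exists_graph hr hx h1
  have hxp : ∀ p ∈ G, ∀ c, x * unit p.2 c = unit p.1 c := fun p hp c => by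
    rw [hxG]
    exact mul_unit_of_graph hsnd hB.indep hp c
  have hpx : ∀ p ∈ G, ∀ c, unit c p.2 * star x = unit c p.1 := fun p hp c => by
    rw [← star_unit, ← star_mul, hxp p hp c, star_unit]
  -- `x* x = 1` makes the projections `y_a x_a` orthogonal
  have key : ∀ p ∈ G, ∀ q ∈ G, ∀ u v, app p.1 u = app q.1 v → p = q := by
    intro p hp q hq u v huv
    by_contra hpq
    apply unit_mul_ne_zero hr huv (a := p.2) (d := q.2)
    rw [← hpx p hp, ← hxp q hq, mul_assoc, ← mul_assoc (star x), h1, one_mul]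
    exact hB.indep.unit_mul_unit_of_ne (Finset.mem_image_of_mem _ hp)
      (Finset.mem_image_of_mem _ hq) (fun h => hpq (hsnd hp hq h)) _ _
  have hone : ∑ p ∈ G, unit p.1 p.1 = 1 := by
    rw [← h2]
    conv_rhs => rw [hxG, Finset.sum_mul, ← hxG]
    exact Finset.sum_congr rfl fun p hp => (hpx p hp p.1).symm
  rw [hxG]
  refine exists_basisBij_of_sum_unit hr
    (G.sup fun p => Finset.univ.sup fun l => (p.1.2 l).length) ?_ hsnd ?_ hB ?_ hone
  · exact fun p hp q hq h => key p hp q hq (fun _ => []) (fun _ => []) (congrArg (app · _) h)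
  · intro a ha b hb u v h
    obtain ⟨p, hp, rfl⟩ := Finset.mem_image.1 ha
    obtain ⟨q, hq, rfl⟩ := Finset.mem_image.1 hb
    rw [key p hp q hq u v h]
  · intro p hp l
    exact (Finset.le_sup (f := fun l => (p.1.2 l).length) (Finset.mem_univ l)).trans
      (Finset.le_sup (f := fun p : Word m r t × Word m r t =>
        Finset.univ.sup fun l => (p.1.2 l).length) hp)

end BrinHigmanThompson

namespace BrinHigmanThompsonGroup

open BrinHigmanThompson BrinHigmanThompson.BasisBij

variable {m r t : ℕ}

/-- The Brin-Higman-Thompson group is the group of positive unitary matrices. -/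
def mulEquivPU (hr : 2 ≤ r) : BrinHigmanThompsonGroup t r m ≃* LeavittMatrix.PU m r t :=
  MulEquiv.ofBijective
    (⟨⟨fun g => ⟨⟨toMatrix g, toMatrix_mem_unitary g⟩, toMatrix_nonneg g⟩,
      Subtype.ext (Subtype.ext toMatrix_one)⟩,
      fun g h => Subtype.ext (Subtype.ext (toMatrix_mul g h))⟩ :
      BrinHigmanThompsonGroup t r m →* LeavittMatrix.PU m r t)
    ⟨fun g h hgh => toMatrix_injective hr
        (congrArg (fun u : LeavittMatrix.PU m r t => (u.1 : LeavittMatrix m r t)) hgh),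
      fun u => by
        obtain ⟨φ, hφ⟩ := exists_toMatrix_eq (by omega) u.2 u.1.2
        exact ⟨φ.toGroup, Subtype.ext (Subtype.ext hφ)⟩⟩

end BrinHigmanThompsonGroup

end

theorem mainTheorem3 (r m m' t : ℕ) (hr : 2 ≤ r) (hm : 1 ≤ m) (hm' : 1 ≤ m') (ht : 1 ≤ t)
    (hgcd : Nat.gcd m' (r - 1) = Nat.gcd m (r - 1)) :
    (∃ f : LeavittMatrix m' r t ≃⋆+* LeavittMatrix m r t, ∀ a b, f a ≤ f b ↔ a ≤ b) ∧
      Nonempty (LeavittMatrix.PU m' r t ≃* LeavittMatrix.PU m r t) ∧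
      Nonempty (BrinHigmanThompsonGroup t r m' ≃* BrinHigmanThompsonGroup t r m) := by
  have h := LeavittMatrix.orderIsomorphic_of_gcd_eq hr ht hm hm' hgcd
  obtain ⟨e⟩ := h.nonempty_PU_mulEquiv
  exact ⟨h, ⟨e⟩, ⟨(BrinHigmanThompsonGroup.mulEquivPU hr).trans
    (e.trans (BrinHigmanThompsonGroup.mulEquivPU hr).symm)⟩⟩
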